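/- **Setting.** Let $M=(\mathcal S,\mathcal A,p,r,\gamma)$ be a discounted MDP with finite nonempty $\mathcal S,\mathcal A$, $S=|\mathcal S|$, $A=|\mathcal A|$, rewards $r[s,a]\in[0,1]$, $\gamma\in[0,1)$, and let $\Gamma=(1-\gamma)^{-1}$. A quantum generative model of $M$ is a unitary $\mathcal O$ on $\mathbb C^{S}\otimes\mathbb C^{A}\otimes\mathbb C^{S}\otimes\mathbb C^{J}$, $J\ge 1$, with $\mathcal O|s\rangle|a\rangle|0\rangle|0\rangle=|s\rangle|a\rangle\sum_{s'}\sqrt{p(s'|s,a)}\,|s'\rangle|\psi_{s',s,a}\rangle$ for some unit vectors $\psi_{s',s,a}$. A query is one use of $\mathcal O$ or $\mathcal O^{-1}$; everything else (oracle-independent unitaries on a finite workspace, measurements, classical computation that may use $r,\gamma$ but not $p$) is free. Similarly, an oracle encoding of a distribution $p$ on a finite set $\Omega$ is a unitary $U_p$ with $U_p|0\rangle|0\rangle=\sum_x\sqrt{p_x}\,|x\rangle|\psi_x\rangle$, $\psi_x$ unit vectors. Write $\log_+x=\max\{1,\ln x\}$, $v(q)[s]=\max_a q[s,a]$, and let $\pi(q)[s]$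 be a maximiser of $q[s,\cdot]$. **Subroutines.** For real $v$ on $\Omega$ and $\eta>0$, $0<\delta<1$: $\mathsf{qEst1}$ gets an input $u>0$, has the promise $0\le v\le u$, and always makes $O\big((u/\eta+\sqrt{u/\eta})\log_+(1/\delta)\big)$ queries to $U_p$; $\mathsf{qEst2}$ gets an input $\sigma>0$ with $\eta<4\sigma$, has the promise $\mathrm{Var}_p[v]\le\sigma^2$, and always makes $O\big((\sigma/\eta)\log_+^2(\sigma/\eta)\log_+(1/\delta)\big)$ queries. If the promise holds, the output is within $<\eta$ of $p^{\mathsf T}v$ with probability $>1-\delta$. For $v:\mathcal S\to\mathbb R$ write $(Pv)[s,a]=\sum_{s'}p(s'|s,a)v[s']$; $\mathsf{qEst}i_{f}((Pv)[s,a],\eta)$ denotes a call for this mean with error $\eta$ and failure probability $f$, run with $\mathcal O$ on $|s\rangle|a\rangle|0\rangle|0\rangle$. **SolveMdp1**$(M,\epsilon,\delta)$, for $0<\epsilon\le\sqrt\Gamma$, $0<\delta<1$. Put $K=\lceil\log_2(\Gamma/\epsilon)\rceil$, $L=\lceil\Gamma\lceil\ln(4\Gamma/\epsilon)\rceil\rceil+1$,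 $f=\delta/(4KLSA)$, $b=1$, $c=0.01$; $v_{1,0}=0$, $q_{1,0}=0$, $\pi_{1,0}$ arbitrary. For $k=1,\dots,K$, with $\epsilon_k=\Gamma/2^k$: 1. for all $(s,a)$: $y_k[s,a]=\max\{\mathsf{qEst1}_f((Pv_{k,0}^2)[s,a],b)-(\mathsf{qEst1}_f((Pv_{k,0})[s,a],(1-\gamma)b))^2,\,0\}$, with $u=\Gamma^2$ and $u=\Gamma$ respectively; 2. for all $(s,a)$: $x_k[s,a]=\mathsf{qEst2}_f((Pv_{k,0})[s,a],\eta)-\eta$ with $\eta=c(1-\gamma)^{1.5}\epsilon\sqrt{y_k[s,a]+b}$ and $\sigma=2\sqrt{y_k[s,a]+b}$; 3. for $l=1,\dots,L$: for each $s$, if $v(q_{k,l-1})[s]\ge v_{k,l-1}[s]$ then $v_{k,l}[s]=v(q_{k,l-1})[s]$, $\pi_{k,l}[s]=\pi(q_{k,l-1})[s]$, else $v_{k,l}[s]=v_{k,l-1}[s]$, $\pi_{k,l}[s]=\pi_{k,l-1}[s]$; for all $(s,a)$, $\Delta_{k,l}[s,a]=\mathsf{qEst1}_f((P(v_{k,l}-v_{k,0}))[s,a],c(1-\gamma)\epsilon_k)-c(1-\gamma)\epsilon_k$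 with $u=2\epsilon_k$; $q_{k,l}=\max\{r+\gamma(x_k+\Delta_{k,l}),0\}$; 4. $(v,\pi,q)_{k+1,0}=(v,\pi,q)_{k,L}$. The output is the final $(v,\pi,q)$. **Theorem (complexity of SolveMdp1).** There are quantum algorithms $\mathsf{qEst1}$, $\mathsf{qEst2}$ with the above specifications such that, with them as subroutines, the following holds. (i) There is a universal constant $C$ such that for all $M$, $\mathcal O$, $\epsilon\in(0,\sqrt\Gamma]$, $\delta\in(0,1)$ and $\pi_{1,0}$, every execution of SolveMdp1 makes at most $$C\,SA\Big(\frac{\Gamma^{1.5}}{\epsilon}+\Gamma^2\Big)\log_+^4\!\Big(\frac{\Gamma}{\epsilon}\Big)\log_+\!\Big(\frac{SA\Gamma}{\delta}\Big)$$ queries to $\mathcal O$; moreover, with probability at least $1-\delta$, all calls of $\mathsf{qEst1}$ and $\mathsf{qEst2}$ satisfy their promises and return estimates that are within the specified errors. (ii) For every $\kappa>0$ there is a constant $C_\kappa$ such that, if in addition $\epsilon\le\kappa/\sqrt\Gamma$, every execution makes at most $C_\kappa\,SA\,\Gamma^{1.5}\epsilon^{-1}\log_+^4(\Gamma/\epsilon)\log_+(SA\Gamma/\delta)$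 queries, i.e. $\widetilde O(SA\Gamma^{1.5}/\epsilon)$. -/

import Mathlib

namespace QuantumMDP

/-! ## Finite discounted Markov decision processes -/

/-- An infinite-horizon discounted MDP with finite state set `S` and finite action set `A`.
`p s a s'` is the probability `p(s'|s,a)`. -/
structure MDP (S A : Type) [Fintype S] where
  p : S → A → S → ℝ
  p_nonneg : ∀ s a s', 0 ≤ p s a s'
  p_sum : ∀ s a, ∑ s', p s a s' = 1
  r : S → A → ℝ
  r_nonneg : ∀ s a, 0 ≤ r s a
  r_le_one : ∀ s a, r s a ≤ 1
  γ : ℝ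
  γ_nonneg : 0 ≤ γ
  γ_lt_one : γ < 1

/-- The effective time horizon `Γ = (1 - γ)⁻¹` of a discount factor. -/
noncomputable def horizon (γ : ℝ) : ℝ := (1 - γ)⁻¹

/-- Mean of `v` under the weights `p`. -/
def mean {Ω : Type} [Fintype Ω] (p v : Ω → ℝ) : ℝ := ∑ x, p x * v x

/-- Variance of `v` under the weights `p`. -/
def variance {Ω : Type} [Fintype Ω] (p v : Ω → ℝ) : ℝ :=
  ∑ x, p x * (v x - mean p v) ^ 2

/-! ## Quantum query programs

The oracle acts on the register with computational basis `X`. A program may adjoin any finite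
workspace `B`, apply arbitrary oracle-independent unitaries, query the oracle or its inverse,
measure everything in the computational basis, and continue adaptively. -/

/-- One gate of a circuit on the oracle register `X` and the workspace `B`. -/
inductive Gate (X B : Type) [Fintype X] [DecidableEq X] [Fintype B] [DecidableEq B] where
  | fixed (V : Matrix.unitaryGroup (X × B) ℂ)
  | query
  | queryInv

section Circuits

variable {X B : Type} [Fintype X] [DecidableEq X] [Fintype B] [DecidableEq B]

/-- The number of oracle queries made by one gate. -/
def Gate.cost : Gate X B → ℕ
  | .fixed _ => 0
  | .query => 1
  | .queryInv => 1

/-- The unitary `U ⊗ 1`. -/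
def extend (B : Type) [Fintype B] [DecidableEq B] (U : Matrix.unitaryGroup X ℂ) :
    Matrix.unitaryGroup (X × B) ℂ :=
  ⟨Matrix.kronecker U.1 (1 : Matrix B B ℂ),
    Matrix.kronecker_mem_unitary U.2 (one_mem _)⟩

/-- The unitary implemented by one gate when the oracle is `U`. -/
def Gate.eval (U : Matrix.unitaryGroup X ℂ) : Gate X B → Matrix.unitaryGroup (X × B) ℂ
  | .fixed V => V
  | .query => extend B U
  | .queryInv => extend B U⁻¹

/-- The unitary implemented by a circuit; the head of the list is applied first. -/
def evalCircuit (U : Matrix.unitaryGroup X ℂ) : List (Gate X B) → Matrix.unitaryGroup (X × B) ℂ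
  | [] => 1
  | g :: gs => evalCircuit U gs * g.eval U

/-- The number of oracle queries made by a circuit. -/
def circuitCost (gs : List (Gate X B)) : ℕ := (gs.map Gate.cost).sum

theorem born_sum {Y : Type} [Fintype Y] [DecidableEq Y] (V : Matrix.unitaryGroup Y ℂ) (y₀ : Y) :
    ∑ y, ENNReal.ofReal (‖V.1 y y₀‖ ^ 2) = 1 := by
  rw [← ENNReal.ofReal_sum_of_nonneg (fun _ _ => by positivity), ← ENNReal.ofReal_one]
  congr 1
  have h := congrFun (congrFun (Matrix.UnitaryGroup.star_mul_self V) y₀) y₀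
  rw [Matrix.mul_apply, Matrix.one_apply_eq] at h
  have h2 : ((∑ y, ‖V.1 y y₀‖ ^ 2 : ℝ) : ℂ) = 1 := by
    rw [← h]
    push_cast
    refine Finset.sum_congr rfl fun y _ => ?_
    rw [Matrix.star_apply]
    exact (Complex.conj_mul' _).symm
  exact_mod_cast h2

/-- Born rule: distribution of the outcome of measuring `V|y₀⟩` in the computational basis. -/
noncomputable def born {Y : Type} [Fintype Y] [DecidableEq Y] (V : Matrix.unitaryGroup Y ℂ)
    (y₀ : Y) : PMF Y :=
  PMF.ofFintype (fun y => ENNReal.ofReal (‖V.1 y y₀‖ ^ 2)) (born_sum V y₀)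

end Circuits

/-- Adaptive quantum query programs with oracle register `X` and output in `α`:
either return, or run a circuit from a computational basis state, measure, and continue
depending on the outcome. The oracle itself is not available to the program. -/
inductive QProg (X : Type) [Fintype X] [DecidableEq X] (α : Type) : Type 1 where
  | ret (a : α) : QProg X α
  | run (B : Type) [Fintype B] [DecidableEq B] (circuit : List (Gate X B)) (init : X × B)
      (next : X × B → QProg X α) : QProg X α

section Programs

variable {X : Type} [Fintype X] [DecidableEq X] {α β : Type}

/-- Sequential composition. -/
def QProg.bind : QProg X α → (α → QProg X β) → QProg X β
  | .ret a, f => f a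
  | @QProg.run _ _ _ _ B _ _ circuit init next, f =>
      .run B circuit init fun z => (next z).bind f

/-- Joint distribution of the output and the number of queries when the oracle is `U`. -/
noncomputable def QProg.exec (U : Matrix.unitaryGroup X ℂ) : QProg X α → PMF (α × ℕ)
  | .ret a => PMF.pure (a, 0)
  | @QProg.run _ _ _ _ _ _ _ circuit init next =>
      (born (evalCircuit U circuit) init).bind fun z =>
        ((next z).exec U).map fun w => (w.1, circuitCost circuit + w.2)

end Programs

/-! ## Quantum mean estimation -/

/-- `U` is a quantum oracle encoding of the distribution `p`:
`U |x₀⟩|j₀⟩ = ∑ₓ √pₓ |x⟩|ψₓ⟩` with unit vectors `ψₓ`. -/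
def Encodes {Ω J : Type} [Fintype Ω] [DecidableEq Ω] [Fintype J] [DecidableEq J]
    (p : Ω → ℝ) (x₀ : Ω) (j₀ : J) (U : Matrix.unitaryGroup (Ω × J) ℂ) : Prop :=
  ∃ ψ : Ω → J → ℂ, (∀ x, ∑ j, ‖ψ x j‖ ^ 2 = 1) ∧
    ∀ x j, U.1 (x, j) (x₀, j₀) = (Real.sqrt (p x) : ℂ) * ψ x j

/-- A mean estimation procedure: for every register `Ω × J` with initial basis state `(x₀, j₀)`,
function `v`, scale `u`, target error and failure probability (in this order), a quantum query
program that outputs a real number. It has no access to the distribution except by queries. -/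
abbrev MeanEstimator : Type 1 :=
  ∀ (Ω J : Type) [Fintype Ω] [DecidableEq Ω] [Fintype J] [DecidableEq J],
    Ω → J → (Ω → ℝ) → ℝ → ℝ → ℝ → QProg (Ω × J) ℝ

/-- `max {1, ln x}`. -/
noncomputable def logp (x : ℝ) : ℝ := max 1 (Real.log x)

/-- `E` is a mean estimator for functions with `0 ≤ v ≤ u`: it always makes
`O((u/η + √(u/η)) log(1/δ))` queries, with constant `c`, and on inputs that satisfy the promise
its output is within `η` of the mean with probability more than `1 - δ`. -/
def IsQEst1 (c : ℝ) (E : MeanEstimator) : Prop :=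
  ∀ (Ω J : Type) [Fintype Ω] [DecidableEq Ω] [Fintype J] [DecidableEq J]
    (x₀ : Ω) (j₀ : J) (v : Ω → ℝ) (u η δ : ℝ) (U : Matrix.unitaryGroup (Ω × J) ℂ),
    0 < u → 0 < η → 0 < δ → δ < 1 →
    (∀ w ∈ ((E Ω J x₀ j₀ v u η δ).exec U).support,
      (w.2 : ℝ) ≤ c * (u / η + Real.sqrt (u / η)) * logp (1 / δ)) ∧
    ∀ p : Ω → ℝ, (∀ x, 0 ≤ p x) → ∑ x, p x = 1 → Encodes p x₀ j₀ U →
      (∀ x, 0 ≤ v x ∧ v x ≤ u) →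
      ENNReal.ofReal (1 - δ) <
        ((E Ω J x₀ j₀ v u η δ).exec U).toOuterMeasure {w | |w.1 - mean p v| < η}

/-- `E` is a mean estimator for functions with variance at most `σ²`: for `0 < η < 4σ` it always
makes `O((σ/η) log²(σ/η) log(1/δ))` queries, with constant `c`, and on inputs that satisfy the
promise its output is within `η` of the mean with probability more than `1 - δ`. -/
def IsQEst2 (c : ℝ) (E : MeanEstimator) : Prop :=
  ∀ (Ω J : Type) [Fintype Ω] [DecidableEq Ω] [Fintype J] [DecidableEq J]
    (x₀ : Ω) (j₀ : J) (v : Ω → ℝ) (σ η δ : ℝ) (U : Matrix.unitaryGroup (Ω × J) ℂ),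
    0 < σ → 0 < η → η < 4 * σ → 0 < δ → δ < 1 →
    (∀ w ∈ ((E Ω J x₀ j₀ v σ η δ).exec U).support,
      (w.2 : ℝ) ≤ c * (σ / η * logp (σ / η) ^ 2) * logp (1 / δ)) ∧
    ∀ p : Ω → ℝ, (∀ x, 0 ≤ p x) → ∑ x, p x = 1 → Encodes p x₀ j₀ U →
      variance p v ≤ σ ^ 2 →
      ENNReal.ofReal (1 - δ) <
        ((E Ω J x₀ j₀ v σ η δ).exec U).toOuterMeasure {w | |w.1 - mean p v| < η}

/-! ## Classical programs with mean-estimation calls -/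

/-- A call of `qEst1` or `qEst2` for the mean of `v` under `p(·|s,a)`, with failure probability
`δ` and error `η`; `u` (resp. `σ`) is the bound on the range (resp. standard deviation) that the
subroutine requires as an input. -/
inductive Call (S A : Type) where
  | qEst1 (δ : ℝ) (s : S) (a : A) (v : S → ℝ) (u η : ℝ)
  | qEst2 (δ : ℝ) (s : S) (a : A) (v : S → ℝ) (σ η : ℝ)

/-- Programs whose only access to the transition probabilities is through calls. -/
inductive EstProg (S A α : Type) where
  | ret (a : α) : EstProg S A α
  | call (c : Call S A) (next : ℝ → EstProg S A α) : EstProg S A α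

section EstPrograms

variable {S A α β ι : Type}

/-- Sequential composition. -/
def EstProg.bind : EstProg S A α → (α → EstProg S A β) → EstProg S A β
  | .ret a, f => f a
  | .call c next, f => .call c fun x => (next x).bind f

instance : Monad (EstProg S A) where
  pure := EstProg.ret
  bind := EstProg.bind

/-- The program that makes one call and returns the answer. -/
def estimate (c : Call S A) : EstProg S A ℝ := .call c .ret

/-- Run `f i` for all `i` in a list and collect the results. -/
def sweepList [DecidableEq ι] (f : ι → EstProg S A ℝ) : List ι → EstProg S A (ι → ℝ)
  | [] => pure fun _ => 0
  | i :: is => do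
      let x ← f i
      let g ← sweepList f is
      pure (Function.update g i x)

/-- Run `f i` once for every `i : ι` and collect the results. -/
noncomputable def sweep [Fintype ι] [DecidableEq ι] (f : ι → EstProg S A ℝ) :
    EstProg S A (ι → ℝ) :=
  sweepList f Finset.univ.toList

/-- `for i ∈ {1, …, n}` with loop variable `i` and mutable state. -/
def forLoop (body : ℕ → α → EstProg S A α) : ℕ → α → EstProg S A α
  | 0, st => pure st
  | n + 1, st => do
      let st' ← forLoop body n st
      body (n + 1) st'

end EstPrograms

/-! ## The algorithm -/

/-- The variables `v`, `π`, `q` of the algorithm. -/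
structure Vars (S A : Type) where
  v : S → ℝ
  π : S → A
  q : S × A → ℝ

section Algorithm

variable {S A : Type} [Fintype S] [DecidableEq S] [Fintype A] [DecidableEq A] [Nonempty A]

/-- A maximiser of `q[s, ·]`. -/
noncomputable def greedy (q : S × A → ℝ) (s : S) : A :=
  (Finite.exists_max fun a : A => q (s, a)).choose

/-- `v(q)[s] = max_a q[s, a]`. -/
noncomputable def maxValue (q : S × A → ℝ) (s : S) : ℝ :=
  Finset.univ.sup' Finset.univ_nonempty fun a : A => q (s, a)

/-- The if-then-else update of `v` and `π`. -/
noncomputable def improve (st : Vars S A) : Vars S A where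
  v s := if st.v s ≤ maxValue st.q s then maxValue st.q s else st.v s
  π s := if st.v s ≤ maxValue st.q s then greedy st.q s else st.π s
  q := st.q

/-- The number of epochs `K = ⌈log₂(Γ/ε)⌉`. -/
noncomputable def epochs (γ ε : ℝ) : ℕ := ⌈Real.logb 2 (horizon γ / ε)⌉₊

/-- The number of iterations per epoch `L = ⌈Γ ⌈ln(4Γ/ε)⌉⌉ + 1`. -/
noncomputable def iterations (γ ε : ℝ) : ℕ :=
  ⌈horizon γ * ⌈Real.log (4 * horizon γ / ε)⌉₊⌉₊ + 1

/-- Body of the inner loop, with anchor `v₀ = v_{k,0}`, the vector `x = x_k`, and failure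
probability `f`. -/
noncomputable def innerStep (r : S → A → ℝ) (γ f c εk : ℝ) (v₀ : S → ℝ) (x : S × A → ℝ)
    (st : Vars S A) : EstProg S A (Vars S A) := do
  let st' := improve st
  let Δ ← sweep fun sa : S × A => do
    let m ← estimate (.qEst1 f sa.1 sa.2 (fun s => st'.v s - v₀ s)
      (2 * εk) (c * (1 - γ) * εk))
    pure (m - c * (1 - γ) * εk)
  pure { st' with q := fun sa => max (r sa.1 sa.2 + γ * (x sa + Δ sa)) 0 }

/-- Body of the outer loop (epoch `k`). -/
noncomputable def epoch (r : S → A → ℝ) (γ ε f b c : ℝ) (L : ℕ) (k : ℕ) (st : Vars S A) :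
    EstProg S A (Vars S A) := do
  let εk := horizon γ / 2 ^ k
  let y ← sweep fun sa : S × A => do
    let m₂ ← estimate (.qEst1 f sa.1 sa.2 (fun s => st.v s ^ 2) (horizon γ ^ 2) b)
    let m₁ ← estimate (.qEst1 f sa.1 sa.2 st.v (horizon γ) ((1 - γ) * b))
    pure (max (m₂ - m₁ ^ 2) 0)
  let x ← sweep fun sa : S × A => do
    let η := c * (1 - γ) ^ (3 / 2 : ℝ) * ε * Real.sqrt (y sa + b)
    let m ← estimate (.qEst2 f sa.1 sa.2 st.v (2 * Real.sqrt (y sa + b)) η)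
    pure (m - η)
  forLoop (fun _ => innerStep r γ f c εk st.v x) L st

/-- The algorithm `SolveMdp1`. Its inputs are the known data `r`, `γ` of the MDP, the accuracy
`ε`, the failure probability `δ`, and the arbitrary initial policy `π₀`. -/
noncomputable def solveMdp1 (r : S → A → ℝ) (γ ε δ : ℝ) (π₀ : S → A) :
    EstProg S A (Vars S A) :=
  let K := epochs γ ε
  let L := iterations γ ε
  let f := δ / (4 * K * L * Fintype.card S * Fintype.card A)
  forLoop (epoch r γ ε f 1 (1 / 100) L) K { v := fun _ => 0, π := π₀, q := fun _ => 0 }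

end Algorithm

/-! ## Execution with the quantum generative model -/

section Execution

variable {S A W : Type} [Fintype S] [DecidableEq S] [Fintype A] [DecidableEq A]
  [Fintype W] [DecidableEq W]

/-- `O` is a quantum generative model of `M`:
`O |s⟩|a⟩|0⟩|0⟩ = |s⟩|a⟩ ∑_{s'} √p(s'|s,a) |s'⟩|ψ_{s',s,a}⟩` with unit vectors `ψ`. Here `s₀` and
`w₀` label the basis states `|0⟩` of the last two registers. -/
def IsGenerativeModel (M : MDP S A) (s₀ : S) (w₀ : W)
    (O : Matrix.unitaryGroup (S × A × S × W) ℂ) : Prop :=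
  ∃ ψ : S → S → A → W → ℂ, (∀ s' s a, ∑ w, ‖ψ s' s a w‖ ^ 2 = 1) ∧
    ∀ s a t b s' w, O.1 (t, b, s', w) (s, a, s₀, w₀) =
      if t = s ∧ b = a then (Real.sqrt (M.p s a s') : ℂ) * ψ s' s a w else 0

/-- Reordering of tensor factors that puts the next-state register first. -/
def reorder : S × A × S × W ≃ S × (S × A × W) where
  toFun z := (z.2.2.1, (z.1, z.2.1, z.2.2.2))
  invFun z := (z.2.1, z.2.2.1, z.1, z.2.2.2)
  left_inv _ := rfl
  right_inv _ := rfl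

/-- The same oracle with its tensor factors reordered. -/
def reorderOracle (O : Matrix.unitaryGroup (S × A × S × W) ℂ) :
    Matrix.unitaryGroup (S × (S × A × W)) ℂ :=
  ⟨O.1.submatrix reorder.symm reorder.symm, by
    rw [Matrix.mem_unitaryGroup_iff, Matrix.star_eq_conjTranspose, Matrix.conjTranspose_submatrix,
      Matrix.submatrix_mul_equiv, ← Matrix.star_eq_conjTranspose,
      Matrix.mem_unitaryGroup_iff.mp O.2, Matrix.submatrix_one_equiv]⟩

/-- The mean that a call asks for. -/
def Call.target (M : MDP S A) : Call S A → ℝ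
  | .qEst1 _ s a v _ _ => mean (M.p s a) v
  | .qEst2 _ s a v _ _ => mean (M.p s a) v

/-- The accuracy that a call asks for. -/
def Call.error : Call S A → ℝ
  | .qEst1 _ _ _ _ _ η => η
  | .qEst2 _ _ _ _ _ η => η

/-- The conditions under which the guarantee of the called subroutine applies. -/
def Call.Promise (M : MDP S A) : Call S A → Prop
  | .qEst1 _ _ _ v u η => 0 < u ∧ 0 < η ∧ ∀ x, 0 ≤ v x ∧ v x ≤ u
  | .qEst2 _ s a v σ η => 0 < σ ∧ 0 < η ∧ η < 4 * σ ∧ variance (M.p s a) v ≤ σ ^ 2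

/-- The quantum query program executed for one call: mean estimation on the oracle register
started in `|s⟩|a⟩|0⟩|0⟩`. -/
def Call.toQProg (E₁ E₂ : MeanEstimator) (s₀ : S) (w₀ : W) :
    Call S A → QProg (S × (S × A × W)) ℝ
  | .qEst1 δ s a v u η => E₁ S (S × A × W) s₀ (s, a, w₀) v u η δ
  | .qEst2 δ s a v σ η => E₂ S (S × A × W) s₀ (s, a, w₀) v σ η δ

/-- Implementation of a program by a quantum query program, with `E₁`, `E₂` as the subroutines.
The output is accompanied by the list of all calls made and the answers returned. -/
def EstProg.toQProg (E₁ E₂ : MeanEstimator) (s₀ : S) (w₀ : W) {α : Type} :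
    EstProg S A α → QProg (S × (S × A × W)) (α × List (Call S A × ℝ))
  | .ret a => .ret (a, [])
  | .call c next =>
      (c.toQProg E₁ E₂ s₀ w₀).bind fun x =>
        ((next x).toQProg E₁ E₂ s₀ w₀).bind fun out => .ret (out.1, (c, x) :: out.2)

/-- A possible result of an execution of `SolveMdp1`: the output, the list of calls with their
answers, and the number of oracle queries. -/
structure Outcome (S A : Type) where
  output : Vars S A
  calls : List (Call S A × ℝ)
  queries : ℕ

/-- The distribution of the result of `SolveMdp1(M, ε, δ)` with subroutines `E₁`, `E₂`, when the
quantum generative model is `O`. -/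
noncomputable def runSolveMdp1 [Nonempty A] (E₁ E₂ : MeanEstimator) (M : MDP S A) (s₀ : S) (w₀ : W)
    (O : Matrix.unitaryGroup (S × A × S × W) ℂ) (ε δ : ℝ) (π₀ : S → A) : PMF (Outcome S A) :=
  (((solveMdp1 M.r M.γ ε δ π₀).toQProg E₁ E₂ s₀ w₀).exec (reorderOracle O)).map
    fun w => ⟨w.1.1, w.1.2, w.2⟩

/-- Every estimation call met the promise of its subroutine and was answered to within the
specified error. -/
def Outcome.AllCorrect (M : MDP S A) (ω : Outcome S A) : Prop :=
  ∀ e ∈ ω.calls, e.1.Promise M ∧ |e.2 - e.1.target M| < e.1.error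

end Execution

end QuantumMDP

open QuantumMDP

/-! The proof has two independent halves: the construction of the mean estimators, and an analysis
of the algorithm that uses only their specifications.

Estimators. One query followed by a rotation of a flag qubit by arcsin √f(x) turns the mean of f : Ω
→ [0,1] into a flag probability a = sin² θ. Grover steps rotate by 2θ, and phase estimation with a
sine window of size N recovers sin² θ. The result is recorded as an expected error, E|r - a| ≤ 6√a/N
+ 5/N² (`expect_amplitudeEstimation_le`). Expected errors of several runs simply add, so one Markov
inequality at the end gives constant success probability, which repetition amplifies
(`QProg.lt_prob_boost`). For values in [0,u] it suffices to rescale. For variance σ², a centre m is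
sampled and both signs of (v - m)/σ are cut into dyadic layers. The layer of height 2^j, normalised
to [0,1], has mean a = O(4^(-j)), so 2^j √a is bounded and all layers have comparable error. About
log(σ/η) layers with N of order (σ/η) log(σ/η) give the squared logarithm in the cost.

Correctness. As long as all answers are accurate, each later promise holds (`EstProg.Safe`).
Subtracting its error from an estimate makes it a lower bound, so all iterates stay below the
optimal value v*, and the iteration never decreases v. For the gap v* - v one needs that the errors
accumulated in an epoch are at most ε_k/2. This follows from a supersolution of the Bellman
evaluation inequality along an optimal policy (`MDP.IsOptimal.exists_epoch_supersolution`). It rests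
on the total variance bound, that discounted standard deviations accumulate to O(Γ^1.5) rather than
O(Γ²). Since γ^(L-1) ≤ 1/4, each epoch halves the gap bound (`safe_epoch`), and this bound is what
the promise 0 ≤ v_{k,l} - v_{k,0} ≤ 2ε_k requires.

Accounting. `EstProg.Budget` adds a weight over the calls on every path. With failure probabilities
as weights it gives the union bound δ; with query bounds it gives the complexity. The latter holds
on every path because the precision ratios u/η and σ/η do not depend on earlier answers: y_k and ε_k
cancel. The four powers of log(Γ/ε) come from the number of epochs (one), the logarithms of `qEst2`
(two) and log(1/f) (one). In the second claim, ε√Γ ≤ κ makes Γ² at most κΓ^1.5/ε. -/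

namespace QuantumMDP

open scoped ENNReal

/-! ## Expectations of discrete distributions -/

section Expect

variable {α β : Type}

/-- Expectation of a nonnegative function. -/
noncomputable def expect (μ : PMF α) (f : α → ℝ≥0∞) : ℝ≥0∞ := ∑' a, μ a * f a

theorem expect_pure (a : α) (f : α → ℝ≥0∞) : expect (PMF.pure a) f = f a := by
  classical
  unfold expect
  rw [tsum_eq_single a]
  · simp
  · intro b hb
    simp [PMF.pure_apply, hb]

theorem expect_bind (μ : PMF α) (k : α → PMF β) (f : β → ℝ≥0∞) :
    expect (μ.bind k) f = expect μ fun a => expect (k a) f := by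
  unfold expect
  simp_rw [PMF.bind_apply, ← ENNReal.tsum_mul_right, ← ENNReal.tsum_mul_left]
  rw [ENNReal.tsum_comm]
  simp_rw [mul_assoc]

theorem expect_mono (μ : PMF α) {f g : α → ℝ≥0∞} (h : ∀ a, f a ≤ g a) :
    expect μ f ≤ expect μ g :=
  ENNReal.tsum_le_tsum fun a => by gcongr; exact h a

theorem expect_const (μ : PMF α) (c : ℝ≥0∞) : expect μ (fun _ => c) = c := by
  simp [expect, ENNReal.tsum_mul_right, μ.tsum_coe]

theorem expect_add (μ : PMF α) (f g : α → ℝ≥0∞) :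
    expect μ (fun a => f a + g a) = expect μ f + expect μ g := by
  simp [expect, mul_add, ENNReal.tsum_add]

theorem expect_const_mul (μ : PMF α) (c : ℝ≥0∞) (f : α → ℝ≥0∞) :
    expect μ (fun a => c * f a) = c * expect μ f := by
  simp [expect, ← ENNReal.tsum_mul_left, mul_left_comm]

theorem expect_fintype [Fintype α] (μ : PMF α) (f : α → ℝ≥0∞) :
    expect μ f = ∑ a, μ a * f a := tsum_fintype _

theorem prob_eq_expect (μ : PMF α) (s : Set α) :
    μ.toOuterMeasure s = expect μ (s.indicator 1) := by
  classical
  rw [PMF.toOuterMeasure_apply, expect]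
  refine tsum_congr fun a => ?_
  by_cases h : a ∈ s <;> simp [h]

theorem prob_add_prob_compl (μ : PMF α) (s : Set α) :
    μ.toOuterMeasure s + μ.toOuterMeasure sᶜ = 1 := by
  rw [prob_eq_expect, prob_eq_expect, ← expect_add, ← expect_const μ 1]
  congr 1
  ext a
  by_cases h : a ∈ s <;> simp [h]

theorem markov (μ : PMF α) (f : α → ℝ≥0∞) (t : ℝ≥0∞) :
    t * μ.toOuterMeasure {a | t ≤ f a} ≤ expect μ f := by
  rw [prob_eq_expect, ← expect_const_mul]
  refine expect_mono μ fun a => ?_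
  by_cases h : t ≤ f a <;> simp [h]

theorem prob_map (μ : PMF α) (g : α → β) (s : Set β) :
    (μ.map g).toOuterMeasure s = μ.toOuterMeasure (g ⁻¹' s) := by
  simp [PMF.toOuterMeasure_map_apply]

theorem prob_mono (μ : PMF α) {s t : Set α} (h : s ⊆ t) :
    μ.toOuterMeasure s ≤ μ.toOuterMeasure t := μ.toOuterMeasure.mono h

theorem prob_le_one (μ : PMF α) (s : Set α) : μ.toOuterMeasure s ≤ 1 := by
  rw [← prob_add_prob_compl μ s]; exact le_self_add

/-- Pass from a bound on the failure probability to a bound on the success probability. -/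
theorem lt_prob_of_prob_compl_lt (μ : PMF α) {s : Set α} {δ : ℝ} (hδ0 : 0 < δ) (hδ1 : δ < 1)
    (h : μ.toOuterMeasure sᶜ < ENNReal.ofReal δ) : ENNReal.ofReal (1 - δ) < μ.toOuterMeasure s := by
  by_contra hc
  rw [not_lt] at hc
  have h1 := prob_add_prob_compl μ s
  have h2 : μ.toOuterMeasure s + μ.toOuterMeasure sᶜ
      < ENNReal.ofReal (1 - δ) + ENNReal.ofReal δ :=
    ENNReal.add_lt_add_of_le_of_lt (ne_top_of_le_ne_top ENNReal.one_ne_top (prob_le_one μ s)) hc h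
  rw [h1, ← ENNReal.ofReal_add (by linarith) hδ0.le] at h2
  norm_num at h2

end Expect

/-! ## Output law and worst-case cost of query programs -/

section Law

variable {X : Type} [Fintype X] [DecidableEq X] {α β : Type}

/-- Distribution of the output of a program. -/
noncomputable def QProg.law (U : Matrix.unitaryGroup X ℂ) (P : QProg X α) : PMF α :=
  (P.exec U).map Prod.fst

theorem QProg.law_ret (U : Matrix.unitaryGroup X ℂ) (a : α) :
    (QProg.ret a : QProg X α).law U = PMF.pure a := by
  simp [QProg.law, QProg.exec, PMF.pure_map]

theorem QProg.law_run (U : Matrix.unitaryGroup X ℂ) (B : Type) [Fintype B] [DecidableEq B]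
    (gs : List (Gate X B)) (z₀ : X × B) (next : X × B → QProg X α) :
    (QProg.run B gs z₀ next).law U =
      (born (evalCircuit U gs) z₀).bind fun z => (next z).law U := by
  simp only [QProg.law, QProg.exec, PMF.map_bind, PMF.map_comp]
  rfl

theorem QProg.law_bind (U : Matrix.unitaryGroup X ℂ) (P : QProg X α) (f : α → QProg X β) :
    (P.bind f).law U = (P.law U).bind fun a => (f a).law U := by
  induction P with
  | ret a => simp [QProg.bind, QProg.law_ret]
  | run B gs z₀ next ih =>
    simp only [QProg.bind, QProg.law_run, PMF.bind_bind, ih]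

/-- Every execution path of the program makes at most `n` queries. -/
def QProg.CostLE : QProg X α → ℕ → Prop
  | .ret _, _ => True
  | @QProg.run _ _ _ _ _ _ _ gs _ next, n =>
      ∃ m, circuitCost gs + m ≤ n ∧ ∀ z, (next z).CostLE m

theorem QProg.CostLE.mono {P : QProg X α} {m n : ℕ} (h : P.CostLE m) (hmn : m ≤ n) :
    P.CostLE n := by
  cases P with
  | ret a => trivial
  | run B gs z₀ next =>
    obtain ⟨k, hk, hn⟩ := h
    exact ⟨k, hk.trans hmn, hn⟩

theorem QProg.CostLE.bind {P : QProg X α} {f : α → QProg X β} {m n : ℕ} (hP : P.CostLE m)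
    (hf : ∀ a, (f a).CostLE n) : (P.bind f).CostLE (m + n) := by
  induction P generalizing m with
  | ret a => exact (hf a).mono (Nat.le_add_left n m)
  | run B gs z₀ next ih =>
    obtain ⟨k, hk, hn⟩ := hP
    exact ⟨k + n, by omega, fun z => ih z (hn z)⟩

theorem QProg.CostLE.exec_le {P : QProg X α} {n : ℕ} (hP : P.CostLE n)
    (U : Matrix.unitaryGroup X ℂ) {w : α × ℕ} (hw : w ∈ (P.exec U).support) : w.2 ≤ n := by
  induction P generalizing n w with
  | ret a =>
    simp only [QProg.exec, PMF.support_pure, Set.mem_singleton_iff] at hw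
    simp [hw]
  | run B gs z₀ next ih =>
    obtain ⟨k, hk, hn⟩ := hP
    simp only [QProg.exec, PMF.mem_support_bind_iff, PMF.support_map, Set.mem_image] at hw
    obtain ⟨z, -, w', hw', rfl⟩ := hw
    have := ih z (hn z) hw'
    simp only
    omega

theorem QProg.prob_exec_fst (U : Matrix.unitaryGroup X ℂ) (P : QProg X α) (s : Set α) :
    (P.exec U).toOuterMeasure {w | w.1 ∈ s} = (P.law U).toOuterMeasure s := by
  rw [QProg.law, prob_map]; rfl

end Law

/-! ## Amplification of the success probability -/

section Boost

variable {X : Type} [Fintype X] [DecidableEq X]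

/-- The results of `n` independent runs. -/
def QProg.replicate (P : QProg X ℝ) : ℕ → QProg X (List ℝ)
  | 0 => .ret []
  | n + 1 => P.bind fun x => (P.replicate n).bind fun l => .ret (x :: l)

theorem QProg.CostLE.replicate {P : QProg X ℝ} {m : ℕ} (h : P.CostLE m) (n : ℕ) :
    (P.replicate n).CostLE (n * m) := by
  induction n with
  | zero => trivial
  | succ n ih =>
    have : (n + 1) * m = m + (n * m + 0) := by ring
    rw [this]
    exact h.bind fun x => ih.bind fun l => trivial

theorem QProg.length_replicate (U : Matrix.unitaryGroup X ℂ) (P : QProg X ℝ) (n : ℕ) {l : List ℝ}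
    (hl : l ∈ ((P.replicate n).law U).support) : l.length = n := by
  induction n generalizing l with
  | zero =>
    simp only [QProg.replicate, QProg.law_ret, PMF.support_pure, Set.mem_singleton_iff] at hl
    simp [hl]
  | succ n ih =>
    simp only [QProg.replicate, QProg.law_bind, QProg.law_ret, PMF.mem_support_bind_iff,
      PMF.support_pure, Set.mem_singleton_iff] at hl
    obtain ⟨x, -, l', hl', rfl⟩ := hl
    simp [ih hl']

-- Exponential moment of the number of bad runs: each run contributes a factor 1 + 15 · P(s) ≤ 2, by
-- independence.
open scoped Classical in
theorem QProg.expect_pow_countP_replicate_le (U : Matrix.unitaryGroup X ℂ) (P : QProg X ℝ)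
    (s : Set ℝ) (hs : 15 * (P.law U).toOuterMeasure s ≤ 1) (n : ℕ) :
    expect ((P.replicate n).law U) (fun l => 16 ^ l.countP (· ∈ s)) ≤ 2 ^ n := by
  induction n with
  | zero => simp [QProg.replicate, QProg.law_ret, expect_pure]
  | succ n ih =>
    simp only [QProg.replicate, QProg.law_bind, QProg.law_ret, expect_bind, expect_pure]
    calc expect (P.law U) (fun x => expect ((P.replicate n).law U)
            fun l => (16 : ℝ≥0∞) ^ (x :: l).countP (· ∈ s))
        ≤ expect (P.law U) (fun x => 2 ^ n * (1 + 15 * s.indicator 1 x)) := by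
          refine expect_mono _ fun x => ?_
          by_cases hx : x ∈ s
          · simp only [List.countP_cons, hx, decide_true, if_true, pow_succ,
              Set.indicator_of_mem, Pi.one_apply]
            simp_rw [mul_comm _ (16 : ℝ≥0∞)]
            rw [expect_const_mul, mul_comm]
            have : (1 + 15 * 1 : ℝ≥0∞) = 16 := by norm_num
            rw [this]
            gcongr
          · simpa [List.countP_cons, hx] using ih
      _ = 2 ^ n * (1 + 15 * (P.law U).toOuterMeasure s) := by
          rw [expect_const_mul, expect_add, expect_const, expect_const_mul, ← prob_eq_expect]
      _ ≤ 2 ^ n * (1 + 1) := by gcongr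
      _ = 2 ^ (n + 1) := by rw [pow_succ]; norm_num

open scoped Classical in
/-- A number within `η` of more than half of the entries of `l`, if there is one. -/
noncomputable def majorityPoint (η : ℝ) (l : List ℝ) : ℝ :=
  if h : ∃ m, l.length < 2 * l.countP (fun x => |x - m| < η) then h.choose else 0

-- Pigeonhole: two strict majorities of the same list meet.
open scoped Classical in
theorem exists_mem_of_two_countP_lt {α : Type} (l : List α) (p q : α → Prop)
    (hp : l.length < 2 * l.countP p) (hq : l.length < 2 * l.countP q) :
    ∃ x ∈ l, p x ∧ q x := by
  by_contra! h
  have h1 : l.countP (fun x => decide (q x)) ≤ l.countP (fun x => !decide (p x)) := by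
    refine List.countP_mono_left fun x hx hqx => ?_
    have hqx' : q x := by simpa using hqx
    have : ¬ p x := fun hpx => h x hx hpx hqx'
    simpa using this
  have h2 := l.length_eq_countP_add_countP (fun x => decide (p x))
  have h3 : l.countP (fun x => !decide (p x)) =
      l.countP (fun a => decide ¬ (decide (p a) = true)) := by
    congr 1; ext x; simp
  omega

-- The chosen point and `μ` are each within `η` of a majority of the entries, and the two majorities
-- share an entry. The factor 2 is why `QProg.boost` works with `η / 2`.
open scoped Classical in
theorem abs_majorityPoint_sub_lt {η μ : ℝ} {l : List ℝ}
    (h : l.length < 2 * l.countP (fun x => |x - μ| < η)) : |majorityPoint η l - μ| < 2 * η := by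
  have hex : ∃ m, l.length < 2 * l.countP (fun x => |x - m| < η) := ⟨μ, h⟩
  rw [majorityPoint, dif_pos hex]
  obtain ⟨x, -, h1, h2⟩ := exists_mem_of_two_countP_lt l _ _ hex.choose_spec h
  rw [abs_lt] at *
  constructor <;> linarith [h1.1, h1.2, h2.1, h2.2]

/-- Number of repetitions that brings the failure probability below `δ`. -/
noncomputable def repetitions (δ : ℝ) : ℕ := ⌈Real.logb 2 (1 / δ)⌉₊ + 1

/-- Repeat an estimator and combine the results. -/
noncomputable def QProg.boost (P : QProg X ℝ) (η δ : ℝ) : QProg X ℝ :=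
  (P.replicate (repetitions δ)).bind fun l => .ret (majorityPoint (η / 2) l)

theorem QProg.CostLE.boost {P : QProg X ℝ} {m : ℕ} (h : P.CostLE m) (η δ : ℝ) :
    (P.boost η δ).CostLE (repetitions δ * m) :=
  (h.replicate _).bind (n := 0) fun _ => trivial

/-- The `+ 1` in `repetitions` makes this strict, as the specification of the estimators asks for
success probability strictly above `1 - δ`. -/
theorem two_inv_pow_repetitions_lt {δ : ℝ} (hδ0 : 0 < δ) :
    ((2 : ℝ) ^ repetitions δ)⁻¹ < δ := by
  have h1 : Real.logb 2 (1 / δ) < repetitions δ := by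
    rw [repetitions]; push_cast
    linarith [Nat.le_ceil (Real.logb 2 (1 / δ))]
  rw [Real.logb_lt_iff_lt_rpow (by norm_num) (by positivity), Real.rpow_natCast] at h1
  rw [inv_lt_comm₀ (by positivity) hδ0]
  simpa using h1

theorem repetitions_le {δ : ℝ} (hδ0 : 0 < δ) (hδ1 : δ < 1) :
    (repetitions δ : ℝ) ≤ 4 * logp (1 / δ) := by
  have h0 : 0 ≤ Real.log (1 / δ) := Real.log_nonneg (by rw [le_div_iff₀ hδ0]; linarith)
  have h1 : 1 ≤ logp (1 / δ) := le_max_left _ _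
  have h2 : Real.log (1 / δ) ≤ logp (1 / δ) := le_max_right _ _
  have h3 : Real.logb 2 (1 / δ) ≤ 2 * Real.log (1 / δ) := by
    rw [Real.logb, div_le_iff₀ (Real.log_pos (by norm_num))]
    nlinarith [Real.log_two_gt_d9]
  have h4 := Nat.ceil_lt_add_one (a := Real.logb 2 (1 / δ))
    (div_nonneg h0 (Real.log_nonneg (by norm_num)))
  rw [repetitions]; push_cast
  linarith

open scoped Classical in
/-- If a single run errs by `η / 2` or more with probability at most `1/15`, the boosted estimator
errs by less than `η` with probability more than `1 - δ`. -/
theorem QProg.lt_prob_boost (U : Matrix.unitaryGroup X ℂ) (P : QProg X ℝ) {μ η δ : ℝ}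
    (hδ0 : 0 < δ) (hδ1 : δ < 1)
    (h : 15 * (P.law U).toOuterMeasure {x | η / 2 ≤ |x - μ|} ≤ 1) :
    ENNReal.ofReal (1 - δ) < ((P.boost η δ).exec U).toOuterMeasure {w | |w.1 - μ| < η} := by
  have hset : ((P.boost η δ).exec U).toOuterMeasure {w | |w.1 - μ| < η} =
      ((P.boost η δ).law U).toOuterMeasure {x | |x - μ| < η} :=
    QProg.prob_exec_fst U (P.boost η δ) {x | |x - μ| < η}
  rw [hset]
  set R := repetitions δ with hR
  set s : Set ℝ := {x | η / 2 ≤ |x - μ|} with hs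
  set ν := (P.replicate R).law U with hν
  have hlaw : (P.boost η δ).law U = ν.map (majorityPoint (η / 2)) := by
    rw [QProg.boost, QProg.law_bind, ← PMF.bind_pure_comp]
    congr 1
    ext l : 1
    rw [QProg.law_ret]; rfl
  refine lt_prob_of_prob_compl_lt _ hδ0 hδ1 ?_
  rw [hlaw, prob_map]
  -- A wrong output means that no majority of runs is within η/2 of `μ`, so at least half of them
  -- are bad and the moment variable is at least 16^(R/2) = 4^R. Markov against the moment bound 2^R
  -- leaves 2^(-R).
  have hbad : ν.toOuterMeasure (majorityPoint (η / 2) ⁻¹' {x | |x - μ| < η}ᶜ) ≤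
      ν.toOuterMeasure {l | (4 : ℝ≥0∞) ^ R ≤ 16 ^ l.countP (· ∈ s)} := by
    -- The inclusion is needed on the support only, which is where lists are known to have length
    -- `R`.
    refine PMF.toOuterMeasure_mono ν ?_
    rintro l ⟨hl, hlν⟩
    have hlen := QProg.length_replicate U P R hlν
    simp only [Set.mem_preimage, Set.mem_compl_iff, Set.mem_ofPred_eq] at hl
    have hcount : ¬ l.length < 2 * l.countP (fun x => |x - μ| < η / 2) := fun hc =>
      hl (by simpa [mul_div_cancel₀] using abs_majorityPoint_sub_lt hc)
    have h2 := l.length_eq_countP_add_countP (fun x => decide (|x - μ| < η / 2))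
    have h3 : l.countP (· ∈ s) =
        l.countP (fun a => decide ¬ (decide (|a - μ| < η / 2) = true)) := by
      congr 1; ext x; simp [hs]
    have h4 : R ≤ 2 * l.countP (· ∈ s) := by omega
    simp only [Set.mem_ofPred_eq]
    calc (4 : ℝ≥0∞) ^ R ≤ 4 ^ (2 * l.countP (· ∈ s)) :=
          pow_le_pow_right₀ (by norm_num) h4
      _ = 16 ^ l.countP (· ∈ s) := by rw [pow_mul]; norm_num
  refine hbad.trans_lt ?_
  have hm := (markov ν (fun l => 16 ^ l.countP (· ∈ s)) (4 ^ R)).trans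
    (QProg.expect_pow_countP_replicate_le U P s h R)
  have h4 : (4 : ℝ≥0∞) ^ R = 2 ^ R * 2 ^ R := by rw [← mul_pow]; norm_num
  have h2 : (2 : ℝ≥0∞) ^ R ≠ 0 := by simp
  have h2t : (2 : ℝ≥0∞) ^ R ≠ ⊤ := ENNReal.pow_ne_top (by norm_num)
  have h5 : ν.toOuterMeasure {l | (4 : ℝ≥0∞) ^ R ≤ 16 ^ l.countP (· ∈ s)} ≤ ((2 : ℝ≥0∞) ^ R)⁻¹ := by
    generalize ν.toOuterMeasure {l | (4 : ℝ≥0∞) ^ R ≤ 16 ^ l.countP (· ∈ s)} = x at hm ⊢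
    rw [h4, mul_assoc] at hm
    rw [ENNReal.le_inv_iff_mul_le, mul_comm,
      ← ENNReal.mul_le_mul_iff_right h2 h2t, mul_one]
    exact hm
  refine h5.trans_lt ?_
  have h6 : ((2 : ℝ≥0∞) ^ R)⁻¹ = ENNReal.ofReal ((2 : ℝ) ^ R)⁻¹ := by
    rw [ENNReal.ofReal_inv_of_pos (by positivity), ENNReal.ofReal_pow (by norm_num)]; norm_num
  rw [h6]
  exact (ENNReal.ofReal_lt_ofReal_iff hδ0).2 (two_inv_pow_repetitions_lt hδ0)

end Boost

end QuantumMDP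

namespace QuantumMDP

open scoped ENNReal Matrix

/-! ## Unitary gates used by amplitude estimation -/

section Gates

variable {X B : Type} [Fintype X] [DecidableEq X] [Fintype B] [DecidableEq B]

theorem mul_mulVec_unitary (V W : Matrix.unitaryGroup B ℂ) (φ : B → ℂ) :
    (V * W).1 *ᵥ φ = V.1 *ᵥ (W.1 *ᵥ φ) := by
  rw [Matrix.mulVec_mulVec]; rfl

theorem mulVec_inv_mulVec (V : Matrix.unitaryGroup B ℂ) (φ : B → ℂ) :
    V.1 *ᵥ ((V⁻¹).1 *ᵥ φ) = φ := by
  rw [← mul_mulVec_unitary, mul_inv_cancel]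
  simp

theorem inv_mulVec_apply (V : Matrix.unitaryGroup B ℂ) (φ : B → ℂ) (y : B) :
    ((V⁻¹).1 *ᵥ φ) y = ∑ z, star (V.1 z y) * φ z := rfl

theorem sum_norm_sq_mulVec (V : Matrix.unitaryGroup B ℂ) (φ : B → ℂ) :
    ∑ y, ‖(V.1 *ᵥ φ) y‖ ^ 2 = ∑ y, ‖φ y‖ ^ 2 := by
  have key : ∀ χ : B → ℂ, ((∑ y, ‖χ y‖ ^ 2 : ℝ) : ℂ) = star χ ⬝ᵥ χ := by
    intro χ
    push_cast
    exact Finset.sum_congr rfl fun y _ => (Complex.conj_mul' _).symm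
  have h : star (V.1 *ᵥ φ) ⬝ᵥ (V.1 *ᵥ φ) = star φ ⬝ᵥ φ := by
    rw [Matrix.star_mulVec, Matrix.dotProduct_mulVec, Matrix.vecMul_vecMul,
      ← Matrix.star_eq_conjTranspose, Matrix.UnitaryGroup.star_mul_self, Matrix.vecMul_one]
  rw [← key, ← key] at h
  exact_mod_cast h

theorem extend_mulVec (U : Matrix.unitaryGroup X ℂ) (φ : X × B → ℂ) (z : X × B) :
    ((extend B U).1 *ᵥ φ) z = ∑ x', U.1 z.1 x' * φ (x', z.2) := by
  simp only [extend, Matrix.mulVec, dotProduct, Fintype.sum_prod_type, Matrix.kronecker,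
    Matrix.kroneckerMap_apply, Matrix.one_apply, mul_ite, mul_one, mul_zero, ite_mul, zero_mul,
    Finset.sum_ite_eq, Finset.mem_univ, if_true]

theorem extend_inv (U : Matrix.unitaryGroup X ℂ) : extend B U⁻¹ = (extend B U)⁻¹ := by
  apply Subtype.ext
  change Matrix.kronecker (star U.1) 1 = star (Matrix.kronecker U.1 1)
  rw [Matrix.star_eq_conjTranspose, Matrix.star_eq_conjTranspose]
  simp [Matrix.kronecker, Matrix.conjTranspose_kronecker]

/-- Apply `V x` to the second register, controlled by the value `x` of the first. -/
def multiplex (V : X → Matrix.unitaryGroup B ℂ) : Matrix.unitaryGroup (X × B) ℂ :=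
  ⟨Matrix.of fun z z' => if z.1 = z'.1 then (V z.1).1 z.2 z'.2 else 0, by
    rw [Matrix.mem_unitaryGroup_iff]
    ext ⟨x, b⟩ ⟨x', b'⟩
    rw [Matrix.mul_apply, Fintype.sum_prod_type, Finset.sum_eq_single x]
    · by_cases h : x = x'
      · subst h
        have := congrFun (congrFun (Matrix.mem_unitaryGroup_iff.1 (V x).2) b) b'
        rw [Matrix.mul_apply] at this
        simpa [Matrix.star_apply, Matrix.one_apply] using this
      · simp [Matrix.star_apply, h, Ne.symm h]
    · intro y _ hy
      simp [Ne.symm hy]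
    · simp⟩

theorem multiplex_mulVec (V : X → Matrix.unitaryGroup B ℂ) (φ : X × B → ℂ) (z : X × B) :
    ((multiplex V).1 *ᵥ φ) z = ∑ b', (V z.1).1 z.2 b' * φ (z.1, b') := by
  simp only [multiplex, Matrix.mulVec, dotProduct, Fintype.sum_prod_type, Matrix.of_apply]
  rw [Finset.sum_eq_single z.1]
  · simp
  · intro y _ hy
    simp [Ne.symm hy]
  · simp

/-- Flip the sign of the basis states in `p`. -/
def signGate (p : B → Prop) [DecidablePred p] : Matrix.unitaryGroup B ℂ :=
  ⟨Matrix.diagonal fun y => if p y then -1 else 1, by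
    rw [Matrix.mem_unitaryGroup_iff, Matrix.star_eq_conjTranspose, Matrix.diagonal_conjTranspose,
      Matrix.diagonal_mul_diagonal, ← Matrix.diagonal_one]
    congr 1
    ext y
    by_cases h : p y <;> simp [h]⟩

theorem signGate_mulVec (p : B → Prop) [DecidablePred p] (φ : B → ℂ) (y : B) :
    ((signGate p).1 *ᵥ φ) y = (if p y then -1 else 1) * φ y := by
  simp [signGate, Matrix.mulVec_diagonal]

/-- Rotation of a qubit by the angle `t`. -/
noncomputable def rotation (t : ℝ) : Matrix.unitaryGroup Bool ℂ :=
  ⟨Matrix.of fun b b' => match b, b' with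
    | false, false => (Real.cos t : ℂ)
    | false, true => (-Real.sin t : ℂ)
    | true, false => (Real.sin t : ℂ)
    | true, true => (Real.cos t : ℂ), by
    rw [Matrix.mem_unitaryGroup_iff]
    have h : (Real.cos t : ℂ) * Real.cos t + Real.sin t * Real.sin t = 1 := by
      have := Real.cos_sq_add_sin_sq t
      rw [sq, sq] at this
      exact_mod_cast this
    ext b b'
    rw [Matrix.mul_apply]
    cases b <;> cases b' <;>
      simp only [Fintype.sum_bool, Matrix.star_apply, Matrix.of_apply, Complex.star_def,
        map_neg, Complex.conj_ofReal, Matrix.one_apply, if_true, reduceCtorEq, if_false]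
    · linear_combination h
    · ring
    · ring
    · linear_combination h⟩

/-- Real Householder reflection that exchanges `|y₀⟩` with a unit vector orthogonal to it. -/
noncomputable def householder (y₀ : B) (α : B → ℝ) (h0 : α y₀ = 0) (h1 : ∑ y, α y ^ 2 = 1) :
    Matrix.unitaryGroup B ℂ :=
  ⟨1 - Matrix.vecMulVec (fun y => ((Pi.single y₀ 1 - α : B → ℝ) y : ℂ)) fun y => ((Pi.single y₀ 1 - α : B → ℝ) y : ℂ), by
    set w : B → ℂ := fun y => ((Pi.single y₀ 1 - α : B → ℝ) y : ℂ) with hw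
    -- Since `α` is a unit vector orthogonal to the basis vector, the squared norm is 2, and 1 - wwᵀ
    -- is already the normalised reflection 1 - 2wwᵀ/|w|².
    have hww : w ⬝ᵥ w = 2 := by
      have : ∑ y, ((Pi.single y₀ 1 - α : B → ℝ) y) * ((Pi.single y₀ 1 - α : B → ℝ) y) = (2 : ℝ) := by
        have h2 : ∀ y, ((Pi.single y₀ 1 - α : B → ℝ) y) * ((Pi.single y₀ 1 - α : B → ℝ) y) =
            (if y = y₀ then (1 : ℝ) else 0) + α y ^ 2 := by
          intro y
          by_cases hy : y = y₀
          · subst hy; simp [h0]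
          · simp [hy]; ring
        rw [Finset.sum_congr rfl fun y _ => h2 y, Finset.sum_add_distrib, h1]
        norm_num
      simp only [dotProduct, hw]
      exact_mod_cast this
    have hstar : star w = w := by
      ext y; simp [hw]
    have hs : star (1 - Matrix.vecMulVec w w) = 1 - Matrix.vecMulVec w w := by
      rw [Matrix.star_eq_conjTranspose, Matrix.conjTranspose_sub, Matrix.conjTranspose_vecMulVec,
        hstar, Matrix.conjTranspose_one]
    have hsq : Matrix.vecMulVec w w * Matrix.vecMulVec w w = 2 • Matrix.vecMulVec w w := by
      rw [Matrix.vecMulVec_mul_vecMulVec, hww, Matrix.vecMulVec_smul]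
      ext; simp
    rw [Matrix.mem_unitaryGroup_iff, hs]
    calc (1 - Matrix.vecMulVec w w) * (1 - Matrix.vecMulVec w w)
        = 1 - 2 • Matrix.vecMulVec w w + Matrix.vecMulVec w w * Matrix.vecMulVec w w := by
          noncomm_ring
      _ = 1 := by rw [hsq]; simp⟩

theorem householder_apply (y₀ : B) (α : B → ℝ) (h0 : α y₀ = 0) (h1 : ∑ y, α y ^ 2 = 1) (y : B) :
    (householder y₀ α h0 h1).1 y y₀ = α y := by
  by_cases hy : y = y₀
  · subst hy; simp [householder, Matrix.vecMulVec_apply, h0]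
  · simp [householder, Matrix.vecMulVec_apply, h0, hy]

end Gates

/-! ## The discrete Fourier transform and the sine window -/

section Fourier

variable {N : ℕ}

/-- The `N`-th root of unity `exp (2πi/N)`. -/
noncomputable def rootOfUnity (N : ℕ) : ℂ := Complex.exp (2 * Real.pi * Complex.I / N)

theorem rootOfUnity_isPrimitiveRoot (hN : N ≠ 0) : IsPrimitiveRoot (rootOfUnity N) N :=
  Complex.isPrimitiveRoot_exp N hN

theorem norm_rootOfUnity (N : ℕ) : ‖rootOfUnity N‖ = 1 := by
  have : (2 * Real.pi * Complex.I / N : ℂ) = ((2 * Real.pi / N : ℝ) : ℂ) * Complex.I := by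
    push_cast; ring
  rw [rootOfUnity, this, Complex.norm_exp_ofReal_mul_I]

/-- The discrete Fourier transform. -/
noncomputable def dft (N : ℕ) [NeZero N] : Matrix.unitaryGroup (Fin N) ℂ :=
  ⟨Matrix.of fun y k => rootOfUnity N ^ (y.1 * k.1) / (Real.sqrt N : ℂ), by
    have hN : N ≠ 0 := NeZero.ne N
    have hprim := rootOfUnity_isPrimitiveRoot hN
    have hconj : rootOfUnity N * star (rootOfUnity N) = 1 := by
      rw [Complex.star_def, Complex.mul_conj', norm_rootOfUnity]; norm_num
    have hsq : (Real.sqrt N : ℂ) * Real.sqrt N = N := by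
      have := Real.mul_self_sqrt (Nat.cast_nonneg N : (0 : ℝ) ≤ N)
      exact_mod_cast this
    have hN' : (N : ℂ) ≠ 0 := by exact_mod_cast hN
    rw [Matrix.mem_unitaryGroup_iff]
    ext y y'
    rw [Matrix.mul_apply]
    have hterm : ∀ k : Fin N, (Matrix.of fun y k : Fin N =>
        rootOfUnity N ^ (y.1 * k.1) / (Real.sqrt N : ℂ)) y k *
        (star (Matrix.of fun y k : Fin N =>
          rootOfUnity N ^ (y.1 * k.1) / (Real.sqrt N : ℂ))) k y' =
        (rootOfUnity N ^ y.1 * star (rootOfUnity N) ^ y'.1) ^ k.1 / N := by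
      intro k
      rw [Matrix.star_apply]
      simp only [Matrix.of_apply, Complex.star_def, map_div₀, map_pow, Complex.conj_ofReal]
      rw [div_mul_div_comm, hsq, mul_pow, ← pow_mul, ← pow_mul]
    rw [Finset.sum_congr rfl fun k _ => hterm k, ← Finset.sum_div,
      Fin.sum_univ_eq_sum_range fun k => (rootOfUnity N ^ y.1 * star (rootOfUnity N) ^ y'.1) ^ k]
    by_cases h : y = y'
    · subst h
      rw [← mul_pow, hconj]
      simp [hN']
    · rw [Matrix.one_apply_ne h]
      set r := rootOfUnity N ^ y.1 * star (rootOfUnity N) ^ y'.1 with hr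
      have hrN : r ^ N = 1 := by
        rw [hr, mul_pow, ← pow_mul, ← pow_mul, mul_comm y.1, mul_comm y'.1, pow_mul, pow_mul,
          ← star_pow (rootOfUnity N) N, hprim.pow_eq_one]
        simp
      have hr1 : r ≠ 1 := by
        intro h1
        apply h
        have h2 : rootOfUnity N ^ y.1 = rootOfUnity N ^ y'.1 := by
          calc rootOfUnity N ^ y.1 = rootOfUnity N ^ y.1 *
                (rootOfUnity N * star (rootOfUnity N)) ^ y'.1 := by rw [hconj]; simp
            _ = r * rootOfUnity N ^ y'.1 := by rw [hr, mul_pow]; ring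
            _ = _ := by rw [h1, one_mul]
        exact Fin.ext (hprim.pow_inj y.2 y'.2 h2)
      rw [geom_sum_eq hr1, hrN]
      simp⟩

theorem dft_mulVec [NeZero N] (c : ℕ → ℂ) (y : Fin N) :
    ((dft N).1 *ᵥ fun k => c k.1) y =
      (∑ k ∈ Finset.range N, (rootOfUnity N ^ y.1) ^ k * c k) / (Real.sqrt N : ℂ) := by
  rw [Finset.sum_div,
    ← Fin.sum_univ_eq_sum_range fun k => (rootOfUnity N ^ y.1) ^ k * c k / (Real.sqrt N : ℂ)]
  simp only [dft, Matrix.mulVec, dotProduct, Matrix.of_apply, pow_mul]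
  exact Finset.sum_congr rfl fun k _ => by ring

/-- Unit vector with small Dirichlet energy. -/
noncomputable def sineWindow (N : ℕ) (k : ℕ) : ℝ :=
  Real.sqrt (2 / N) * Real.sin (Real.pi * k / N)

theorem sum_sineWindow_sq (hN : 2 ≤ N) : ∑ k ∈ Finset.range N, sineWindow N k ^ 2 = 1 := by
  have hN0 : (N : ℝ) ≠ 0 := by positivity
  -- Real part of the vanishing sum of all N-th roots of unity; this is where `2 ≤ N` is needed.
  have hcos : ∑ k ∈ Finset.range N, Real.cos (2 * (Real.pi * k / N)) = 0 := by
    have h := (rootOfUnity_isPrimitiveRoot (N := N) (by omega)).geom_sum_eq_zero (by omega)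
    have h2 := congrArg Complex.re h
    rw [Complex.re_sum, Complex.zero_re] at h2
    rw [← h2]
    refine Finset.sum_congr rfl fun k _ => ?_
    rw [rootOfUnity, ← Complex.exp_nat_mul]
    have : (k * (2 * Real.pi * Complex.I / N) : ℂ) =
        ((2 * (Real.pi * k / N) : ℝ) : ℂ) * Complex.I := by push_cast; ring
    rw [this, Complex.exp_ofReal_mul_I_re]
  have hterm : ∀ k, sineWindow N k ^ 2 = 1 / N - Real.cos (2 * (Real.pi * k / N)) / N := by
    intro k
    rw [sineWindow, mul_pow, Real.sq_sqrt (by positivity), Real.sin_sq_eq_half_sub]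
    field_simp
  rw [Finset.sum_congr rfl fun k _ => hterm k, Finset.sum_sub_distrib,
    ← Finset.sum_div _ (fun k : ℕ => Real.cos (2 * (Real.pi * k / N))), hcos]
  simp [hN0]

/-- Sine is 1-Lipschitz, so each of the N terms is at most (2/N)(π/N)², and 2π² ≤ 20. -/
theorem sum_sineWindow_sub_sq_le (hN : 2 ≤ N) :
    ∑ k ∈ Finset.range N, (sineWindow N k - sineWindow N (k + 1)) ^ 2 ≤ 20 / N ^ 2 := by
  have hN0 : (0 : ℝ) < N := by positivity
  have hterm : ∀ k ∈ Finset.range N,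
      (sineWindow N k - sineWindow N (k + 1)) ^ 2 ≤ 20 / N ^ 3 := by
    intro k _
    have h1 : |Real.sin (Real.pi * k / N) - Real.sin (Real.pi * (k + 1 : ℕ) / N)| ≤
        Real.pi / N := by
      have h2 := Real.abs_sin_sub_sin_le (Real.pi * k / N) (Real.pi * (k + 1 : ℕ) / N)
      have h3 : Real.pi * k / N - Real.pi * (k + 1 : ℕ) / N = - (Real.pi / N) := by
        push_cast; ring
      rwa [h3, abs_neg, abs_of_pos (div_pos Real.pi_pos hN0)] at h2
    rw [sineWindow, sineWindow, ← mul_sub, mul_pow, Real.sq_sqrt (by positivity), ← sq_abs]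
    calc 2 / N * |Real.sin (Real.pi * k / N) - Real.sin (Real.pi * (k + 1 : ℕ) / N)| ^ 2
        ≤ 2 / N * (Real.pi / N) ^ 2 := by gcongr
      _ = 2 * Real.pi ^ 2 / N ^ 3 := by field_simp
      _ ≤ 20 / N ^ 3 := by
        gcongr
        nlinarith [Real.pi_lt_d2, Real.pi_pos]
  refine (Finset.sum_le_sum hterm).trans_eq ?_
  rw [Finset.sum_const, Finset.card_range, nsmul_eq_mul]
  field_simp

end Fourier

end QuantumMDP

namespace QuantumMDP

open scoped ENNReal Matrix

/-! ## The amplitude estimation circuit -/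

section AmplitudeCircuit

variable {X : Type} [Fintype X] [DecidableEq X] {N : ℕ}

/-- Rotate the flag qubit by the angle `t x`. -/
noncomputable def flagGate (N : ℕ) (t : X → ℝ) : Matrix.unitaryGroup (X × Bool × Fin N) ℂ :=
  multiplex fun x => extend (Fin N) (rotation (t x))

/-- Apply `V` to the counter. -/
def counterGate (X : Type) [Fintype X] [DecidableEq X] (V : Matrix.unitaryGroup (Fin N) ℂ) :
    Matrix.unitaryGroup (X × Bool × Fin N) ℂ :=
  multiplex fun _ => multiplex fun _ => V

theorem counterGate_mulVec (V : Matrix.unitaryGroup (Fin N) ℂ) (φ : X × Bool × Fin N → ℂ)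
    (z : X × Bool × Fin N) :
    ((counterGate X V).1 *ᵥ φ) z = (V.1 *ᵥ fun k => φ (z.1, z.2.1, k)) z.2.2 := by
  rw [counterGate, multiplex_mulVec]
  exact multiplex_mulVec (fun _ : Bool => V) (fun b => φ (z.1, b)) z.2

/-- The preparation unitary: query, then rotate the flag. -/
noncomputable def prepare (N : ℕ) (t : X → ℝ) (U : Matrix.unitaryGroup X ℂ) :
    Matrix.unitaryGroup (X × Bool × Fin N) ℂ := flagGate N t * extend (Bool × Fin N) U

theorem prepare_mulVec (t : X → ℝ) (U : Matrix.unitaryGroup X ℂ) (φ : X × Bool × Fin N → ℂ)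
    (z : X × Bool × Fin N) :
    ((prepare N t U).1 *ᵥ φ) z =
      ∑ b', (rotation (t z.1)).1 z.2.1 b' * ∑ x', U.1 z.1 x' * φ (x', b', z.2.2) := by
  rw [prepare, mul_mulVec_unitary, flagGate, multiplex_mulVec]
  have := extend_mulVec (B := Fin N) (rotation (t z.1))
    (fun b => ((extend (Bool × Fin N) U).1 *ᵥ φ) (z.1, b)) z.2
  rw [Matrix.mulVec, dotProduct] at this
  rw [this]
  simp_rw [extend_mulVec]

/-- The amplitudes of the prepared state. -/
noncomputable def prepared (t : X → ℝ) (U : Matrix.unitaryGroup X ℂ) (x₀ : X) (x : X) (b : Bool) :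
    ℂ := (rotation (t x)).1 b false * U.1 x x₀

theorem prepare_mulVec_initial (t : X → ℝ) (U : Matrix.unitaryGroup X ℂ) (x₀ : X) (c : Fin N → ℂ)
    (z : X × Bool × Fin N) :
    ((prepare N t U).1 *ᵥ fun y => if y.1 = x₀ ∧ y.2.1 = false then c y.2.2 else 0) z =
      c z.2.2 * prepared t U x₀ z.1 z.2.1 := by
  rw [prepare_mulVec]
  simp [prepared]
  ring

/-- The preparation does not touch the counter, so it commutes with multiplication by functions of
the counter. This is used for the counter-controlled signs. -/
theorem prepare_mulVec_smul (t : X → ℝ) (U : Matrix.unitaryGroup X ℂ) (c : Fin N → ℂ)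
    (φ : X × Bool × Fin N → ℂ) :
    ((prepare N t U).1 *ᵥ fun y => c y.2.2 * φ y) =
      fun z => c z.2.2 * ((prepare N t U).1 *ᵥ φ) z := by
  ext z
  simp_rw [prepare_mulVec, Finset.mul_sum]
  exact Finset.sum_congr rfl fun b _ => Finset.sum_congr rfl fun x _ => by ring

theorem prepare_inv_mulVec_initial (t : X → ℝ) (U : Matrix.unitaryGroup X ℂ) (x₀ : X)
    (φ : X × Bool × Fin N → ℂ) (k : Fin N) :
    (((prepare N t U)⁻¹).1 *ᵥ φ) (x₀, false, k) =
      ∑ x, ∑ b, star (prepared t U x₀ x b) * φ (x, b, k) := by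
  rw [inv_mulVec_apply, Fintype.sum_prod_type]
  refine Finset.sum_congr rfl fun x _ => ?_
  rw [Fintype.sum_prod_type]
  refine Finset.sum_congr rfl fun b _ => ?_
  have h : ∀ k', (prepare N t U).1 (x, b, k') (x₀, false, k) =
      (if k' = k then 1 else 0) * prepared t U x₀ x b := by
    intro k'
    have h1 := prepare_mulVec_initial t U x₀ (fun k' => if k' = k then (1 : ℂ) else 0) (x, b, k')
    have h2 : (fun y : X × Bool × Fin N => if y.1 = x₀ ∧ y.2.1 = false then
        (if y.2.2 = k then (1 : ℂ) else 0) else 0) = Pi.single (x₀, false, k) 1 := by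
      ext ⟨y, b', j⟩
      by_cases h1 : y = x₀ <;> by_cases h2 : b' = false <;> by_cases h3 : j = k <;>
        simp [h1, h2, h3]
    rw [h2, Matrix.mulVec_single_one] at h1
    exact h1
  rw [Finset.sum_eq_single k]
  · simp [h]
  · intro j _ hj
    simp [h, hj]
  · simp

/-- The basis states whose sign is flipped by the reflection about the initial state, in the
`n`-th step. -/
abbrev awayFromInitial (x₀ : X) (n : ℕ) (z : X × Bool × Fin N) : Prop :=
  n < z.2.2.1 ∧ ¬ (z.1 = x₀ ∧ z.2.1 = false)

/-- The basis states whose sign is flipped by the reflection about the unflagged states, in the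
`n`-th step. -/
abbrev flagged (n : ℕ) (z : X × Bool × Fin N) : Prop := n < z.2.2.1 ∧ z.2.1 = true

/-- Conjugating a sign flip away from the initial state by the preparation gives the reflection
2|Ψ⟩⟨Ψ| - 1 about the prepared state Ψ. Where the counter does not exceed `n`, no sign is flipped,
and the preparation cancels against its inverse. -/
theorem reflection_mulVec (t : X → ℝ) (U : Matrix.unitaryGroup X ℂ) (x₀ : X) (n : ℕ)
    (φ : X × Bool × Fin N → ℂ) (z : X × Bool × Fin N) :
    ((prepare N t U).1 *ᵥ ((signGate (awayFromInitial x₀ n)).1 *ᵥ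
      (((prepare N t U)⁻¹).1 *ᵥ φ))) z =
      if n < z.2.2.1 then
        2 * (∑ x, ∑ b, star (prepared t U x₀ x b) * φ (x, b, z.2.2)) * prepared t U x₀ z.1 z.2.1
          - φ z
      else φ z := by
  set χ := ((prepare N t U)⁻¹).1 *ᵥ φ with hχ
  -- On active counter values the sign gate is -1 plus twice the projection onto the initial state.
  -- The first summand is a function of the counter, the second is a state that
  -- `prepare_mulVec_initial` can treat.
  have h1 : (signGate (awayFromInitial x₀ n)).1 *ᵥ χ =
      (fun y => (if n < y.2.2.1 then (-1 : ℂ) else 1) * χ y) +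
      fun y => if y.1 = x₀ ∧ y.2.1 = false then
        (if n < y.2.2.1 then 2 * χ (x₀, false, y.2.2) else 0) else 0 := by
    ext ⟨x, b, k⟩
    rw [signGate_mulVec]
    by_cases hk : n < k.1
    · by_cases hx : x = x₀ ∧ b = false
      · obtain ⟨rfl, rfl⟩ := hx
        simp [awayFromInitial, hk]; ring
      · simp only [awayFromInitial, hk, hx, Pi.add_apply]
        simp
    · simp [awayFromInitial, hk]
  rw [h1, Matrix.mulVec_add, Pi.add_apply, prepare_mulVec_initial t U x₀
      (fun k : Fin N => if n < k.1 then 2 * χ (x₀, false, k) else 0),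
    prepare_mulVec_smul t U (fun k : Fin N => if n < k.1 then (-1 : ℂ) else 1), hχ,
    mulVec_inv_mulVec, prepare_inv_mulVec_initial]
  by_cases hk : n < z.2.2.1 <;> simp [hk]
  ring

/-- One Grover step, controlled by the value of the counter being more than `n`. -/
noncomputable def groverStep (t : X → ℝ) (x₀ : X) (n : ℕ) : List (Gate X (Bool × Fin N)) :=
  [.fixed (signGate (flagged n)), .fixed (flagGate N t)⁻¹, .queryInv,
    .fixed (signGate (awayFromInitial x₀ n)), .query, .fixed (flagGate N t)]

theorem evalCircuit_append {B : Type} [Fintype B] [DecidableEq B] (U : Matrix.unitaryGroup X ℂ)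
    (gs hs : List (Gate X B)) :
    evalCircuit U (gs ++ hs) = evalCircuit U hs * evalCircuit U gs := by
  induction gs with
  | nil => simp [evalCircuit]
  | cons g gs ih => simp [evalCircuit, ih, mul_assoc]

theorem circuitCost_append {B : Type} [Fintype B] [DecidableEq B] (gs hs : List (Gate X B)) :
    circuitCost (gs ++ hs) = circuitCost gs + circuitCost hs := by
  simp [circuitCost]

theorem evalCircuit_groverStep (t : X → ℝ) (U : Matrix.unitaryGroup X ℂ) (x₀ : X) (n : ℕ) :
    evalCircuit U (groverStep (N := N) t x₀ n) = prepare N t U *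
      (signGate (awayFromInitial x₀ n) * ((prepare N t U)⁻¹ * signGate (flagged n))) := by
  simp only [groverStep, evalCircuit, Gate.eval, extend_inv, prepare, mul_inv_rev, one_mul,
    mul_assoc]

/-- The factors by which `m` Grover steps multiply the flagged and the unflagged part of the
prepared state, when the flagged part has squared norm `a`. -/
def groverFactor (a : ℝ) : ℕ → Bool → ℝ
  | 0, _ => 1
  | m + 1, b => 2 * ((1 - a) * groverFactor a m false - a * groverFactor a m true) +
      (if b then 1 else -1) * groverFactor a m b

/-- With a = sin² θ, a Grover step is the rotation by 2θ in the plane of the flagged and unflagged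
parts. The factors multiply unnormalised parts, so nothing is divided by sin θ or cos θ and the
cases a = 0 and a = 1 need no separate treatment. -/
theorem groverFactor_sin_cos (θ : ℝ) (m : ℕ) :
    Real.sin θ * groverFactor (Real.sin θ ^ 2) m true = Real.sin ((2 * m + 1) * θ) ∧
    Real.cos θ * groverFactor (Real.sin θ ^ 2) m false = Real.cos ((2 * m + 1) * θ) := by
  induction m with
  | zero => simp [groverFactor]
  | succ m ih =>
    obtain ⟨hs, hc⟩ := ih
    have hcos : 1 - Real.sin θ ^ 2 = Real.cos θ ^ 2 := by rw [Real.cos_sq']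
    -- The overlap of the prepared state with the current state after the flagged sign flip; it lies
    -- halfway between the angles (2m+1)θ and (2m+3)θ.
    have ht : (1 - Real.sin θ ^ 2) * groverFactor (Real.sin θ ^ 2) m false -
        Real.sin θ ^ 2 * groverFactor (Real.sin θ ^ 2) m true =
        Real.cos ((2 * m + 2) * θ) := by
      rw [hcos, show (2 * m + 2) * θ = (2 * m + 1) * θ + θ by ring, Real.cos_add, ← hs, ← hc]
      ring
    have e1 : (2 * ((m + 1 : ℕ) : ℝ) + 1) * θ = (2 * m + 2) * θ + θ := by push_cast; ring
    have e2 : (2 * (m : ℝ) + 1) * θ = (2 * m + 2) * θ - θ := by ring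
    rw [e2, Real.sin_sub] at hs
    rw [e2, Real.cos_sub] at hc
    rw [e1, Real.sin_add, Real.cos_add]
    simp only [groverFactor, ht, if_true, reduceCtorEq, if_false]
    constructor
    · linear_combination hs
    · linear_combination -hc

/-- Preparation followed by `n` Grover steps. -/
noncomputable def groverCircuit (t : X → ℝ) (x₀ : X) (P : Matrix.unitaryGroup (Fin N) ℂ) :
    ℕ → List (Gate X (Bool × Fin N))
  | 0 => [.fixed (counterGate X P), .query, .fixed (flagGate N t)]
  | n + 1 => groverCircuit t x₀ P n ++ groverStep t x₀ n

theorem circuitCost_groverCircuit (t : X → ℝ) (x₀ : X) (P : Matrix.unitaryGroup (Fin N) ℂ)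
    (n : ℕ) : circuitCost (groverCircuit t x₀ P n) = 1 + 2 * n := by
  induction n with
  | zero => rfl
  | succ n ih =>
    rw [groverCircuit, circuitCost_append, ih]
    have : circuitCost (groverStep (N := N) t x₀ n) = 2 := rfl
    omega

variable [NeZero N]

/-- Step number `n` acts only on counter values above `n`, so after `n` steps the value k has
undergone min n k of them. Only sign flips are controlled by the counter; the oracle itself is never
queried in a controlled way. -/
theorem groverCircuit_mulVec (t : X → ℝ) (U : Matrix.unitaryGroup X ℂ) (x₀ : X)
    (P : Matrix.unitaryGroup (Fin N) ℂ) {a : ℝ}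
    (ha1 : ∑ x, ‖prepared t U x₀ x true‖ ^ 2 = a)
    (ha0 : ∑ x, ‖prepared t U x₀ x false‖ ^ 2 = 1 - a) (n : ℕ) :
    (evalCircuit U (groverCircuit t x₀ P n)).1 *ᵥ Pi.single (x₀, false, 0) 1 =
      fun z => P.1 z.2.2 0 * groverFactor a (min n z.2.2.1) z.2.1 *
        prepared t U x₀ z.1 z.2.1 := by
  induction n with
  | zero =>
    have h1 : evalCircuit U (groverCircuit t x₀ P 0) = prepare N t U * counterGate X P := by
      simp only [groverCircuit, evalCircuit, Gate.eval, prepare, one_mul]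
    have h2 : (counterGate X P).1 *ᵥ Pi.single (x₀, false, 0) 1 =
        fun y => if y.1 = x₀ ∧ y.2.1 = false then P.1 y.2.2 0 else 0 := by
      ext ⟨x, b, k⟩
      rw [counterGate_mulVec]
      simp only [Matrix.mulVec, dotProduct, Pi.single_apply, Prod.mk.injEq]
      by_cases h : x = x₀ ∧ b = false
      · obtain ⟨rfl, rfl⟩ := h; simp
      · rw [if_neg h]
        refine Finset.sum_eq_zero fun j _ => ?_
        rw [if_neg (fun h' => h ⟨h'.1, h'.2.1⟩), mul_zero]
    ext z
    rw [h1, mul_mulVec_unitary, h2, prepare_mulVec_initial t U x₀ fun k => P.1 k 0]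
    simp [groverFactor]
  | succ n ih =>
    rw [groverCircuit, evalCircuit_append, mul_mulVec_unitary, ih, evalCircuit_groverStep,
      mul_mulVec_unitary, mul_mulVec_unitary, mul_mulVec_unitary]
    ext ⟨x, b, k⟩
    rw [reflection_mulVec]
    simp only [signGate_mulVec, flagged]
    by_cases hk : n < k.1
    · have hsum : ∀ c : Bool → ℂ, ∑ x, ∑ b, star (prepared t U x₀ x b) *
          (c b * prepared t U x₀ x b) = c true * a + c false * (1 - a) := by
        intro c
        have e1 : ((1 - a : ℝ) : ℂ) = 1 - a := by push_cast; ring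
        rw [← e1, ← ha0, ← ha1]
        push_cast
        rw [Finset.mul_sum, Finset.mul_sum, ← Finset.sum_add_distrib]
        refine Finset.sum_congr rfl fun x _ => ?_
        rw [Fintype.sum_bool, ← Complex.conj_mul', ← Complex.conj_mul', Complex.star_def]
        ring
      have h := hsum fun b => (if b = true then -1 else 1) *
        (P.1 k 0 * groverFactor a n b)
      simp only [hk, true_and, if_true, min_eq_left hk.le, min_eq_left (Nat.succ_le_of_lt hk)]
      have h' : ∑ x, ∑ b, star (prepared t U x₀ x b) * ((if b = true then -1 else 1) *
          (P.1 k 0 * groverFactor a n b * prepared t U x₀ x b)) =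
          -(P.1 k 0 * groverFactor a n true) * a + P.1 k 0 * groverFactor a n false * (1 - a) := by
        simp only [if_true, reduceCtorEq, if_false] at h
        rw [show -(P.1 k 0 * (groverFactor a n true : ℂ)) * a +
          P.1 k 0 * groverFactor a n false * (1 - a) = _ by
            rw [← one_mul (P.1 k 0 * (groverFactor a n false : ℂ)), neg_eq_neg_one_mul, ← h]]
        exact Finset.sum_congr rfl fun x _ => Finset.sum_congr rfl fun b _ => by ring
      rw [h']
      cases b <;> simp [groverFactor] <;> ring
    · have h1 : min n k.1 = k.1 := min_eq_right (by omega)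
      have h2 : min (n + 1) k.1 = k.1 := min_eq_right (by omega)
      simp [hk, h1, h2]

end AmplitudeCircuit

end QuantumMDP

namespace QuantumMDP

open scoped ENNReal Matrix

/-! ## Error analysis of amplitude estimation -/

section WindowAnalysis

variable {N : ℕ} [NeZero N]

/-- Outcome amplitudes of phase estimation with the sine window. -/
noncomputable def windowAmplitude (N : ℕ) [NeZero N] (φ : ℝ) : Fin N → ℂ :=
  (dft N).1 *ᵥ fun k => sineWindow N k * Complex.exp (((2 * k.1 + 1) * φ : ℝ) * Complex.I)

theorem sum_norm_sq_windowAmplitude (hN : 2 ≤ N) (φ : ℝ) :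
    ∑ y, ‖windowAmplitude N φ y‖ ^ 2 = 1 := by
  rw [windowAmplitude, sum_norm_sq_mulVec, ← sum_sineWindow_sq hN,
    ← Fin.sum_univ_eq_sum_range fun k => sineWindow N k ^ 2]
  refine Finset.sum_congr rfl fun k _ => ?_
  rw [norm_mul, Complex.norm_exp_ofReal_mul_I, mul_one, Complex.norm_real, Real.norm_eq_abs,
    sq_abs]

theorem norm_one_sub_exp_sq (u : ℝ) :
    ‖1 - Complex.exp ((2 * u : ℝ) * Complex.I)‖ ^ 2 = 4 * Real.sin u ^ 2 := by
  rw [← Complex.normSq_eq_norm_sq, Complex.normSq_apply]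
  simp only [Complex.sub_re, Complex.sub_im, Complex.one_re, Complex.one_im,
    Complex.exp_ofReal_mul_I_re, Complex.exp_ofReal_mul_I_im]
  have h := Real.sin_sq_add_cos_sq (2 * u)
  have h2 := Real.sin_sq_eq_half_sub u
  nlinarith

/-- Summation by parts. Multiplying ∑ s_k z^k by 1 - z replaces the window by its differences, and
|1 - z|² is the sine factor on the left. -/
theorem norm_sq_windowAmplitude_mul (hN : 2 ≤ N) (φ : ℝ) (y : Fin N) :
    ‖windowAmplitude N φ y‖ ^ 2 * (4 * Real.sin (φ + Real.pi * y / N) ^ 2) =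
      ‖((dft N).1 *ᵥ fun k => (sineWindow N (k.1 + 1) - sineWindow N k.1 : ℝ) *
        Complex.exp ((2 * k.1 * φ : ℝ) * Complex.I)) y‖ ^ 2 := by
  have hN0 : (N : ℝ) ≠ 0 := by positivity
  set z : ℂ := Complex.exp ((2 * (φ + Real.pi * y / N) : ℝ) * Complex.I) with hz
  have hzk : ∀ k : ℕ, (rootOfUnity N ^ y.1) ^ k * Complex.exp ((2 * k * φ : ℝ) * Complex.I) =
      z ^ k := by
    intro k
    rw [hz, rootOfUnity, ← Complex.exp_nat_mul, ← Complex.exp_nat_mul, ← Complex.exp_nat_mul,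
      ← Complex.exp_add]
    congr 1
    push_cast
    ring
  -- There are no boundary terms because the sine window vanishes at both 0 and N.
  have hshift : (1 - z) * ∑ k ∈ Finset.range N, (sineWindow N k : ℂ) * z ^ k =
      z * ∑ k ∈ Finset.range N, ((sineWindow N (k + 1) - sineWindow N k : ℝ) : ℂ) * z ^ k := by
    have h0 : sineWindow N 0 = 0 := by simp [sineWindow]
    have hNN : sineWindow N N = 0 := by simp [sineWindow, hN0]
    have h1 := Finset.sum_range_succ (fun k => (sineWindow N k : ℂ) * z ^ k) N
    have h2 := Finset.sum_range_succ' (fun k => (sineWindow N k : ℂ) * z ^ k) N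
    rw [h1, hNN, h0] at h2
    simp only [Complex.ofReal_zero, zero_mul, add_zero] at h2
    rw [sub_mul, one_mul, Finset.mul_sum, Finset.mul_sum]
    nth_rewrite 1 [h2]
    rw [← Finset.sum_sub_distrib]
    refine Finset.sum_congr rfl fun k _ => ?_
    push_cast
    ring
  have e1 : windowAmplitude N φ y = Complex.exp ((φ : ℝ) * Complex.I) *
      (∑ k ∈ Finset.range N, (sineWindow N k : ℂ) * z ^ k) / (Real.sqrt N : ℂ) := by
    rw [windowAmplitude, dft_mulVec
      (fun k => (sineWindow N k : ℂ) * Complex.exp (((2 * k + 1) * φ : ℝ) * Complex.I)),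
      Finset.mul_sum]
    congr 1
    refine Finset.sum_congr rfl fun k _ => ?_
    rw [← hzk, show (((2 * k + 1) * φ : ℝ) : ℂ) * Complex.I =
      (φ : ℝ) * Complex.I + (2 * k * φ : ℝ) * Complex.I by push_cast; ring, Complex.exp_add]
    ring
  have e2 : ((dft N).1 *ᵥ fun k => (sineWindow N (k.1 + 1) - sineWindow N k.1 : ℝ) *
        Complex.exp ((2 * k.1 * φ : ℝ) * Complex.I)) y =
      (∑ k ∈ Finset.range N, ((sineWindow N (k + 1) - sineWindow N k : ℝ) : ℂ) * z ^ k) /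
        (Real.sqrt N : ℂ) := by
    rw [dft_mulVec (fun k => ((sineWindow N (k + 1) - sineWindow N k : ℝ) : ℂ) *
        Complex.exp ((2 * k * φ : ℝ) * Complex.I))]
    congr 1
    refine Finset.sum_congr rfl fun k _ => ?_
    rw [← hzk]
    ring
  have hz1 : ‖z‖ = 1 := Complex.norm_exp_ofReal_mul_I _
  have h := congrArg norm hshift
  rw [norm_mul, norm_mul, hz1, one_mul] at h
  rw [e1, e2, ← norm_one_sub_exp_sq, ← hz, norm_div, norm_div, norm_mul,
    Complex.norm_exp_ofReal_mul_I, ← h]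
  ring

/-- By Parseval, the sum over outcomes of the previous identity is the Dirichlet energy of the
window, at most 20/N². -/
theorem sum_windowAmplitude_mul_sin_sq_le (hN : 2 ≤ N) (φ : ℝ) :
    ∑ y : Fin N, ‖windowAmplitude N φ y‖ ^ 2 * Real.sin (φ + Real.pi * y / N) ^ 2 ≤ 5 / N ^ 2 := by
  have h1 : ∑ y : Fin N, ‖windowAmplitude N φ y‖ ^ 2 *
      (4 * Real.sin (φ + Real.pi * y / N) ^ 2) ≤ 20 / (N : ℝ) ^ 2 := by
    rw [Finset.sum_congr rfl fun y _ => norm_sq_windowAmplitude_mul hN φ y, sum_norm_sq_mulVec]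
    refine le_trans (le_of_eq ?_) (sum_sineWindow_sub_sq_le hN)
    rw [← Fin.sum_univ_eq_sum_range fun k => (sineWindow N k - sineWindow N (k + 1)) ^ 2]
    refine Finset.sum_congr rfl fun k _ => ?_
    rw [norm_mul, Complex.norm_exp_ofReal_mul_I, mul_one, Complex.norm_real, Real.norm_eq_abs,
      sq_abs]
    ring
  have h2 : ∑ y : Fin N, ‖windowAmplitude N φ y‖ ^ 2 *
      (4 * Real.sin (φ + Real.pi * y / N) ^ 2) =
      4 * ∑ y : Fin N, ‖windowAmplitude N φ y‖ ^ 2 * Real.sin (φ + Real.pi * y / N) ^ 2 := by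
    rw [Finset.mul_sum]
    exact Finset.sum_congr rfl fun y _ => by ring
  rw [h2] at h1
  linarith [show (20 : ℝ) / N ^ 2 = 4 * (5 / N ^ 2) by ring]

/-- The difference factors as sin(φ+x) sin(x-φ), and |sin(x-φ)| ≤ d + 2|sin φ| with d = |sin(φ+x)|.
Only the second moment of d is controlled, so the linear term is traded by 2d ≤ 1/n + nd². -/
theorem abs_sin_sq_sub_sin_sq_le (x φ : ℝ) {n : ℝ} (hn : 0 < n) :
    |Real.sin x ^ 2 - Real.sin φ ^ 2| ≤
      |Real.sin φ| / n + (1 + n * |Real.sin φ|) * Real.sin (φ + x) ^ 2 := by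
  set d := |Real.sin (φ + x)| with hd
  have h1 : Real.sin x ^ 2 - Real.sin φ ^ 2 = Real.sin (φ + x) * Real.sin (x - φ) := by
    rw [Real.sin_add, Real.sin_sub]
    nlinarith [Real.sin_sq_add_cos_sq x, Real.sin_sq_add_cos_sq φ]
  have h2 : |Real.sin (x - φ)| ≤ d + 2 * |Real.sin φ| := by
    have e : Real.sin (x - φ) = Real.sin (φ + x) * Real.cos (2 * φ) -
        2 * (Real.cos (φ + x) * Real.cos φ * Real.sin φ) := by
      rw [show x - φ = (φ + x) - 2 * φ by ring, Real.sin_sub, Real.sin_two_mul]; ring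
    rw [e]
    refine (abs_sub _ _).trans ?_
    rw [abs_mul, abs_mul, abs_mul, abs_mul, abs_two]
    have c1 := Real.abs_cos_le_one (2 * φ)
    have c2 := Real.abs_cos_le_one (φ + x)
    have c3 := Real.abs_cos_le_one φ
    have c4 : |Real.cos (φ + x)| * |Real.cos φ| ≤ 1 := mul_le_one₀ c2 (abs_nonneg _) c3
    have c5 := mul_le_mul_of_nonneg_right c4 (abs_nonneg (Real.sin φ))
    have c6 := mul_le_mul_of_nonneg_left c1 (abs_nonneg (Real.sin (φ + x)))
    linarith
  have h3 : 2 * d ≤ 1 / n + n * d ^ 2 := by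
    have : 1 / n + n * d ^ 2 - 2 * d = (1 - n * d) ^ 2 / n := by field_simp; ring
    have h4 : 0 ≤ (1 - n * d) ^ 2 / n := by positivity
    linarith
  rw [h1, abs_mul, ← sq_abs (Real.sin (φ + x)), ← hd]
  calc d * |Real.sin (x - φ)| ≤ d * (d + 2 * |Real.sin φ|) := by gcongr
    _ = d ^ 2 + 2 * d * |Real.sin φ| := by ring
    _ ≤ d ^ 2 + (1 / n + n * d ^ 2) * |Real.sin φ| := by gcongr
    _ = _ := by ring

/-- The choice n = N balances the two terms of `abs_sin_sq_sub_sin_sq_le` against the second moment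
5/N². -/
theorem sum_windowAmplitude_mul_error_le (hN : 2 ≤ N) (φ : ℝ) :
    ∑ y : Fin N, ‖windowAmplitude N φ y‖ ^ 2 *
      |Real.sin (Real.pi * y / N) ^ 2 - Real.sin φ ^ 2| ≤
      6 * |Real.sin φ| / N + 5 / N ^ 2 := by
  have hN0 : (0 : ℝ) < N := by positivity
  calc ∑ y : Fin N, ‖windowAmplitude N φ y‖ ^ 2 *
        |Real.sin (Real.pi * y / N) ^ 2 - Real.sin φ ^ 2|
      ≤ ∑ y : Fin N, (‖windowAmplitude N φ y‖ ^ 2 * (|Real.sin φ| / N) + (1 + N * |Real.sin φ|) *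
          (‖windowAmplitude N φ y‖ ^ 2 * Real.sin (φ + Real.pi * y / N) ^ 2)) := by
        refine Finset.sum_le_sum fun y _ => ?_
        have := mul_le_mul_of_nonneg_left
          (abs_sin_sq_sub_sin_sq_le (Real.pi * y / N) φ hN0)
          (sq_nonneg ‖windowAmplitude N φ y‖)
        linarith
    _ = |Real.sin φ| / N + (1 + N * |Real.sin φ|) * ∑ y : Fin N,
          (‖windowAmplitude N φ y‖ ^ 2 * Real.sin (φ + Real.pi * y / N) ^ 2) := by
        rw [Finset.sum_add_distrib, ← Finset.sum_mul, sum_norm_sq_windowAmplitude hN, one_mul,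
          Finset.mul_sum]
    _ ≤ |Real.sin φ| / N + (1 + N * |Real.sin φ|) * (5 / N ^ 2) := by
        gcongr
        exact sum_windowAmplitude_mul_sin_sq_le hN φ
    _ = _ := by field_simp; ring

/-- Parallelogram law. It rewrites the flagged and unflagged contributions as an equal mixture of
the phases θ and -θ. -/
theorem norm_sin_sq_add_norm_cos_sq (s c p m : ℂ) (hp : p = c + s * Complex.I)
    (hm : m = c - s * Complex.I) : ‖s‖ ^ 2 + ‖c‖ ^ 2 = (‖p‖ ^ 2 + ‖m‖ ^ 2) / 2 := by
  subst hp hm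
  simp only [← Complex.normSq_eq_norm_sq, Complex.normSq_apply, Complex.add_re, Complex.add_im,
    Complex.sub_re, Complex.sub_im, Complex.mul_re, Complex.mul_im, Complex.I_re, Complex.I_im]
  ring

end WindowAnalysis

/-! ### The amplitude estimation program and its expected error. -/

section AmplitudeEstimation

variable {X : Type} [Fintype X] [DecidableEq X]

/-- Preparation of the sine window in the counter. -/
noncomputable def windowGate (n : ℕ) : Matrix.unitaryGroup (Fin (n + 2)) ℂ :=
  householder 0 (fun k => sineWindow (n + 2) k) (by simp [sineWindow]) (by
    rw [Fin.sum_univ_eq_sum_range fun k => sineWindow (n + 2) k ^ 2]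
    exact sum_sineWindow_sq (by omega))

/-- The circuit of amplitude estimation. -/
noncomputable def amplitudeCircuit (t : X → ℝ) (x₀ : X) (n : ℕ) :
    List (Gate X (Bool × Fin (n + 2))) :=
  groverCircuit t x₀ (windowGate n) (n + 1) ++ [.fixed (counterGate X (dft (n + 2)))]

/-- Amplitude estimation with a counter of size `n + 2`; the flag is rotated by `t x`. -/
noncomputable def amplitudeEstimation (t : X → ℝ) (x₀ : X) (n : ℕ) : QProg X ℝ :=
  .run (Bool × Fin (n + 2)) (amplitudeCircuit t x₀ n) (x₀, false, 0)
    fun z => .ret (Real.sin (Real.pi * z.2.2 / (n + 2 : ℕ)) ^ 2)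

theorem amplitudeEstimation_costLE (t : X → ℝ) (x₀ : X) (n : ℕ) :
    (amplitudeEstimation t x₀ n).CostLE (2 * (n + 2)) := by
  refine ⟨0, ?_, fun _ => trivial⟩
  rw [amplitudeCircuit, circuitCost_append, circuitCost_groverCircuit]
  have : circuitCost [Gate.fixed (counterGate X (dft (n + 2)))] = 0 := rfl
  omega

theorem amplitudeCircuit_apply (t : X → ℝ) (U : Matrix.unitaryGroup X ℂ) (x₀ : X) (n : ℕ) {a : ℝ}
    (ha1 : ∑ x, ‖prepared t U x₀ x true‖ ^ 2 = a)
    (ha0 : ∑ x, ‖prepared t U x₀ x false‖ ^ 2 = 1 - a) (z : X × Bool × Fin (n + 2)) :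
    (evalCircuit U (amplitudeCircuit t x₀ n)).1 z (x₀, false, 0) =
      ((dft (n + 2)).1 *ᵥ fun k => sineWindow (n + 2) k * groverFactor a k z.2.1) z.2.2 *
        prepared t U x₀ z.1 z.2.1 := by
  have h : (evalCircuit U (amplitudeCircuit t x₀ n)).1 z (x₀, false, 0) =
      ((evalCircuit U (amplitudeCircuit t x₀ n)).1 *ᵥ Pi.single (x₀, false, 0) 1) z := by
    rw [Matrix.mulVec_single_one]; rfl
  rw [h, amplitudeCircuit, evalCircuit_append, mul_mulVec_unitary,
    groverCircuit_mulVec t U x₀ (windowGate n) ha1 ha0]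
  simp only [evalCircuit, Gate.eval, one_mul]
  rw [counterGate_mulVec, mul_comm, ← smul_eq_mul, ← Pi.smul_apply, ← Matrix.mulVec_smul]
  congr 1
  ext k
  -- The counter takes values up to n + 1 only, so n + 1 steps realise every power k in full.
  have hk : min (n + 1) k.1 = k.1 := min_eq_right (by omega)
  simp [windowGate, householder_apply, hk]
  ring

/-- The measured counter is distributed as an equal mixture of phase estimation at θ and at -θ. The
output sin² is blind to the sign, so the window bound applies to both halves. -/
theorem expect_amplitudeEstimation_le (t : X → ℝ) (U : Matrix.unitaryGroup X ℂ) (x₀ : X) (n : ℕ)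
    {a : ℝ} (ha1 : ∑ x, ‖prepared t U x₀ x true‖ ^ 2 = a)
    (ha0 : ∑ x, ‖prepared t U x₀ x false‖ ^ 2 = 1 - a) :
    expect ((amplitudeEstimation t x₀ n).law U) (fun r => ENNReal.ofReal |r - a|) ≤
      ENNReal.ofReal (6 * Real.sqrt a / (n + 2 : ℕ) + 5 / (n + 2 : ℕ) ^ 2) := by
  have hN : 2 ≤ n + 2 := by omega
  have ha_nonneg : 0 ≤ a := ha1 ▸ Finset.sum_nonneg fun _ _ => by positivity
  have ha_le : a ≤ 1 := by
    have : 0 ≤ 1 - a := ha0 ▸ Finset.sum_nonneg fun _ _ => by positivity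
    linarith
  set θ := Real.arcsin (Real.sqrt a) with hθ
  have hsin : Real.sin θ = Real.sqrt a := Real.sin_arcsin
    (by linarith [Real.sqrt_nonneg a]) (Real.sqrt_le_one.2 ha_le)
  have hsq : Real.sin θ ^ 2 = a := by rw [hsin, Real.sq_sqrt ha_nonneg]
  set err : Fin (n + 2) → ℝ := fun y =>
    |Real.sin (Real.pi * y / (n + 2 : ℕ)) ^ 2 - a| with herr
  set V : Bool → Fin (n + 2) → ℂ := fun b =>
    (dft (n + 2)).1 *ᵥ fun k => sineWindow (n + 2) k * groverFactor a k b with hV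
  -- Up to the factors sin θ and cos θ, the two flag values carry the sines and cosines of (2k+1)θ.
  -- Their combinations cos ± i sin are the phases seen by `windowAmplitude` at ±θ.
  have hprob : ∀ y, ‖V true y‖ ^ 2 * a + ‖V false y‖ ^ 2 * (1 - a) =
      (‖windowAmplitude (n + 2) θ y‖ ^ 2 + ‖windowAmplitude (n + 2) (-θ) y‖ ^ 2) / 2 := by
    intro y
    have hcos : 1 - a = Real.cos θ ^ 2 := by rw [Real.cos_sq', hsq]
    have hs : ∀ k : ℕ, (Real.sin θ : ℂ) * groverFactor a k true =
        Real.sin ((2 * k + 1) * θ) := fun k => by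
      rw [← hsq, ← (groverFactor_sin_cos θ k).1]; push_cast; ring
    have hc : ∀ k : ℕ, (Real.cos θ : ℂ) * groverFactor a k false =
        Real.cos ((2 * k + 1) * θ) := fun k => by
      rw [← hsq, ← (groverFactor_sin_cos θ k).2]; push_cast; ring
    have hlin : ∀ (c : ℂ) (b : Bool), c * V b y =
        ((dft (n + 2)).1 *ᵥ fun k => c * (sineWindow (n + 2) k * groverFactor a k b)) y := by
      intro c b
      rw [hV, ← smul_eq_mul, ← Pi.smul_apply, ← Matrix.mulVec_smul]
      rfl
    have e1 : ‖V true y‖ ^ 2 * a = ‖(Real.sin θ : ℂ) * V true y‖ ^ 2 := by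
      rw [norm_mul, Complex.norm_real, Real.norm_eq_abs, mul_pow, sq_abs, hsq, mul_comm]
    have e0 : ‖V false y‖ ^ 2 * (1 - a) = ‖(Real.cos θ : ℂ) * V false y‖ ^ 2 := by
      rw [norm_mul, Complex.norm_real, Real.norm_eq_abs, mul_pow, sq_abs, hcos, mul_comm]
    rw [e1, e0]
    apply norm_sin_sq_add_norm_cos_sq
    · rw [hlin, hlin, mul_comm _ Complex.I, ← smul_eq_mul, ← Pi.smul_apply,
        ← Matrix.mulVec_smul, ← Pi.add_apply, ← Matrix.mulVec_add, windowAmplitude]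
      congr 2
      ext k
      simp only [Pi.add_apply, Pi.smul_apply, smul_eq_mul]
      rw [Complex.exp_mul_I, ← Complex.ofReal_cos, ← Complex.ofReal_sin, ← hs, ← hc]
      ring
    · rw [hlin, hlin, mul_comm _ Complex.I, ← smul_eq_mul, ← Pi.smul_apply,
        ← Matrix.mulVec_smul, ← Pi.sub_apply, ← Matrix.mulVec_sub, windowAmplitude]
      congr 2
      ext k
      simp only [Pi.sub_apply, Pi.smul_apply, smul_eq_mul]
      rw [Complex.exp_mul_I, ← Complex.ofReal_cos, ← Complex.ofReal_sin, mul_neg, Real.cos_neg,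
        Real.sin_neg, Complex.ofReal_neg, ← hs, ← hc]
      ring
  have hreal : ∑ z : X × Bool × Fin (n + 2),
      ‖(evalCircuit U (amplitudeCircuit t x₀ n)).1 z (x₀, false, 0)‖ ^ 2 * err z.2.2 ≤
      6 * Real.sqrt a / (n + 2 : ℕ) + 5 / (n + 2 : ℕ) ^ 2 := by
    calc ∑ z : X × Bool × Fin (n + 2),
          ‖(evalCircuit U (amplitudeCircuit t x₀ n)).1 z (x₀, false, 0)‖ ^ 2 * err z.2.2
        = ∑ y, (‖V true y‖ ^ 2 * a + ‖V false y‖ ^ 2 * (1 - a)) * err y := by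
          simp_rw [amplitudeCircuit_apply t U x₀ n ha1 ha0, Fintype.sum_prod_type,
            Fintype.sum_bool, ← Finset.sum_add_distrib]
          rw [Finset.sum_comm]
          refine Finset.sum_congr rfl fun y _ => ?_
          rw [← ha0, ← ha1, Finset.mul_sum, Finset.mul_sum, ← Finset.sum_add_distrib,
            Finset.sum_mul]
          refine Finset.sum_congr rfl fun x _ => ?_
          rw [norm_mul, norm_mul, mul_pow, mul_pow, add_mul, ha1]
      _ = ((∑ y, ‖windowAmplitude (n + 2) θ y‖ ^ 2 * err y) +
            ∑ y, ‖windowAmplitude (n + 2) (-θ) y‖ ^ 2 * err y) / 2 := by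
          rw [← Finset.sum_add_distrib, Finset.sum_div]
          refine Finset.sum_congr rfl fun y _ => ?_
          rw [hprob]; ring
      _ ≤ _ := by
          have h1 := sum_windowAmplitude_mul_error_le hN θ
          have h2 := sum_windowAmplitude_mul_error_le hN (-θ)
          rw [Real.sin_neg, neg_sq, abs_neg] at h2
          rw [hsq, hsin, abs_of_nonneg (Real.sqrt_nonneg a)] at h1 h2
          linarith
  rw [amplitudeEstimation, QProg.law_run, expect_bind]
  simp_rw [QProg.law_ret, expect_pure]
  rw [expect_fintype]
  calc _ = ∑ z : X × Bool × Fin (n + 2), ENNReal.ofReal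
        (‖(evalCircuit U (amplitudeCircuit t x₀ n)).1 z (x₀, false, 0)‖ ^ 2 * err z.2.2) := by
        refine Finset.sum_congr rfl fun z _ => ?_
        rw [ENNReal.ofReal_mul (by positivity)]
        rfl
    _ = ENNReal.ofReal (∑ z : X × Bool × Fin (n + 2),
        ‖(evalCircuit U (amplitudeCircuit t x₀ n)).1 z (x₀, false, 0)‖ ^ 2 * err z.2.2) :=
        (ENNReal.ofReal_sum_of_nonneg fun _ _ => by positivity).symm
    _ ≤ _ := ENNReal.ofReal_le_ofReal hreal

end AmplitudeEstimation

end QuantumMDP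

namespace QuantumMDP

open scoped ENNReal Matrix

/-! ## Mean estimation for functions with values in the unit interval -/

section UnitInterval

variable {Ω J : Type} [Fintype Ω] [DecidableEq Ω] [Fintype J] [DecidableEq J]
  {p : Ω → ℝ} {x₀ : Ω} {j₀ : J} {U : Matrix.unitaryGroup (Ω × J) ℂ}

theorem Encodes.sum_norm_sq_mul (h : Encodes p x₀ j₀ U) (hp : ∀ x, 0 ≤ p x) (g : Ω → ℝ) :
    ∑ z : Ω × J, ‖U.1 z (x₀, j₀)‖ ^ 2 * g z.1 = mean p g := by
  obtain ⟨ψ, hψ, hU⟩ := h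
  rw [Fintype.sum_prod_type, mean]
  refine Finset.sum_congr rfl fun x _ => ?_
  have : ∀ j, ‖U.1 (x, j) (x₀, j₀)‖ ^ 2 * g x = p x * g x * ‖ψ x j‖ ^ 2 := by
    intro j
    rw [hU, norm_mul, Complex.norm_real, Real.norm_eq_abs, mul_pow, sq_abs, Real.sq_sqrt (hp x)]
    ring
  rw [Finset.sum_congr rfl fun j _ => this j, ← Finset.mul_sum, hψ, mul_one]

/-- Amplitude estimation of the mean of `f`. -/
noncomputable def unitMean (x₀ : Ω) (j₀ : J) (n : ℕ) (f : Ω → ℝ) : QProg (Ω × J) ℝ :=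
  amplitudeEstimation (fun z => Real.arcsin (Real.sqrt (f z.1))) (x₀, j₀) n

/-- Rotation by arcsin √f(x) flags outcome x with conditional probability f(x), so the flag has
total probability equal to the mean. The vectors ψₓ drop out because they are unit vectors. -/
theorem expect_unitMean_le (h : Encodes p x₀ j₀ U) (hp : ∀ x, 0 ≤ p x) (hp1 : ∑ x, p x = 1)
    (n : ℕ) {f : Ω → ℝ} (hf0 : ∀ x, 0 ≤ f x) (hf1 : ∀ x, f x ≤ 1) :
    expect ((unitMean x₀ j₀ n f).law U) (fun r => ENNReal.ofReal |r - mean p f|) ≤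
      ENNReal.ofReal (6 * Real.sqrt (mean p f) / (n + 2 : ℕ) + 5 / (n + 2 : ℕ) ^ 2) := by
  have hsin : ∀ x, Real.sin (Real.arcsin (Real.sqrt (f x))) ^ 2 = f x := fun x => by
    rw [Real.sin_arcsin (by linarith [Real.sqrt_nonneg (f x)]) (Real.sqrt_le_one.2 (hf1 x)),
      Real.sq_sqrt (hf0 x)]
  apply expect_amplitudeEstimation_le
  · rw [← h.sum_norm_sq_mul hp]
    refine Finset.sum_congr rfl fun z _ => ?_
    simp only [prepared, rotation, Matrix.of_apply]
    rw [norm_mul, Complex.norm_real, Real.norm_eq_abs, mul_pow, sq_abs, hsin, mul_comm]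
  · have h1 : 1 - mean p f = mean p fun x => 1 - f x := by
      simp [mean, mul_sub, Finset.sum_sub_distrib, hp1]
    rw [h1, ← h.sum_norm_sq_mul hp]
    refine Finset.sum_congr rfl fun z _ => ?_
    simp only [prepared, rotation, Matrix.of_apply]
    rw [norm_mul, Complex.norm_real, Real.norm_eq_abs, mul_pow, sq_abs, Real.cos_sq', hsin,
      mul_comm]

theorem unitMean_costLE (x₀ : Ω) (j₀ : J) (n : ℕ) (f : Ω → ℝ) :
    (unitMean x₀ j₀ n f).CostLE (2 * (n + 2)) := amplitudeEstimation_costLE _ _ _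

/-- Estimate of `∑ j < k, w j * mean p (f j)`. -/
noncomputable def weightedMeans (x₀ : Ω) (j₀ : J) (n : ℕ) (w : ℕ → ℝ) (f : ℕ → Ω → ℝ) :
    ℕ → QProg (Ω × J) ℝ
  | 0 => .ret 0
  | k + 1 => (weightedMeans x₀ j₀ n w f k).bind fun a =>
      (unitMean x₀ j₀ n (f k)).bind fun r => .ret (a + w k * r)

theorem weightedMeans_costLE (x₀ : Ω) (j₀ : J) (n : ℕ) (w : ℕ → ℝ) (f : ℕ → Ω → ℝ) (k : ℕ) :
    (weightedMeans x₀ j₀ n w f k).CostLE (k * (2 * (n + 2))) := by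
  induction k with
  | zero => trivial
  | succ k ih =>
    have : (k + 1) * (2 * (n + 2)) = k * (2 * (n + 2)) + (2 * (n + 2) + 0) := by ring
    rw [this]
    exact ih.bind fun a => (unitMean_costLE _ _ _ _).bind fun r => trivial

/-- Expected absolute errors add by the triangle inequality, so no union bound over the single
estimates is needed. -/
theorem expect_weightedMeans_le (h : Encodes p x₀ j₀ U) (hp : ∀ x, 0 ≤ p x)
    (hp1 : ∑ x, p x = 1) (n : ℕ) {w : ℕ → ℝ} (hw : ∀ j, 0 ≤ w j) {f : ℕ → Ω → ℝ}
    (hf0 : ∀ j x, 0 ≤ f j x) (hf1 : ∀ j x, f j x ≤ 1) (k : ℕ) :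
    expect ((weightedMeans x₀ j₀ n w f k).law U)
        (fun r => ENNReal.ofReal |r - ∑ j ∈ Finset.range k, w j * mean p (f j)|) ≤
      ENNReal.ofReal (∑ j ∈ Finset.range k,
        w j * (6 * Real.sqrt (mean p (f j)) / (n + 2 : ℕ) + 5 / (n + 2 : ℕ) ^ 2)) := by
  induction k with
  | zero => simp [weightedMeans, QProg.law_ret, expect_pure]
  | succ k ih =>
    rw [weightedMeans, QProg.law_bind, expect_bind]
    simp_rw [QProg.law_bind, expect_bind, QProg.law_ret, expect_pure]
    set μ := ∑ j ∈ Finset.range k, w j * mean p (f j) with hμ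
    set e := 6 * Real.sqrt (mean p (f k)) / (n + 2 : ℕ) + 5 / (n + 2 : ℕ) ^ 2 with he
    have hstep : ∀ a : ℝ, expect ((unitMean x₀ j₀ n (f k)).law U)
        (fun r => ENNReal.ofReal |a + w k * r -
          ∑ j ∈ Finset.range (k + 1), w j * mean p (f j)|) ≤
        ENNReal.ofReal |a - μ| + ENNReal.ofReal (w k * e) := by
      intro a
      calc _ ≤ expect ((unitMean x₀ j₀ n (f k)).law U) (fun r => ENNReal.ofReal |a - μ| +
              ENNReal.ofReal (w k) * ENNReal.ofReal |r - mean p (f k)|) := by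
            refine expect_mono _ fun r => ?_
            rw [← ENNReal.ofReal_mul (hw k), ← ENNReal.ofReal_add (abs_nonneg _)
              (mul_nonneg (hw k) (abs_nonneg _))]
            refine ENNReal.ofReal_le_ofReal ?_
            rw [Finset.sum_range_succ, ← hμ, show a + w k * r - (μ + w k * mean p (f k)) =
              (a - μ) + w k * (r - mean p (f k)) by ring]
            refine (abs_add_le _ _).trans ?_
            rw [abs_mul, abs_of_nonneg (hw k)]
        _ ≤ _ := by
            rw [expect_add, expect_const, expect_const_mul, ENNReal.ofReal_mul (hw k)]
            gcongr
            exact expect_unitMean_le h hp hp1 n (hf0 k) (hf1 k)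
    calc _ ≤ _ := expect_mono _ hstep
      _ ≤ _ := by
        rw [expect_add, expect_const, Finset.sum_range_succ, ENNReal.ofReal_add]
        · gcongr
        · exact Finset.sum_nonneg fun j _ => mul_nonneg (hw j) (by positivity)
        · exact mul_nonneg (hw k) (by positivity)

/-- Markov's inequality in the normalisation that `QProg.lt_prob_boost` expects: expected error η/30
against the threshold η/2. -/
theorem fifteen_mul_prob_le_one {α : Type} (ν : PMF α) (err : α → ℝ) {η : ℝ} (hη : 0 < η)
    (h : expect ν (fun x => ENNReal.ofReal (err x)) ≤ ENNReal.ofReal (η / 30)) :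
    15 * ν.toOuterMeasure {x | η / 2 ≤ err x} ≤ 1 := by
  have h1 : {x | η / 2 ≤ err x} = {x | ENNReal.ofReal (η / 2) ≤ ENNReal.ofReal (err x)} := by
    ext x
    simp only [Set.mem_ofPred_eq]
    constructor
    · exact fun hx => ENNReal.ofReal_le_ofReal hx
    · intro hx
      by_contra hc
      rw [not_le] at hc
      exact absurd hx (not_le.2 ((ENNReal.ofReal_lt_ofReal_iff (by positivity)).2 hc))
  have h2 := (markov ν (fun x => ENNReal.ofReal (err x)) (ENNReal.ofReal (η / 2))).trans h
  rw [← h1] at h2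
  have h3 : ENNReal.ofReal (η / 2) = 15 * ENNReal.ofReal (η / 30) := by
    rw [show (15 : ℝ≥0∞) = ENNReal.ofReal 15 by norm_num, ← ENNReal.ofReal_mul (by norm_num)]
    congr 1; ring
  have h4 : ENNReal.ofReal (η / 30) ≠ 0 := by
    rw [Ne, ENNReal.ofReal_eq_zero, not_le]; positivity
  rw [h3, mul_comm (15 : ℝ≥0∞), mul_assoc] at h2
  rw [← ENNReal.mul_le_mul_iff_right h4 ENNReal.ofReal_ne_top, mul_one]
  exact h2

end UnitInterval

/-! ## Mean estimation for bounded functions -/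

/-- Mean estimation for functions with values in `[0, u]`. -/
noncomputable def qEst1 : MeanEstimator := fun _ _ _ _ _ _ x₀ j₀ v u η δ =>
  if u < 2 * η then .ret (u / 2)
  else ((unitMean x₀ j₀ ⌈330 * (u / η)⌉₊ fun x => v x / u).bind fun r => .ret (u * r)).boost η δ

theorem mean_nonneg {Ω : Type} [Fintype Ω] {p f : Ω → ℝ} (hp : ∀ x, 0 ≤ p x) (hf : ∀ x, 0 ≤ f x) :
    0 ≤ mean p f := Finset.sum_nonneg fun x _ => mul_nonneg (hp x) (hf x)

theorem mean_mono {Ω : Type} [Fintype Ω] {p f g : Ω → ℝ} (hp : ∀ x, 0 ≤ p x)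
    (h : ∀ x, f x ≤ g x) : mean p f ≤ mean p g :=
  Finset.sum_le_sum fun x _ => mul_le_mul_of_nonneg_left (h x) (hp x)

theorem mean_const {Ω : Type} [Fintype Ω] {p : Ω → ℝ} (hp1 : ∑ x, p x = 1) (c : ℝ) :
    mean p (fun _ => c) = c := by
  rw [mean, ← Finset.sum_mul, hp1, one_mul]

theorem mean_const_mul {Ω : Type} [Fintype Ω] (p : Ω → ℝ) (c : ℝ) (f : Ω → ℝ) :
    mean p (fun x => c * f x) = c * mean p f := by
  simp only [mean, Finset.mul_sum, mul_left_comm]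

theorem mean_add {Ω : Type} [Fintype Ω] (p f g : Ω → ℝ) :
    mean p (fun x => f x + g x) = mean p f + mean p g := by
  simp only [mean, mul_add, Finset.sum_add_distrib]

theorem mean_sub {Ω : Type} [Fintype Ω] (p f g : Ω → ℝ) :
    mean p (fun x => f x - g x) = mean p f - mean p g := by
  simp only [mean, mul_sub, Finset.sum_sub_distrib]

theorem mean_sq_sub {Ω : Type} [Fintype Ω] {p : Ω → ℝ} (hp1 : ∑ x, p x = 1) (v : Ω → ℝ) (m : ℝ) :
    mean p (fun x => (v x - m) ^ 2) = variance p v + (mean p v - m) ^ 2 := by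
  have h0 : mean p (fun x => v x - mean p v) = 0 := by
    rw [mean_sub, mean_const hp1, sub_self]
  have h1 : ∀ x, (v x - m) ^ 2 = ((v x - mean p v) ^ 2 + 2 * (mean p v - m) * (v x - mean p v)) +
      (mean p v - m) ^ 2 := fun x => by ring
  simp_rw [h1]
  rw [mean_add, mean_add, mean_const_mul, h0, mean_const hp1, mul_zero, add_zero]
  rfl

theorem one_le_logp (x : ℝ) : 1 ≤ logp x := le_max_left _ _

theorem isQEst1_qEst1 : IsQEst1 2700 qEst1 := by
  intro Ω J _ _ _ _ x₀ j₀ v u η δ U hu hη hδ0 hδ1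
  have hL := one_le_logp (1 / δ)
  have hdiv : 0 < u / η := div_pos hu hη
  -- The mean lies in [0,u], so u/2 is off by at most u/2 < η and no query is needed. Otherwise u/η
  -- ≥ 2, which absorbs the rounding of the counter size.
  by_cases hsmall : u < 2 * η
  · have hq : qEst1 Ω J x₀ j₀ v u η δ = .ret (u / 2) := if_pos hsmall
    rw [hq]
    constructor
    · intro w hw
      simp only [QProg.exec, PMF.support_pure, Set.mem_singleton_iff] at hw
      rw [hw]
      simp only [Nat.cast_zero]
      positivity
    · intro p hp hp1 _ hv
      have h0 := mean_nonneg hp fun x => (hv x).1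
      have h1 := (mean_mono hp fun x => (hv x).2).trans_eq (mean_const hp1 u)
      refine lt_prob_of_prob_compl_lt _ hδ0 hδ1 ?_
      have : |u / 2 - mean p v| < η := by
        rw [abs_lt]; constructor <;> linarith
      simp [QProg.exec, PMF.toOuterMeasure_pure_apply, this, hδ0]
  · have hq : qEst1 Ω J x₀ j₀ v u η δ = ((unitMean x₀ j₀ ⌈330 * (u / η)⌉₊ fun x => v x / u).bind
        fun r => .ret (u * r)).boost η δ := if_neg hsmall
    rw [hq]
    rw [not_lt] at hsmall
    have hge : 2 ≤ u / η := by rwa [le_div_iff₀ hη]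
    set n := ⌈330 * (u / η)⌉₊ with hn
    have hn1 : 330 * (u / η) ≤ n := Nat.le_ceil _
    have hn2 : (n : ℝ) < 330 * (u / η) + 1 := Nat.ceil_lt_add_one (by positivity)
    constructor
    · intro w hw
      have h1 := (((unitMean_costLE x₀ j₀ n fun x => v x / u).bind (n := 0)
        (f := fun r => .ret (u * r)) fun _ => trivial).boost η δ).exec_le U hw
      have h2 : (w.2 : ℝ) ≤ repetitions δ * (2 * (n + 2)) := by exact_mod_cast h1
      have h3 := repetitions_le hδ0 hδ1
      calc (w.2 : ℝ) ≤ repetitions δ * (2 * (n + 2)) := h2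
        _ ≤ (4 * logp (1 / δ)) * (2 * (332 * (u / η))) := by gcongr; linarith
        _ = 2656 * (u / η) * logp (1 / δ) := by ring
        _ ≤ 2700 * (u / η + Real.sqrt (u / η)) * logp (1 / δ) := by
          gcongr
          · norm_num
          · linarith [Real.sqrt_nonneg (u / η)]
    · intro p hp hp1 henc hv
      refine QProg.lt_prob_boost U _ hδ0 hδ1 (fifteen_mul_prob_le_one _ _ hη ?_)
      have hmean : mean p v = u * mean p fun x => v x / u := by
        rw [← mean_const_mul]
        congr 1; ext x; field_simp
      have hmean1 : mean p (fun x => v x / u) ≤ 1 := by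
        rw [← mean_const hp1 1]
        exact mean_mono hp fun x => (div_le_one hu).2 (hv x).2
      rw [QProg.law_bind, expect_bind]
      simp_rw [QProg.law_ret, expect_pure]
      calc _ = expect ((unitMean x₀ j₀ n fun x => v x / u).law U) (fun r => ENNReal.ofReal u *
            ENNReal.ofReal |r - mean p fun x => v x / u|) := by
            congr 1; ext r
            rw [← ENNReal.ofReal_mul hu.le, hmean, ← mul_sub, abs_mul, abs_of_pos hu]
        _ ≤ ENNReal.ofReal u * ENNReal.ofReal
            (6 * Real.sqrt (mean p fun x => v x / u) / (n + 2 : ℕ) + 5 / (n + 2 : ℕ) ^ 2) := by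
            rw [expect_const_mul]
            gcongr
            exact expect_unitMean_le henc hp hp1 n (fun x => div_nonneg (hv x).1 hu.le)
              fun x => (div_le_one hu).2 (hv x).2
        _ ≤ ENNReal.ofReal (η / 30) := by
            rw [← ENNReal.ofReal_mul hu.le]
            refine ENNReal.ofReal_le_ofReal ?_
            have hs : Real.sqrt (mean p fun x => v x / u) ≤ 1 := Real.sqrt_le_one.2 hmean1
            set N : ℝ := ((n + 2 : ℕ) : ℝ) with hN
            have hN1 : 1 ≤ N := by rw [hN]; push_cast; linarith [Nat.cast_nonneg (α := ℝ) n]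
            have hN2 : 330 * (u / η) ≤ N := by rw [hN]; push_cast; linarith
            -- The error is at most u(6 + 5)/N = 11u/N, and 330 = 11 · 30 brings it down to η/30.
            have h5 : 5 / N ^ 2 ≤ 5 / N := by
              gcongr
              nlinarith
            have h6 : 6 * Real.sqrt (mean p fun x => v x / u) / N ≤ 6 / N := by
              gcongr; linarith
            calc _ ≤ u * (6 / N + 5 / N) := by gcongr
              _ = 11 * u / N := by ring
              _ ≤ η / 30 := by
                rw [div_le_div_iff₀ (by linarith) (by norm_num)]
                have := mul_le_mul_of_nonneg_left hN2 hη.le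
                rw [show η * (330 * (u / η)) = 330 * u by field_simp] at this
                linarith

/-! ## Mean estimation for functions of bounded variance -/

section Layers

/-- The part of `t⁺` between the consecutive thresholds `0, 1, 2, 4, 8, …`. -/
noncomputable def layer : ℕ → ℝ → ℝ
  | 0, t => min (max t 0) 1
  | j + 1, t => min (max t 0) (2 ^ (j + 1)) - min (max t 0) (2 ^ j)

theorem sum_layer (k : ℕ) (t : ℝ) :
    ∑ j ∈ Finset.range (k + 1), layer j t = min (max t 0) (2 ^ k) := by
  induction k with
  | zero => simp [layer]
  | succ k ih => rw [Finset.sum_range_succ, ih, layer]; ring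

theorem layer_nonneg (j : ℕ) (t : ℝ) : 0 ≤ layer j t := by
  cases j with
  | zero => exact le_min (le_max_right _ _) zero_le_one
  | succ j =>
    rw [layer, sub_nonneg]
    gcongr
    · norm_num
    · omega

theorem layer_le (j : ℕ) (t : ℝ) : layer j t ≤ 2 ^ j := by
  cases j with
  | zero => simp [layer]
  | succ j =>
    have : (0 : ℝ) ≤ min (max t 0) (2 ^ j) := le_min (le_max_right _ _) (by positivity)
    rw [layer]
    linarith [min_le_right (max t 0) ((2 : ℝ) ^ (j + 1))]

/-- A layer with index j ≥ 1 is zero unless t exceeds 2^(j-1), and it is then at most t, so 2^j ·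
layer ≤ 2t · t. The summand 1 covers the bottom layer. -/
theorem two_pow_mul_layer_le (j : ℕ) (t : ℝ) : 2 ^ j * layer j t ≤ 1 + 2 * t ^ 2 := by
  cases j with
  | zero =>
    have := layer_le 0 t
    rw [pow_zero] at this ⊢
    nlinarith [sq_nonneg t]
  | succ j =>
    rw [layer]
    have h2 : (0 : ℝ) < 2 ^ j := by positivity
    rcases le_total (max t 0) (2 ^ j) with h | h
    · rw [min_eq_left h, min_eq_left (h.trans (by gcongr; norm_num; omega)), sub_self, mul_zero]
      positivity
    · rw [min_eq_right h]
      have ht : max t 0 = t := by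
        rw [max_eq_left]
        by_contra hc
        rw [max_eq_right (by linarith)] at h
        linarith
      rw [ht] at h ⊢
      have h3 : min t (2 ^ (j + 1)) ≤ t := min_le_left _ _
      have h4 : 2 ^ (j + 1) * (min t (2 ^ (j + 1)) - 2 ^ j) ≤ 2 ^ (j + 1) * t := by
        gcongr; linarith
      have h5 : (2 : ℝ) ^ (j + 1) * t ≤ 2 * t ^ 2 := by
        rw [pow_succ]; nlinarith
      linarith

/-- Truncation error: it is nonzero only for t > 2^k, where t ≤ t²/2^k. -/
theorem max_sub_min_le (k : ℕ) (t : ℝ) :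
    max t 0 - min (max t 0) (2 ^ k) ≤ t ^ 2 / 2 ^ k := by
  have h2 : (0 : ℝ) < 2 ^ k := by positivity
  rcases le_total (max t 0) (2 ^ k) with h | h
  · rw [min_eq_left h, sub_self]; positivity
  · rw [min_eq_right h, le_div_iff₀ h2]
    rcases le_total t 0 with h0 | h0
    · rw [max_eq_right h0] at h; linarith
    · rw [max_eq_left h0] at *
      nlinarith

variable {Ω J : Type} [Fintype Ω] [DecidableEq Ω] [Fintype J] [DecidableEq J]
  {p : Ω → ℝ} {x₀ : Ω} {j₀ : J} {U : Matrix.unitaryGroup (Ω × J) ℂ}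

/-- Estimate of the mean of `t⁺`, layer by layer. -/
noncomputable def posPartMean (x₀ : Ω) (j₀ : J) (k n : ℕ) (t : Ω → ℝ) : QProg (Ω × J) ℝ :=
  weightedMeans x₀ j₀ n (fun j => 2 ^ j) (fun j x => layer j (t x) / 2 ^ j) (k + 1)

/-- The three terms are the truncation at 2^k, the √a part of the k + 1 amplitude estimates, which
is bounded uniformly in the layer, and their 1/N² part, which sums geometrically. -/
theorem expect_posPartMean_le (h : Encodes p x₀ j₀ U) (hp : ∀ x, 0 ≤ p x) (hp1 : ∑ x, p x = 1)
    (k n : ℕ) (t : Ω → ℝ) {s : ℝ} (hs : mean p (fun x => t x ^ 2) = s) :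
    expect ((posPartMean x₀ j₀ k n t).law U)
        (fun r => ENNReal.ofReal |r - mean p fun x => max (t x) 0|) ≤
      ENNReal.ofReal (s / 2 ^ k + (k + 1) * (6 * (1 + s) / (n + 2 : ℕ)) +
        10 * 2 ^ k / (n + 2 : ℕ) ^ 2) := by
  have hs0 : 0 ≤ s := hs ▸ mean_nonneg hp fun x => sq_nonneg _
  set μ : ℕ → ℝ := fun j => mean p fun x => layer j (t x) / 2 ^ j with hμ
  have hsum : ∑ j ∈ Finset.range (k + 1), 2 ^ j * μ j =
      mean p fun x => min (max (t x) 0) (2 ^ k) := by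
    simp_rw [hμ, ← mean_const_mul, ← sum_layer, mean, Finset.mul_sum]
    rw [Finset.sum_comm]
    refine Finset.sum_congr rfl fun x _ => Finset.sum_congr rfl fun j _ => ?_
    field_simp
  have htail : |mean p (fun x => min (max (t x) 0) (2 ^ k)) - mean p fun x => max (t x) 0| ≤
      s / 2 ^ k := by
    rw [abs_sub_comm, ← mean_sub, abs_of_nonneg (mean_nonneg hp fun x => by
      rw [sub_nonneg]; exact min_le_left _ _), ← hs, div_eq_inv_mul, ← mean_const_mul]
    refine mean_mono hp fun x => (max_sub_min_le k (t x)).trans_eq (div_eq_inv_mul _ _)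
  -- The point of the dyadic cut: 4^j μ_j ≤ 1 + 2s ≤ (1 + s)², so small means compensate for large
  -- weights.
  have hsqrt : ∀ j, 2 ^ j * Real.sqrt (μ j) ≤ 1 + s := by
    intro j
    have h1 : (2 : ℝ) ^ j * Real.sqrt (μ j) = Real.sqrt ((2 ^ j) ^ 2 * μ j) := by
      rw [Real.sqrt_mul (by positivity), Real.sqrt_sq (by positivity)]
    rw [h1, Real.sqrt_le_left (by linarith)]
    have h2 : (2 ^ j) ^ 2 * μ j ≤ 1 + 2 * s := by
      rw [hμ, ← hs, ← mean_const_mul, ← mean_const_mul, ← mean_const hp1 1, ← mean_add]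
      refine mean_mono hp fun x => ?_
      have := two_pow_mul_layer_le j (t x)
      calc ((2 : ℝ) ^ j) ^ 2 * (layer j (t x) / 2 ^ j) = 2 ^ j * layer j (t x) := by
            field_simp
        _ ≤ _ := this
    nlinarith
  have hbound : ∑ j ∈ Finset.range (k + 1), (2 : ℝ) ^ j *
      (6 * Real.sqrt (μ j) / (n + 2 : ℕ) + 5 / (n + 2 : ℕ) ^ 2) ≤
      (k + 1) * (6 * (1 + s) / (n + 2 : ℕ)) + 10 * 2 ^ k / (n + 2 : ℕ) ^ 2 := by
    calc _ ≤ ∑ j ∈ Finset.range (k + 1), (6 * (1 + s) / (n + 2 : ℕ) +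
          2 ^ j * (5 / ((n + 2 : ℕ) : ℝ) ^ 2)) := by
          refine Finset.sum_le_sum fun j _ => ?_
          rw [mul_add]
          gcongr
          rw [← mul_div_assoc, mul_left_comm]
          gcongr
          exact hsqrt j
      _ = (k + 1) * (6 * (1 + s) / (n + 2 : ℕ)) + (2 ^ (k + 1) - 1) *
          (5 / ((n + 2 : ℕ) : ℝ) ^ 2) := by
          rw [Finset.sum_add_distrib, ← Finset.sum_mul, geom_sum_eq (by norm_num)]
          simp
          norm_num
      _ ≤ _ := by
          rw [show (10 : ℝ) * 2 ^ k / ((n + 2 : ℕ) : ℝ) ^ 2 =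
            2 ^ (k + 1) * (5 / ((n + 2 : ℕ) : ℝ) ^ 2) by ring]
          gcongr
          linarith
  calc _ ≤ expect ((posPartMean x₀ j₀ k n t).law U) (fun r => ENNReal.ofReal (s / 2 ^ k) +
        ENNReal.ofReal |r - ∑ j ∈ Finset.range (k + 1), 2 ^ j * μ j|) := by
        refine expect_mono _ fun r => ?_
        rw [← ENNReal.ofReal_add (by positivity) (abs_nonneg _), hsum]
        refine ENNReal.ofReal_le_ofReal ?_
        have := abs_sub_le r (mean p fun x => min (max (t x) 0) (2 ^ k))
          (mean p fun x => max (t x) 0)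
        linarith
    _ ≤ ENNReal.ofReal (s / 2 ^ k) + ENNReal.ofReal ((k + 1) * (6 * (1 + s) / (n + 2 : ℕ)) +
        10 * 2 ^ k / (n + 2 : ℕ) ^ 2) := by
        rw [expect_add, expect_const]
        gcongr
        refine le_trans ?_ (ENNReal.ofReal_le_ofReal hbound)
        refine expect_weightedMeans_le h hp hp1 n (fun j => by positivity) (fun j x => ?_)
          (fun j x => ?_) (k + 1)
        · exact div_nonneg (layer_nonneg _ _) (by positivity)
        · exact div_le_one_of_le₀ (layer_le _ _) (by positivity)
    _ = _ := by
        rw [← ENNReal.ofReal_add (by positivity) (by positivity), add_assoc]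

/-- Sample the value of `v` once. -/
def sampleValue (x₀ : Ω) (j₀ : J) (v : Ω → ℝ) : QProg (Ω × J) ℝ :=
  .run Unit [.query] ((x₀, j₀), ()) fun z => .ret (v z.1.1)

theorem expect_sampleValue (h : Encodes p x₀ j₀ U) (hp : ∀ x, 0 ≤ p x) (v : Ω → ℝ) {g : ℝ → ℝ}
    (hg : ∀ x, 0 ≤ g x) :
    expect ((sampleValue x₀ j₀ v).law U) (fun m => ENNReal.ofReal (g m)) =
      ENNReal.ofReal (mean p fun x => g (v x)) := by
  rw [sampleValue, QProg.law_run, expect_bind]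
  simp_rw [QProg.law_ret, expect_pure]
  rw [expect_fintype, ← h.sum_norm_sq_mul hp, ENNReal.ofReal_sum_of_nonneg
    (fun _ _ => mul_nonneg (by positivity) (hg _)), Fintype.sum_prod_type]
  refine Finset.sum_congr rfl fun z _ => ?_
  rw [Fintype.sum_unique, ENNReal.ofReal_mul (by positivity)]
  have h1 : (evalCircuit U [Gate.query (B := Unit)]).1 (z, ()) ((x₀, j₀), ()) =
      U.1 z (x₀, j₀) := by
    simp [evalCircuit, Gate.eval, extend, Matrix.kronecker]
  rw [← h1]
  rfl

/-- Mean estimation with constant success probability: sample a value `m`, then estimate the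
means of the positive and the negative part of `(v - m) / σ`. -/
noncomputable def centeredMean (x₀ : Ω) (j₀ : J) (k n : ℕ) (v : Ω → ℝ) (σ : ℝ) :
    QProg (Ω × J) ℝ :=
  (sampleValue x₀ j₀ v).bind fun m =>
    (posPartMean x₀ j₀ k n fun x => (v x - m) / σ).bind fun a =>
      (posPartMean x₀ j₀ k n fun x => -((v x - m) / σ)).bind fun b => .ret (m + σ * (a - b))

theorem centeredMean_costLE (x₀ : Ω) (j₀ : J) (k n : ℕ) (v : Ω → ℝ) (σ : ℝ) :
    (centeredMean x₀ j₀ k n v σ).CostLE (1 + 4 * ((k + 1) * (n + 2))) := by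
  have h1 : (sampleValue x₀ j₀ v).CostLE 1 := ⟨0, le_refl 1, fun _ => trivial⟩
  have h2 : 1 + 4 * ((k + 1) * (n + 2)) =
      1 + ((k + 1) * (2 * (n + 2)) + ((k + 1) * (2 * (n + 2)) + 0)) := by ring
  rw [h2]
  exact h1.bind fun m => (weightedMeans_costLE _ _ _ _ _ _).bind fun a =>
    (weightedMeans_costLE _ _ _ _ _ _).bind fun b => trivial

/-- The error for a given centre m is affine in the second moment s(m) of (v - m)/σ. Hence it can be
averaged over the sampled m, and only the mean of s enters. -/
theorem expect_centeredMean_le (h : Encodes p x₀ j₀ U) (hp : ∀ x, 0 ≤ p x) (hp1 : ∑ x, p x = 1)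
    (k n : ℕ) (v : Ω → ℝ) {σ : ℝ} (hσ : 0 < σ) (hv : variance p v ≤ σ ^ 2) :
    expect ((centeredMean x₀ j₀ k n v σ).law U) (fun r => ENNReal.ofReal |r - mean p v|) ≤
      ENNReal.ofReal (2 * σ * (2 / 2 ^ k + (k + 1) * (18 / (n + 2 : ℕ)) +
        10 * 2 ^ k / (n + 2 : ℕ) ^ 2)) := by
  set s : ℝ → ℝ := fun m => mean p fun x => ((v x - m) / σ) ^ 2 with hs
  set e : ℝ → ℝ := fun m => s m / 2 ^ k + (k + 1) * (6 * (1 + s m) / (n + 2 : ℕ)) +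
        10 * 2 ^ k / (n + 2 : ℕ) ^ 2 with he
  have hs0 : ∀ m, 0 ≤ s m := fun m => mean_nonneg hp fun x => sq_nonneg _
  have he0 : ∀ m, 0 ≤ e m := fun m => by have := hs0 m; rw [he]; positivity
  have hstep : ∀ m, expect (((posPartMean x₀ j₀ k n fun x => (v x - m) / σ).bind fun a =>
      (posPartMean x₀ j₀ k n fun x => -((v x - m) / σ)).bind fun b =>
        .ret (m + σ * (a - b))).law U) (fun r => ENNReal.ofReal |r - mean p v|) ≤
      ENNReal.ofReal (2 * σ * e m) := by
    intro m
    set t : Ω → ℝ := fun x => (v x - m) / σ with ht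
    set a₀ := mean p fun x => max (t x) 0 with ha₀
    set b₀ := mean p fun x => max (-(t x)) 0 with hb₀
    have hmean : mean p v = m + σ * (a₀ - b₀) := by
      rw [ha₀, hb₀, ← mean_sub]
      have : ∀ x, max (t x) 0 - max (-(t x)) 0 = t x := fun x => by
        rcases le_total (t x) 0 with h | h
        · rw [max_eq_right h, max_eq_left (by linarith)]; ring
        · rw [max_eq_left h, max_eq_right (by linarith)]; ring
      simp_rw [this]
      rw [← mean_const_mul]
      have h2 : (fun x => σ * t x) = fun x => v x - m := by
        ext x; rw [ht]; field_simp
      rw [h2, mean_sub, mean_const hp1]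
      ring
    have hA := expect_posPartMean_le h hp hp1 k n t (s := s m) rfl
    have hB := expect_posPartMean_le h hp hp1 k n (fun x => -(t x)) (s := s m)
      (by simp_rw [neg_sq]; rfl)
    simp_rw [QProg.law_bind, expect_bind, QProg.law_ret, expect_pure]
    calc _ ≤ expect ((posPartMean x₀ j₀ k n t).law U) (fun a =>
            expect ((posPartMean x₀ j₀ k n fun x => -(t x)).law U) fun b =>
              ENNReal.ofReal σ * ENNReal.ofReal |a - a₀| +
                ENNReal.ofReal σ * ENNReal.ofReal |b - b₀|) := by
          refine expect_mono _ fun a => expect_mono _ fun b => ?_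
          rw [← mul_add, ← ENNReal.ofReal_add (abs_nonneg _) (abs_nonneg _),
            ← ENNReal.ofReal_mul hσ.le]
          refine ENNReal.ofReal_le_ofReal ?_
          rw [hmean, show m + σ * (a - b) - (m + σ * (a₀ - b₀)) =
            σ * ((a - a₀) - (b - b₀)) by ring, abs_mul, abs_of_pos hσ]
          gcongr
          exact abs_sub _ _
      _ = ENNReal.ofReal σ * expect ((posPartMean x₀ j₀ k n t).law U)
            (fun a => ENNReal.ofReal |a - a₀|) +
          ENNReal.ofReal σ * expect ((posPartMean x₀ j₀ k n fun x => -(t x)).law U)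
            (fun b => ENNReal.ofReal |b - b₀|) := by
          simp_rw [expect_add, expect_const, expect_const_mul]
      _ ≤ ENNReal.ofReal σ * ENNReal.ofReal (e m) + ENNReal.ofReal σ * ENNReal.ofReal (e m) := by
          gcongr
      _ = _ := by
          rw [← ENNReal.ofReal_mul hσ.le, ← ENNReal.ofReal_add
            (mul_nonneg hσ.le (he0 m)) (mul_nonneg hσ.le (he0 m))]
          congr 1; ring
  -- Two independent samples of v differ by 2 Var in mean square.
  have hS : mean p (fun x => s (v x)) ≤ 2 := by
    have h1 : ∀ m, s m = (σ ^ 2)⁻¹ * (variance p v + (mean p v - m) ^ 2) := fun m => by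
      rw [← mean_sq_sub hp1, ← mean_const_mul, hs]
      simp_rw [div_pow, div_eq_inv_mul]
    simp_rw [h1]
    rw [mean_const_mul, mean_add, mean_const hp1]
    have h2 : mean p (fun x => (mean p v - v x) ^ 2) = variance p v := by
      rw [variance, mean]
      exact Finset.sum_congr rfl fun x _ => by ring
    rw [h2, inv_mul_le_iff₀ (by positivity)]
    linarith
  rw [centeredMean, QProg.law_bind, expect_bind]
  calc _ ≤ expect ((sampleValue x₀ j₀ v).law U) (fun m => ENNReal.ofReal (2 * σ * e m)) :=
        expect_mono _ hstep
    _ = ENNReal.ofReal (mean p fun x => 2 * σ * e (v x)) :=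
        expect_sampleValue h hp v fun m => mul_nonneg (by positivity) (he0 m)
    _ ≤ _ := by
        refine ENNReal.ofReal_le_ofReal ?_
        have h1 : ∀ m, e m = ((2 ^ k)⁻¹ + (k + 1) * (6 / (n + 2 : ℕ))) * s m +
            ((k + 1) * (6 / (n + 2 : ℕ)) + 10 * 2 ^ k / (n + 2 : ℕ) ^ 2) := fun m => by
          rw [he]; ring
        simp_rw [h1]
        rw [mean_const_mul, mean_add, mean_const_mul, mean_const hp1]
        refine mul_le_mul_of_nonneg_left ?_ (by positivity)
        have h2 := mul_le_mul_of_nonneg_left hS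
          (show (0 : ℝ) ≤ ((2 ^ k)⁻¹ + (k + 1) * (6 / (n + 2 : ℕ))) by positivity)
        refine (add_le_add_left h2 _).trans_eq ?_
        ring

end Layers

/-- Number of layers for relative precision `ρ = σ / η`. -/
noncomputable def layerCount (ρ : ℝ) : ℕ := ⌈Real.logb 2 (360 * ρ)⌉₊

/-- Size of the counter for relative precision `ρ = σ / η`. -/
noncomputable def counterSize (ρ : ℝ) : ℕ := ⌈3240 * (layerCount ρ + 1) * ρ⌉₊

/-- Mean estimation for functions with standard deviation at most `σ`. -/
noncomputable def qEst2 : MeanEstimator := fun _ _ _ _ _ _ x₀ j₀ v σ η δ =>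
  (centeredMean x₀ j₀ (layerCount (σ / η)) (counterSize (σ / η)) v σ).boost η δ

/-- The assumption 1/4 < ρ is the requirement η < 4σ; it makes the logarithm positive, so that the
natural ceiling does not truncate. -/
theorem layerCount_spec {ρ : ℝ} (hρ : 1 / 4 < ρ) :
    360 * ρ ≤ 2 ^ layerCount ρ ∧ (2 : ℝ) ^ layerCount ρ ≤ 720 * ρ ∧
      (layerCount ρ : ℝ) + 1 ≤ 15 * logp ρ := by
  have hpos : 0 < 360 * ρ := by linarith
  have h0 : 0 ≤ Real.logb 2 (360 * ρ) := Real.logb_nonneg (by norm_num) (by linarith)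
  have h1 : Real.logb 2 (360 * ρ) ≤ layerCount ρ := Nat.le_ceil _
  have h2 : (layerCount ρ : ℝ) < Real.logb 2 (360 * ρ) + 1 := Nat.ceil_lt_add_one h0
  refine ⟨?_, ?_, ?_⟩
  · rwa [Real.logb_le_iff_le_rpow (by norm_num) hpos, Real.rpow_natCast] at h1
  · have h3 : (layerCount ρ : ℝ) - 1 ≤ Real.logb 2 (360 * ρ) := by linarith
    rw [Real.le_logb_iff_rpow_le (by norm_num) hpos, Real.rpow_sub (by norm_num),
      Real.rpow_natCast, Real.rpow_one] at h3
    linarith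
  · have h4 : Real.logb 2 (360 * ρ) ≤ 13 * logp ρ := by
      rw [Real.logb, div_le_iff₀ (Real.log_pos (by norm_num)), Real.log_mul (by norm_num)
        (by linarith)]
      have h5 : Real.log ρ ≤ logp ρ := le_max_right _ _
      have h6 : Real.log 360 ≤ 9 * Real.log 2 := by
        have : Real.log 360 ≤ Real.log (2 ^ 9) := Real.log_le_log (by norm_num) (by norm_num)
        rwa [Real.log_pow] at this
      have h7 := Real.log_two_gt_d9
      nlinarith [one_le_logp ρ]
    linarith [one_le_logp ρ]

theorem isQEst2_qEst2 : IsQEst2 20000000 qEst2 := by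
  intro Ω J _ _ _ _ x₀ j₀ v σ η δ U hσ hη hση hδ0 hδ1
  set ρ := σ / η with hρ
  have hρ4 : 1 / 4 < ρ := by rw [hρ, lt_div_iff₀ hη]; linarith
  have hq : qEst2 Ω J x₀ j₀ v σ η δ =
    (centeredMean x₀ j₀ (layerCount ρ) (counterSize ρ) v σ).boost η δ := rfl
  obtain ⟨hk1, hk2, hk3⟩ := layerCount_spec hρ4
  set k := layerCount ρ with hk
  set n := counterSize ρ with hn
  have hn1 : 3240 * (k + 1) * ρ ≤ n := Nat.le_ceil _
  have hn2 : (n : ℝ) < 3240 * (k + 1) * ρ + 1 := Nat.ceil_lt_add_one (by positivity)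
  rw [hq]
  constructor
  · intro w hw
    have h1 := ((centeredMean_costLE x₀ j₀ k n v σ).boost η δ).exec_le U hw
    have h2 : (w.2 : ℝ) ≤ repetitions δ * (1 + 4 * ((k + 1) * (n + 2))) := by exact_mod_cast h1
    have h3 := repetitions_le hδ0 hδ1
    set l := logp ρ with hl
    have hl1 : 1 ≤ l := one_le_logp ρ
    have h4 : (n : ℝ) + 2 ≤ 50000 * ρ * l := by
      have := mul_le_mul_of_nonneg_right hk3 (by linarith : 0 ≤ ρ)
      nlinarith
    have h5 : (1 : ℝ) + 4 * ((k + 1) * (n + 2)) ≤ 5000000 * (ρ * l ^ 2) := by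
      have h6 : ((k : ℝ) + 1) * (n + 2) ≤ (15 * l) * (50000 * ρ * l) := by gcongr
      have h7 : 1 / 4 ≤ ρ * l ^ 2 := by nlinarith
      nlinarith
    calc (w.2 : ℝ) ≤ repetitions δ * (1 + 4 * ((k + 1) * (n + 2))) := h2
      _ ≤ (4 * logp (1 / δ)) * (5000000 * (ρ * l ^ 2)) := by
        have := one_le_logp (1 / δ)
        gcongr
      _ = _ := by ring
  · intro p hp hp1 henc hv
    refine QProg.lt_prob_boost U _ hδ0 hδ1 (fifteen_mul_prob_le_one _ _ hη ?_)
    refine (expect_centeredMean_le henc hp hp1 k n v hσ hv).trans (ENNReal.ofReal_le_ofReal ?_)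
    set N : ℝ := ((n + 2 : ℕ) : ℝ) with hN
    have hN2 : 3240 * (k + 1) * ρ ≤ N := by rw [hN]; push_cast; linarith
    have hρ0 : 0 < ρ := by linarith
    have hN0 : 0 < N := by rw [hN]; positivity
    have hkk : (0 : ℝ) ≤ k := Nat.cast_nonneg k
    -- The three error sources are allotted η/90 each, that is 1/(180ρ) before multiplication by 2σ.
    -- This fixes 360 = 2 · 180 in `layerCount` and 3240 = 18 · 180 in `counterSize`.
    have b1 : 2 / (2 : ℝ) ^ k ≤ 1 / (180 * ρ) := by
      rw [div_le_div_iff₀ (by positivity) (by positivity)]; linarith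
    have b2 : ((k : ℝ) + 1) * (18 / N) ≤ 1 / (180 * ρ) := by
      rw [← mul_div_assoc, div_le_div_iff₀ (by positivity) (by positivity)]; linarith
    have b3 : 10 * (2 : ℝ) ^ k / N ^ 2 ≤ 1 / (180 * ρ) := by
      rw [div_le_div_iff₀ (by positivity) (by positivity)]
      have : 3240 * ρ ≤ N := by nlinarith
      nlinarith
    have hση' : σ = ρ * η := by rw [hρ]; field_simp
    calc 2 * σ * (2 / 2 ^ k + (k + 1) * (18 / N) + 10 * 2 ^ k / N ^ 2)
        ≤ 2 * σ * (1 / (180 * ρ) + 1 / (180 * ρ) + 1 / (180 * ρ)) := by gcongr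
      _ = η / 30 := by rw [hση']; field_simp; norm_num

end QuantumMDP

namespace QuantumMDP

/-! ## Means and variances -/

section Variance

variable {Ω : Type} [Fintype Ω] {p : Ω → ℝ}

theorem variance_nonneg (hp : ∀ x, 0 ≤ p x) (v : Ω → ℝ) : 0 ≤ variance p v :=
  Finset.sum_nonneg fun x _ => mul_nonneg (hp x) (sq_nonneg _)

theorem mean_sq (hp1 : ∑ x, p x = 1) (v : Ω → ℝ) :
    mean p (fun x => v x ^ 2) = variance p v + mean p v ^ 2 := by
  simpa using mean_sq_sub hp1 v 0

theorem sq_mean_mul_le (hp : ∀ x, 0 ≤ p x) (f g : Ω → ℝ) :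
    mean p (fun x => f x * g x) ^ 2 ≤ mean p (fun x => f x ^ 2) * mean p fun x => g x ^ 2 := by
  have h := Finset.sum_mul_sq_le_sq_mul_sq Finset.univ (fun x => Real.sqrt (p x) * f x)
    fun x => Real.sqrt (p x) * g x
  have e : ∀ f g : Ω → ℝ, ∑ x, (Real.sqrt (p x) * f x) * (Real.sqrt (p x) * g x) =
      mean p fun x => f x * g x := fun f g => Finset.sum_congr rfl fun x _ => by
    rw [mul_mul_mul_comm, Real.mul_self_sqrt (hp x)]
  have e2 : ∀ f : Ω → ℝ, ∑ x, (Real.sqrt (p x) * f x) ^ 2 = mean p fun x => f x ^ 2 :=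
    fun f => by simp_rw [sq]; exact e f f
  rwa [e, e2, e2] at h

/-- The standard deviation is the seminorm of the covariance form, and Cauchy–Schwarz bounds the
cross term. -/
theorem sqrt_variance_sub_le (hp : ∀ x, 0 ≤ p x) (v e : Ω → ℝ) :
    Real.sqrt (variance p fun x => v x - e x) ≤
      Real.sqrt (variance p v) + Real.sqrt (variance p e) := by
  have hv := variance_nonneg hp v
  have he := variance_nonneg hp e
  set c := mean p fun x => (v x - mean p v) * (e x - mean p e) with hc
  have h1 : (variance p fun x => v x - e x) = variance p v - 2 * c + variance p e := by
    change mean p (fun x => (v x - e x - mean p fun x => v x - e x) ^ 2) =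
      mean p (fun x => (v x - mean p v) ^ 2) - 2 * c + mean p fun x => (e x - mean p e) ^ 2
    rw [hc, ← mean_const_mul, ← mean_sub, ← mean_add, mean_sub p v e]
    congr 1
    ext x
    ring
  have h2 : c ^ 2 ≤ variance p v * variance p e :=
    sq_mean_mul_le hp (fun x => v x - mean p v) fun x => e x - mean p e
  have h3 : |c| ≤ Real.sqrt (variance p v) * Real.sqrt (variance p e) := by
    rw [← Real.sqrt_mul hv]
    exact Real.abs_le_sqrt h2
  rw [Real.sqrt_le_left (by positivity), h1, add_sq, Real.sq_sqrt hv, Real.sq_sqrt he]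
  linarith [neg_abs_le c]

theorem sqrt_variance_le (hp : ∀ x, 0 ≤ p x) (hp1 : ∑ x, p x = 1) {e : Ω → ℝ} {d : ℝ}
    (hd : 0 ≤ d) (he : ∀ x, |e x| ≤ d) : Real.sqrt (variance p e) ≤ d := by
  rw [Real.sqrt_le_left hd]
  have h1 := mean_sq hp1 e
  have h2 : mean p (fun x => e x ^ 2) ≤ d ^ 2 := by
    rw [← mean_const hp1 (d ^ 2)]
    refine mean_mono hp fun x => ?_
    rw [← sq_abs]
    have := he x
    gcongr
  linarith [sq_nonneg (mean p e)]

end Variance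

/-! ## The optimal value function -/

section Optimal

theorem maxValue_le_iff {S A : Type} [Fintype A] [Nonempty A] (q : S × A → ℝ) (s : S) (c : ℝ) :
    maxValue q s ≤ c ↔ ∀ a, q (s, a) ≤ c := by
  simp [maxValue]

theorem le_maxValue {S A : Type} [Fintype A] [Nonempty A] (q : S × A → ℝ) (s : S) (a : A) : q (s, a) ≤ maxValue q s :=
  (maxValue_le_iff q s _).1 le_rfl a

variable {S A : Type} [Fintype S] {M : MDP S A}

theorem MDP.one_sub_gamma_pos (M : MDP S A) : 0 < 1 - M.γ := sub_pos.2 M.γ_lt_one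

theorem MDP.horizon_mul (M : MDP S A) : (1 - M.γ) * horizon M.γ = 1 :=
  mul_inv_cancel₀ M.one_sub_gamma_pos.ne'

theorem MDP.one_le_horizon (M : MDP S A) : 1 ≤ horizon M.γ :=
  (one_le_inv₀ M.one_sub_gamma_pos).2 (by linarith [M.γ_nonneg])

/-- `v` is the optimal value function and `π` is an optimal policy. -/
structure MDP.IsOptimal (M : MDP S A) (v : S → ℝ) (π : S → A) : Prop where
  le : ∀ s a, M.r s a + M.γ * mean (M.p s a) v ≤ v s
  eq : ∀ s, v s = M.r s (π s) + M.γ * mean (M.p s (π s)) v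
  nonneg : ∀ s, 0 ≤ v s
  le_horizon : ∀ s, v s ≤ horizon M.γ

/-- The total variance bound: a supersolution of the policy evaluation equation with the standard
deviation of the next value as the cost. -/
theorem MDP.IsOptimal.exists_supersolution {v : S → ℝ} {π : S → A} (h : M.IsOptimal v π) :
    ∃ g : S → ℝ, (∀ s, 0 ≤ g s) ∧ (∀ s, g s ≤ 3 / 2 * Real.sqrt (horizon M.γ) ^ 3) ∧
      ∀ s, M.γ * mean (M.p s (π s)) g + M.γ * Real.sqrt (variance (M.p s (π s)) v) ≤ g s := by
  have hΓ := M.one_le_horizon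
  set τ := Real.sqrt (horizon M.γ) with hτ
  have hττ : horizon M.γ = τ ^ 2 := (Real.sq_sqrt (by linarith)).symm
  have hτ1 : 1 ≤ τ := Real.one_le_sqrt.2 hΓ
  have hτ0 : 0 < τ := by linarith
  have hmul := M.horizon_mul
  rw [hττ] at hmul
  have hv : ∀ s, v s ≤ τ ^ 2 := fun s => hττ ▸ h.le_horizon s
  have hvsq : ∀ s, v s ^ 2 ≤ τ ^ 4 := fun s => by
    have := pow_le_pow_left₀ (h.nonneg s) (hv s) 2
    calc v s ^ 2 ≤ (τ ^ 2) ^ 2 := this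
      _ = τ ^ 4 := by ring
  -- The witness is 3/2 τ³ - v²/(2τ) with τ = √Γ. By the Bellman equation the discounted mean of v²
  -- exceeds v² by at least γ²V - 2τ², so the quadratic term pays for the variance V. The constant
  -- term yields (1-γ) · 3/2 τ³ = 3/2 τ, which covers the remaining τ + τ/2.
  refine ⟨fun s => 3 / 2 * τ ^ 3 + -(2 * τ)⁻¹ * v s ^ 2, fun s => ?_, fun s => ?_, fun s => ?_⟩
  · have h1 : (2 * τ)⁻¹ * v s ^ 2 ≤ (2 * τ)⁻¹ * τ ^ 4 := by
      have := hvsq s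
      gcongr
    have h2 : (2 * τ)⁻¹ * τ ^ 4 = 1 / 2 * τ ^ 3 := by field_simp
    have h3 : 0 < τ ^ 3 := by positivity
    linarith
  · have : 0 ≤ (2 * τ)⁻¹ * v s ^ 2 := by positivity
    linarith
  · have hp := M.p_nonneg s (π s)
    have hp1 := M.p_sum s (π s)
    rw [mean_add, mean_const hp1, mean_const_mul, mean_sq hp1]
    set V := variance (M.p s (π s)) v with hV
    set m := mean (M.p s (π s)) v with hm
    have hV0 : 0 ≤ V := variance_nonneg hp v
    have heq := h.eq s
    rw [← hm] at heq
    set r := M.r s (π s) with hr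
    have hr0 : 0 ≤ r := M.r_nonneg _ _
    have hr1 : r ≤ 1 := M.r_le_one _ _
    have hγ0 := M.γ_nonneg
    have hγ1 := M.γ_lt_one
    have h1 : M.γ ^ 2 * V + v s ^ 2 - 2 * τ ^ 2 ≤ M.γ * (V + m ^ 2) := by
      have h2 : M.γ * m = v s - r := by linarith
      have h3 : (M.γ * m) ^ 2 = (v s - r) ^ 2 := by rw [h2]
      have h4 : r * v s ≤ 1 * τ ^ 2 := mul_le_mul hr1 (hv s) (h.nonneg s) zero_le_one
      have h5 : M.γ ^ 2 * (V + m ^ 2) ≤ M.γ * (V + m ^ 2) := by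
        have : 0 ≤ V + m ^ 2 := by positivity
        gcongr
        nlinarith
      nlinarith [sq_nonneg r]
    -- Arithmetic–geometric mean with weight τ, the typical size of γ√V.
    have h2 : M.γ * Real.sqrt V ≤ (2 * τ)⁻¹ * (M.γ ^ 2 * V + τ ^ 2) := by
      rw [inv_mul_eq_div, le_div_iff₀ (by positivity)]
      nlinarith [Real.sq_sqrt hV0, sq_nonneg (M.γ * Real.sqrt V - τ)]
    have h3 : (2 * τ)⁻¹ * (M.γ ^ 2 * V + v s ^ 2 - 2 * τ ^ 2) ≤
        (2 * τ)⁻¹ * (M.γ * (V + m ^ 2)) := by gcongr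
    have h4 : 3 / 2 * τ ^ 3 - M.γ * (3 / 2 * τ ^ 3) = 3 / 2 * τ := by
      linear_combination (3 / 2 * τ) * hmul
    have h5 : (2 * τ)⁻¹ * τ ^ 2 = τ / 2 := by field_simp
    linarith

variable [Fintype A] [Nonempty A]

/-- The Bellman optimality operator. -/
noncomputable def MDP.bellman (M : MDP S A) (v : S → ℝ) (s : S) : ℝ :=
  maxValue (fun sa : S × A => M.r sa.1 sa.2 + M.γ * mean (M.p sa.1 sa.2) v) s

theorem MDP.bellman_contracting (M : MDP S A) :
    ContractingWith ⟨M.γ, M.γ_nonneg⟩ M.bellman := by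
  refine ⟨M.γ_lt_one, LipschitzWith.of_dist_le_mul fun v w => ?_⟩
  have key : ∀ v w : S → ℝ, ∀ s, M.bellman v s ≤ M.bellman w s + M.γ * dist v w := by
    intro v w s
    rw [MDP.bellman, maxValue_le_iff]
    intro a
    have h1 : mean (M.p s a) v ≤ mean (M.p s a) w + dist v w := by
      rw [← mean_const (M.p_sum s a) (dist v w), ← mean_add]
      refine mean_mono (M.p_nonneg s a) fun x => ?_
      have := (le_abs_self (v x - w x)).trans (dist_le_pi_dist v w x)
      linarith
    have h2 := le_maxValue (fun sa : S × A => M.r sa.1 sa.2 + M.γ * mean (M.p sa.1 sa.2) w) s a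
    have h3 := mul_le_mul_of_nonneg_left h1 M.γ_nonneg
    rw [MDP.bellman]
    simp only at h2 ⊢
    linarith
  change dist (M.bellman v) (M.bellman w) ≤ M.γ * dist v w
  rw [dist_pi_le_iff (mul_nonneg M.γ_nonneg dist_nonneg)]
  intro s
  rw [Real.dist_eq, abs_le]
  have h1 := key v w s
  have h2 := key w v s
  rw [dist_comm] at h2
  constructor <;> linarith

/-- The value function is the Banach fixed point of the Bellman operator. Its bounds 0 and Γ come
from the fixed point equation at a minimising and at a maximising state. -/
theorem MDP.exists_isOptimal [Nonempty S] (M : MDP S A) : ∃ v π, M.IsOptimal v π := by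
  set v := ContractingWith.fixedPoint M.bellman M.bellman_contracting with hv
  have hfix : M.bellman v = v := ContractingWith.fixedPoint_isFixedPt M.bellman_contracting
  set q : S × A → ℝ := fun sa => M.r sa.1 sa.2 + M.γ * mean (M.p sa.1 sa.2) v with hq
  have hle : ∀ s a, q (s, a) ≤ v s := fun s a => by
    rw [← hfix]; exact le_maxValue q s a
  have hgreedy : ∀ s a, q (s, a) ≤ q (s, greedy q s) := fun s =>
    (Finite.exists_max fun a : A => q (s, a)).choose_spec
  have heq : ∀ s, v s = q (s, greedy q s) := fun s => by
    refine le_antisymm ?_ (hle _ _)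
    rw [← hfix]
    exact (maxValue_le_iff q s _).2 (hgreedy s)
  refine ⟨v, greedy q, hle, heq, ?_, ?_⟩
  · obtain ⟨s₁, hs₁⟩ := Finite.exists_min v
    have h1 : v s₁ ≤ mean (M.p s₁ (greedy q s₁)) v := by
      rw [← mean_const (M.p_sum s₁ (greedy q s₁)) (v s₁)]
      exact mean_mono (M.p_nonneg _ _) hs₁
    have h2 := heq s₁
    simp only [hq] at h2
    have h3 := M.r_nonneg s₁ (greedy q s₁)
    have h4 := mul_le_mul_of_nonneg_left h1 M.γ_nonneg
    have h5 : 0 ≤ (1 - M.γ) * v s₁ := by linarith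
    exact fun s => (nonneg_of_mul_nonneg_right h5 M.one_sub_gamma_pos).trans (hs₁ s)
  · obtain ⟨s₁, hs₁⟩ := Finite.exists_max v
    have h1 : mean (M.p s₁ (greedy q s₁)) v ≤ v s₁ := by
      rw [← mean_const (M.p_sum s₁ (greedy q s₁)) (v s₁)]
      exact mean_mono (M.p_nonneg _ _) hs₁
    have h2 := heq s₁
    simp only [hq] at h2
    have h3 := M.r_le_one s₁ (greedy q s₁)
    have h4 := mul_le_mul_of_nonneg_left h1 M.γ_nonneg
    have h5 : v s₁ * (1 - M.γ) ≤ 1 := by linarith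
    intro s
    refine (hs₁ s).trans ?_
    rw [horizon, ← one_div, le_div_iff₀ M.one_sub_gamma_pos]
    exact h5

end Optimal

/-! ## Accuracy of one epoch -/

section Accuracy

/-- The second moment contributes an error 1, the squared mean at most d² + 2Γd ≤ 3 because d = 1/Γ.
Truncation at 0 does no harm since the true variance is nonnegative. -/
theorem abs_variance_estimate {Γ d m₁ m₂ a₁ a₂ y : ℝ} (hd1 : d ≤ 1)
    (hdΓ : d * Γ = 1) (ha0 : 0 ≤ a₁) (haΓ : a₁ ≤ Γ) (h₂ : |m₂ - a₂| < 1) (h₁ : |m₁ - a₁| < d)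
    (hvar : 0 ≤ a₂ - a₁ ^ 2) (hy : y = max (m₂ - m₁ ^ 2) 0) :
    a₂ - a₁ ^ 2 ≤ y + 4 ∧ y ≤ a₂ - a₁ ^ 2 + 4 := by
  rw [abs_lt] at h₁ h₂
  have h3 : |m₁ ^ 2 - a₁ ^ 2| ≤ 3 := by
    have e : m₁ ^ 2 - a₁ ^ 2 = (m₁ - a₁) * (m₁ - a₁) + 2 * a₁ * (m₁ - a₁) := by ring
    have h4 : |m₁ - a₁| ≤ d := abs_le.2 ⟨by linarith, by linarith⟩
    rw [e]
    refine (abs_add_le _ _).trans ?_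
    rw [abs_mul, abs_mul, abs_of_nonneg (show 0 ≤ 2 * a₁ by linarith)]
    have h5 : |m₁ - a₁| * |m₁ - a₁| ≤ 1 * 1 := by gcongr <;> linarith
    have h6 : 2 * a₁ * |m₁ - a₁| ≤ 2 * Γ * d := by gcongr; linarith
    linarith
  rw [abs_le] at h3
  have h4 : y ≤ max (a₂ - a₁ ^ 2 + 4) 0 := by
    rw [hy]; gcongr; linarith
  have h5 := le_max_left (m₂ - m₁ ^ 2) 0
  rw [max_eq_left (by linarith)] at h4
  exact ⟨by rw [hy]; linarith, h4⟩

variable {S A : Type} [Fintype S] {M : MDP S A}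

/-- The cumulative effect of the estimation errors in an epoch with target accuracy `e` is less
than `e / 2`. -/
theorem MDP.IsOptimal.exists_epoch_supersolution {v : S → ℝ} {π : S → A} (h : M.IsOptimal v π)
    {ε e : ℝ} (hε : 0 < ε) (hεΓ : ε ≤ Real.sqrt (horizon M.γ)) (hεe : ε ≤ 2 * e)
    {v₀ : S → ℝ} (hv₀ : ∀ s, v₀ s ≤ v s) (hv₀e : ∀ s, v s - v₀ s ≤ 2 * e) {y : S × A → ℝ}
    (hy : ∀ s a, y (s, a) ≤ variance (M.p s a) v₀ + 4) :
    ∃ g : S → ℝ, (∀ s, 0 ≤ g s) ∧ (∀ s, g s ≤ e / 2) ∧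
      ∀ s, M.γ * mean (M.p s (π s)) g + M.γ * (2 * (1 / 100 * (1 - M.γ) ^ (3 / 2 : ℝ) * ε *
        Real.sqrt (y (s, π s) + 1)) + 2 * (1 / 100 * (1 - M.γ) * e)) ≤ g s := by
  obtain ⟨g₁, hg0, hg1, hg⟩ := h.exists_supersolution
  have hΓ := M.one_le_horizon
  have hmul := M.horizon_mul
  have hd := M.one_sub_gamma_pos
  have hγ0 := M.γ_nonneg
  have he : 0 < e := by linarith
  set Γ := horizon M.γ with hΓdef
  set τ := Real.sqrt Γ with hτ
  have hττ : Γ = τ ^ 2 := (Real.sq_sqrt (by linarith)).symm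
  have hτ1 : 1 ≤ τ := Real.one_le_sqrt.2 hΓ
  have hκ : (1 - M.γ) ^ (3 / 2 : ℝ) * τ ^ 3 = 1 := by
    have h1 : τ ^ 3 = Γ ^ (3 / 2 : ℝ) := by
      rw [hτ, Real.sqrt_eq_rpow, ← Real.rpow_natCast, ← Real.rpow_mul (by linarith)]
      norm_num
    rw [h1, ← Real.mul_rpow hd.le (by linarith), hmul, Real.one_rpow]
  set κ := (1 - M.γ) ^ (3 / 2 : ℝ) with hκdef
  have hκ0 : 0 < κ := Real.rpow_pos_of_pos hd _
  have h5 : Real.sqrt 5 ≤ 9 / 4 := by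
    rw [Real.sqrt_le_left (by norm_num)]; norm_num
  have h50 := Real.sqrt_nonneg 5
  -- A shifted estimate is off by up to twice its error, hence 1/50 = 2/100. The term in `g₁`
  -- handles the standard deviation of the optimal value; the constants handle the excess √5 + 2e of
  -- √(y+1) over it and the error of the difference estimates. The sum is at most (3 + 13/2 + 1)e/50
  -- < e/2.
  refine ⟨fun s => (1 / 50 * κ * ε) * g₁ s + (1 / 50 * κ * ε * (Real.sqrt 5 + 2 * e) * Γ +
    1 / 50 * e), fun s => ?_, fun s => ?_, fun s => ?_⟩
  · have := hg0 s
    positivity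
  · have h1 : κ * ε * g₁ s ≤ 3 * e := by
      calc κ * ε * g₁ s ≤ κ * ε * (3 / 2 * τ ^ 3) := by
            have := hg1 s
            gcongr
        _ = 3 / 2 * ε * (κ * τ ^ 3) := by ring
        _ ≤ 3 * e := by rw [hκ]; linarith
    have hκΓ : κ * Γ * τ = 1 := by rw [hττ, ← hκ]; ring
    -- This is where ε ≤ √Γ is used: it makes the contribution of the 2e in √5 + 2e linear in e.
    have h2 : κ * Γ * ε ≤ 1 := by
      rw [← hκΓ]
      gcongr
    have h3 : κ * Γ * ε ≤ 2 * e := by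
      have : κ * Γ ≤ 1 := by
        rw [← hκΓ]
        exact le_mul_of_one_le_right (by positivity) hτ1
      calc κ * Γ * ε ≤ 1 * ε := by gcongr
        _ ≤ 2 * e := by linarith
    have h4 : κ * ε * (Real.sqrt 5 + 2 * e) * Γ ≤ 9 / 2 * e + 2 * e := by
      have e1 : κ * ε * (Real.sqrt 5 + 2 * e) * Γ =
          Real.sqrt 5 * (κ * Γ * ε) + 2 * e * (κ * Γ * ε) := by ring
      rw [e1]
      have : Real.sqrt 5 * (κ * Γ * ε) ≤ 9 / 4 * (2 * e) := by gcongr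
      have : 2 * e * (κ * Γ * ε) ≤ 2 * e * 1 := by gcongr
      linarith
    linarith
  · have hp := M.p_nonneg s (π s)
    have hp1 := M.p_sum s (π s)
    rw [mean_add, mean_const hp1, mean_const_mul]
    have h1 : Real.sqrt (y (s, π s) + 1) ≤
        Real.sqrt (variance (M.p s (π s)) v) + (Real.sqrt 5 + 2 * e) := by
      have h2 : Real.sqrt (variance (M.p s (π s)) v₀) ≤
          Real.sqrt (variance (M.p s (π s)) v) + 2 * e := by
        have h3 := sqrt_variance_sub_le hp v fun s => v s - v₀ s
        have h4 := sqrt_variance_le hp hp1 (d := 2 * e) (by linarith) (e := fun s => v s - v₀ s)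
          fun x => abs_le.2 ⟨by linarith [hv₀ x], hv₀e x⟩
        simp only [sub_sub_cancel] at h3
        linarith
      have h3 : Real.sqrt (variance (M.p s (π s)) v₀ + 5) ≤
          Real.sqrt (variance (M.p s (π s)) v₀) + Real.sqrt 5 := by
        have hV := variance_nonneg hp v₀
        rw [Real.sqrt_le_left (by positivity), add_sq, Real.sq_sqrt hV,
          Real.sq_sqrt (by norm_num)]
        have := Real.sqrt_nonneg (variance (M.p s (π s)) v₀)
        nlinarith
      have h4 : Real.sqrt (y (s, π s) + 1) ≤ Real.sqrt (variance (M.p s (π s)) v₀ + 5) :=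
        Real.sqrt_le_sqrt (by linarith [hy s (π s)])
      linarith
    have h2 := hg s
    set w := Real.sqrt (variance (M.p s (π s)) v) with hw
    have h3 : κ * ε * (M.γ * Real.sqrt (y (s, π s) + 1)) ≤
        κ * ε * (g₁ s - M.γ * mean (M.p s (π s)) g₁ + (Real.sqrt 5 + 2 * e)) := by
      have h4 : M.γ * Real.sqrt (y (s, π s) + 1) ≤ M.γ * (w + (Real.sqrt 5 + 2 * e)) := by gcongr
      have h6 : M.γ * (Real.sqrt 5 + 2 * e) ≤ 1 * (Real.sqrt 5 + 2 * e) := by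
        gcongr
        linarith
      gcongr
      linarith
    have h4 : κ * ε * (Real.sqrt 5 + 2 * e) * Γ - M.γ * (κ * ε * (Real.sqrt 5 + 2 * e) * Γ) =
        κ * ε * (Real.sqrt 5 + 2 * e) := by
      linear_combination (κ * ε * (Real.sqrt 5 + 2 * e)) * hmul
    have h6 : M.γ * ((1 - M.γ) * e) ≤ 1 * ((1 - M.γ) * e) := by
      gcongr
      linarith
    linarith

/-- From γ ≤ exp(-(1-γ)) and L - 1 ≥ Γ ln 4; the rest of ln(4Γ/ε) is not needed here. -/
theorem pow_iterations_le (M : MDP S A) {ε : ℝ} (hε : 0 < ε)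
    (hεΓ : ε ≤ horizon M.γ) : M.γ ^ (iterations M.γ ε - 1) ≤ 1 / 4 := by
  have hd := M.one_sub_gamma_pos
  have hΓ := M.one_le_horizon
  have hlog4 : Real.log 4 ≤ Real.log (4 * horizon M.γ / ε) := by
    apply Real.log_le_log (by norm_num)
    rw [le_div_iff₀ hε]; linarith
  have h1 : horizon M.γ * Real.log 4 ≤ (iterations M.γ ε - 1 : ℕ) := by
    rw [iterations, Nat.add_sub_cancel]
    refine le_trans ?_ (Nat.le_ceil _)
    gcongr
    exact hlog4.trans (Nat.le_ceil _)
  have h2 : M.γ ≤ Real.exp (-(1 - M.γ)) := by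
    have := Real.add_one_le_exp (-(1 - M.γ)); linarith
  calc M.γ ^ (iterations M.γ ε - 1) ≤ Real.exp (-(1 - M.γ)) ^ (iterations M.γ ε - 1) := by
        have := M.γ_nonneg
        gcongr
    _ = Real.exp ((iterations M.γ ε - 1 : ℕ) * -(1 - M.γ)) := (Real.exp_nat_mul _ _).symm
    _ ≤ Real.exp (-Real.log 4) := by
        apply Real.exp_le_exp.2
        have h3 := mul_le_mul_of_nonneg_left h1 hd.le
        rw [← mul_assoc, M.horizon_mul, one_mul] at h3
        linarith
    _ = 1 / 4 := by rw [Real.exp_neg, Real.exp_log (by norm_num)]; norm_num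

/-- Rounding up the number of epochs costs a factor 2 at most, so no target accuracy falls below
ε/2. -/
theorem le_two_mul_horizon_div (M : MDP S A) {ε : ℝ} (hε : 0 < ε) (hεΓ : ε ≤ horizon M.γ)
    {k : ℕ} (hk : k ≤ epochs M.γ ε) : ε ≤ 2 * (horizon M.γ / 2 ^ k) := by
  have hpos : 0 < horizon M.γ / ε := div_pos (by linarith) hε
  have h0 : 0 ≤ Real.logb 2 (horizon M.γ / ε) :=
    Real.logb_nonneg (by norm_num) ((one_le_div hε).2 hεΓ)
  have h1 : (k : ℝ) - 1 ≤ Real.logb 2 (horizon M.γ / ε) := by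
    have h2 : (epochs M.γ ε : ℝ) < Real.logb 2 (horizon M.γ / ε) + 1 := Nat.ceil_lt_add_one h0
    have h3 : (k : ℝ) ≤ epochs M.γ ε := by exact_mod_cast hk
    linarith
  rw [Real.le_logb_iff_rpow_le (by norm_num) hpos, Real.rpow_sub (by norm_num),
    Real.rpow_natCast, Real.rpow_one, le_div_iff₀ hε] at h1
  rw [← mul_div_assoc, le_div_iff₀ (by positivity)]
  linarith

end Accuracy

end QuantumMDP

namespace QuantumMDP

open scoped ENNReal

/-! ## Reasoning about programs with calls -/

section EstPrograms

variable {S A α β ι : Type} [Fintype S]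

/-- As long as all answers are correct, the promises of all calls hold and the result
satisfies `Q`. -/
def EstProg.Safe (M : MDP S A) : EstProg S A α → (α → Prop) → Prop
  | .ret a, Q => Q a
  | .call c next, Q =>
      c.Promise M ∧ ∀ x, |x - c.target M| < c.error → (next x).Safe M Q

theorem EstProg.Safe.bind {M : MDP S A} {P : EstProg S A α} {f : α → EstProg S A β}
    {Q : α → Prop} {R : β → Prop} (hP : P.Safe M Q) (hf : ∀ a, Q a → (f a).Safe M R) :
    (P >>= f).Safe M R := by
  induction P with
  | ret a => exact hf a hP
  | call c next ih => exact ⟨hP.1, fun x hx => ih x (hP.2 x hx)⟩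

theorem EstProg.Safe.mono {M : MDP S A} {P : EstProg S A α} {Q R : α → Prop} (hP : P.Safe M Q)
    (h : ∀ a, Q a → R a) : P.Safe M R := by
  induction P with
  | ret a => exact h a hP
  | call c next ih => exact ⟨hP.1, fun x hx => ih x (hP.2 x hx)⟩

theorem safe_estimate {M : MDP S A} {c : Call S A} (h : c.Promise M) :
    (estimate c).Safe M fun x => |x - c.target M| < c.error := ⟨h, fun _ hx => hx⟩

theorem safe_sweepList [DecidableEq ι] {M : MDP S A} {f : ι → EstProg S A ℝ} {Q : ι → ℝ → Prop}
    (h : ∀ i, (f i).Safe M (Q i)) (l : List ι) :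
    (sweepList f l).Safe M fun g => ∀ i ∈ l, Q i (g i) := by
  induction l with
  | nil => intro i hi; simp at hi
  | cons i l ih =>
    refine (h i).bind fun x hx => ih.bind fun g hg => ?_
    intro j hj
    by_cases hji : j = i
    · subst hji; simpa using hx
    · rw [Function.update_of_ne hji]
      exact hg j (by simpa [hji] using hj)

theorem safe_sweep [Fintype ι] [DecidableEq ι] {M : MDP S A} {f : ι → EstProg S A ℝ}
    {Q : ι → ℝ → Prop} (h : ∀ i, (f i).Safe M (Q i)) :
    (sweep f).Safe M fun g => ∀ i, Q i (g i) :=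
  (safe_sweepList h _).mono fun g hg i => hg i (by simp)

theorem safe_forLoop {M : MDP S A} {body : ℕ → α → EstProg S A α} {I : ℕ → α → Prop} {n : ℕ}
    (h : ∀ k < n, ∀ st, I k st → (body (k + 1) st).Safe M (I (k + 1))) {st : α} (h0 : I 0 st) :
    (forLoop body n st).Safe M (I n) := by
  induction n with
  | zero => exact h0
  | succ n ih => exact (ih fun k hk => h k (by omega)).bind fun st' hst' => h n (by omega) st' hst'

/-- On every path all calls satisfy `ok` and their total weight is at most the given bound. -/
def EstProg.Budget (ok : Call S A → Prop) (w : Call S A → ℝ) : EstProg S A α → ℝ → Prop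
  | .ret _, B => 0 ≤ B
  | .call c next, B => ok c ∧ ∃ B', w c + B' ≤ B ∧ ∀ x, (next x).Budget ok w B'

end EstPrograms

/-! ### Additive accounting along every path of a program. -/

section Budgets

variable {S A α β ι : Type} {ok : Call S A → Prop} {w : Call S A → ℝ}

theorem EstProg.Budget.mono {P : EstProg S A α} {B B' : ℝ} (h : P.Budget ok w B) (hB : B ≤ B') :
    P.Budget ok w B' := by
  cases P with
  | ret a => exact le_trans h hB
  | call c next =>
    obtain ⟨h1, b, h2, h3⟩ := h
    exact ⟨h1, b, h2.trans hB, h3⟩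

/-- The result satisfies `Q` whatever the answers are. -/
def EstProg.Always : EstProg S A α → (α → Prop) → Prop
  | .ret a, Q => Q a
  | .call _ next, Q => ∀ x, (next x).Always Q

theorem EstProg.Always.of_forall (P : EstProg S A α) {Q : α → Prop} (h : ∀ a, Q a) :
    P.Always Q := by
  induction P with
  | ret a => exact h a
  | call c next ih => exact ih

theorem EstProg.Always.bind {P : EstProg S A α} {f : α → EstProg S A β} {Q : α → Prop}
    {R : β → Prop} (hP : P.Always Q) (hf : ∀ a, Q a → (f a).Always R) :
    (P >>= f).Always R := by
  induction P with
  | ret a => exact hf a hP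
  | call c next ih => exact fun x => ih x (hP x)

theorem always_sweepList [DecidableEq ι] {f : ι → EstProg S A ℝ} {Q : ι → ℝ → Prop}
    (h : ∀ i, (f i).Always (Q i)) (l : List ι) :
    (sweepList f l).Always fun g => ∀ i ∈ l, Q i (g i) := by
  induction l with
  | nil => intro i hi; simp at hi
  | cons i l ih =>
    refine (h i).bind fun x hx => ih.bind fun g hg => ?_
    intro j hj
    by_cases hji : j = i
    · subst hji; simpa using hx
    · rw [Function.update_of_ne hji]
      exact hg j (by simpa [hji] using hj)

theorem always_sweep [Fintype ι] [DecidableEq ι] {f : ι → EstProg S A ℝ} {Q : ι → ℝ → Prop}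
    (h : ∀ i, (f i).Always (Q i)) : (sweep f).Always fun g => ∀ i ∈ Finset.univ.toList, Q i (g i) :=
  always_sweepList h _

/-- The costs of later calls may depend on facts that hold even after wrong answers; for the
algorithm this fact is 0 ≤ y. -/
theorem EstProg.Budget.bind_of_always {P : EstProg S A α} {f : α → EstProg S A β} {B₁ B₂ : ℝ}
    {Q : α → Prop} (hP : P.Budget ok w B₁) (hQ : P.Always Q)
    (hf : ∀ a, Q a → (f a).Budget ok w B₂) : (P >>= f).Budget ok w (B₁ + B₂) := by
  induction P generalizing B₁ with
  | ret a => exact (hf a hQ).mono (le_add_of_nonneg_left hP)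
  | call c next ih =>
    obtain ⟨h1, b, h2, h3⟩ := hP
    exact ⟨h1, b + B₂, by linarith, fun x => ih x (h3 x) (hQ x)⟩

theorem EstProg.Budget.bind {P : EstProg S A α} {f : α → EstProg S A β} {B₁ B₂ : ℝ}
    (hP : P.Budget ok w B₁) (hf : ∀ a, (f a).Budget ok w B₂) :
    (P >>= f).Budget ok w (B₁ + B₂) :=
  hP.bind_of_always (Q := fun _ => True) (.of_forall _ fun _ => trivial) fun a _ => hf a

theorem budget_pure (a : α) : (pure a : EstProg S A α).Budget ok w 0 := le_refl (0 : ℝ)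

theorem budget_estimate {c : Call S A} (h : ok c) : (estimate c).Budget ok w (w c) :=
  ⟨h, 0, by simp, fun _ => le_refl (0 : ℝ)⟩

theorem budget_sweepList [DecidableEq ι] {f : ι → EstProg S A ℝ} {B : ℝ}
    (h : ∀ i, (f i).Budget ok w B) (l : List ι) : (sweepList f l).Budget ok w (l.length * B) := by
  induction l with
  | nil => exact (budget_pure _).mono (by simp)
  | cons i l ih =>
    refine ((h i).bind fun x => ih.bind fun g => budget_pure _).mono (le_of_eq ?_)
    rw [List.length_cons]; push_cast; ring

theorem budget_sweep [Fintype ι] [DecidableEq ι] {f : ι → EstProg S A ℝ} {B : ℝ}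
    (h : ∀ i, (f i).Budget ok w B) : (sweep f).Budget ok w (Fintype.card ι * B) :=
  (budget_sweepList h _).mono (by simp)

theorem budget_forLoop {body : ℕ → α → EstProg S A α} {B : ℝ} {n : ℕ}
    (h : ∀ k < n, ∀ st, (body (k + 1) st).Budget ok w B) (st : α) :
    (forLoop body n st).Budget ok w (n * B) := by
  induction n with
  | zero => exact (budget_pure _).mono (by simp)
  | succ n ih =>
    refine ((ih fun k hk => h k (by omega)).bind fun st' => h n (by omega) st').mono
      (le_of_eq ?_)
    push_cast; ring

/-- The failure probability that a call asks for. -/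
def Call.failure : Call S A → ℝ
  | .qEst1 δ _ _ _ _ _ => δ
  | .qEst2 δ _ _ _ _ _ => δ

/-- The conditions under which the query bound of the called subroutine applies. -/
def Call.Valid : Call S A → Prop
  | .qEst1 δ _ _ _ u η => 0 < u ∧ 0 < η ∧ 0 < δ ∧ δ < 1
  | .qEst2 δ _ _ _ σ η => 0 < σ ∧ 0 < η ∧ η < 4 * σ ∧ 0 < δ ∧ δ < 1

/-- The query bound of the called subroutine, with constant `c`. -/
noncomputable def Call.queryBound (c : ℝ) : Call S A → ℝ
  | .qEst1 δ _ _ _ u η => c * (u / η + Real.sqrt (u / η)) * logp (1 / δ)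
  | .qEst2 δ _ _ _ σ η => c * (σ / η * logp (σ / η) ^ 2) * logp (1 / δ)

end Budgets

/-! ## Execution of programs with calls -/

section Implementation

variable {X α β : Type} [Fintype X] [DecidableEq X]

theorem QProg.mem_support_exec_bind {U : Matrix.unitaryGroup X ℂ} {P : QProg X α}
    {f : α → QProg X β} {w : β × ℕ} (hw : w ∈ ((P.bind f).exec U).support) :
    ∃ w₁ ∈ (P.exec U).support, ∃ w₂ ∈ ((f w₁.1).exec U).support,
      w.1 = w₂.1 ∧ w.2 = w₁.2 + w₂.2 := by
  induction P generalizing w with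
  | ret a => exact ⟨(a, 0), by simp [QProg.exec], w, hw, rfl, by simp⟩
  | run B gs z₀ next ih =>
    simp only [QProg.bind, QProg.exec, PMF.mem_support_bind_iff, PMF.support_map,
      Set.mem_image] at hw
    obtain ⟨z, hz, w', hw', rfl⟩ := hw
    obtain ⟨w₁, h₁, w₂, h₂, h3, h4⟩ := ih z hw'
    refine ⟨(w₁.1, circuitCost gs + w₁.2), ?_, w₂, h₂, h3, ?_⟩
    · simp only [QProg.exec, PMF.mem_support_bind_iff, PMF.support_map, Set.mem_image]
      exact ⟨z, hz, w₁, h₁, rfl⟩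
    · simp only [h4]; omega

variable {S A W : Type} [Fintype S] [DecidableEq S] [Fintype A] [DecidableEq A]
  [Fintype W] [DecidableEq W] {M : MDP S A} {s₀ : S} {w₀ : W}
  {O : Matrix.unitaryGroup (S × A × S × W) ℂ} {E₁ E₂ : MeanEstimator} {c : ℝ}

/-- The state and action registers become part of the garbage register; the oracle leaves them at
(s, a), so the garbage vectors are still unit vectors. -/
theorem IsGenerativeModel.encodes (h : IsGenerativeModel M s₀ w₀ O) (s : S) (a : A) :
    Encodes (M.p s a) s₀ (s, a, w₀) (reorderOracle O) := by
  obtain ⟨ψ, hψ, hO⟩ := h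
  refine ⟨fun s' j => if j.1 = s ∧ j.2.1 = a then ψ s' s a j.2.2 else 0, fun s' => ?_,
    fun s' j => ?_⟩
  · rw [Fintype.sum_prod_type, Finset.sum_eq_single s, Fintype.sum_prod_type,
      Finset.sum_eq_single a]
    · simpa using hψ s' s a
    · intro b _ hb; simp [hb]
    · simp
    · intro t _ ht; simp [ht]
    · simp
  · obtain ⟨t, b, w⟩ := j
    have : (reorderOracle O).1 (s', t, b, w) (s₀, s, a, w₀) = O.1 (t, b, s', w) (s, a, s₀, w₀) :=
      rfl
    rw [this, hO]
    simp

theorem Call.queries_le (h₁ : IsQEst1 c E₁) (h₂ : IsQEst2 c E₂)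
    (U : Matrix.unitaryGroup (S × (S × A × W)) ℂ) {e : Call S A} (he : e.Valid) {w : ℝ × ℕ}
    (hw : w ∈ ((e.toQProg E₁ E₂ s₀ w₀).exec U).support) : (w.2 : ℝ) ≤ e.queryBound c := by
  cases e with
  | qEst1 δ s a v u η =>
    obtain ⟨hu, hη, hδ0, hδ1⟩ := he
    exact (h₁ _ _ s₀ (s, a, w₀) v u η δ U hu hη hδ0 hδ1).1 w hw
  | qEst2 δ s a v σ η =>
    obtain ⟨hσ, hη, hση, hδ0, hδ1⟩ := he
    exact (h₂ _ _ s₀ (s, a, w₀) v σ η δ U hσ hη hση hδ0 hδ1).1 w hw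

theorem prob_compl_le_of_lt_prob {μ : PMF α} {s : Set α} {δ : ℝ} (hδ0 : 0 ≤ δ) (hδ1 : δ ≤ 1)
    (h : ENNReal.ofReal (1 - δ) ≤ μ.toOuterMeasure s) :
    μ.toOuterMeasure sᶜ ≤ ENNReal.ofReal δ := by
  have h1 := prob_add_prob_compl μ s
  have h2 : ENNReal.ofReal (1 - δ) + μ.toOuterMeasure sᶜ ≤
      ENNReal.ofReal (1 - δ) + ENNReal.ofReal δ := by
    rw [← ENNReal.ofReal_add (by linarith) hδ0, sub_add_cancel, ENNReal.ofReal_one, ← h1]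
    gcongr
  exact (ENNReal.add_le_add_iff_left ENNReal.ofReal_ne_top).1 h2

theorem Call.prob_incorrect_le (h₁ : IsQEst1 c E₁) (h₂ : IsQEst2 c E₂)
    (hO : IsGenerativeModel M s₀ w₀ O) {e : Call S A} (he : e.Promise M) (hδ0 : 0 < e.failure)
    (hδ1 : e.failure < 1) :
    ((e.toQProg E₁ E₂ s₀ w₀).law (reorderOracle O)).toOuterMeasure
      {x | |x - e.target M| < e.error}ᶜ ≤ ENNReal.ofReal e.failure := by
  refine prob_compl_le_of_lt_prob hδ0.le hδ1.le ?_
  rw [← QProg.prob_exec_fst]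
  cases e with
  | qEst1 δ s a v u η =>
    obtain ⟨hu, hη, hv⟩ := he
    exact ((h₁ _ _ s₀ (s, a, w₀) v u η δ _ hu hη hδ0 hδ1).2 (M.p s a) (M.p_nonneg s a)
      (M.p_sum s a) (hO.encodes s a) hv).le
  | qEst2 δ s a v σ η =>
    obtain ⟨hσ, hη, hση, hv⟩ := he
    exact ((h₂ _ _ s₀ (s, a, w₀) v σ η δ _ hσ hη hση hδ0 hδ1).2 (M.p s a) (M.p_nonneg s a)
      (M.p_sum s a) (hO.encodes s a) hv).le

theorem EstProg.Budget.queries_le (h₁ : IsQEst1 c E₁) (h₂ : IsQEst2 c E₂)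
    (U : Matrix.unitaryGroup (S × (S × A × W)) ℂ) {P : EstProg S A α} {B : ℝ}
    (hP : P.Budget Call.Valid (Call.queryBound c) B) {w : (α × List (Call S A × ℝ)) × ℕ}
    (hw : w ∈ ((P.toQProg E₁ E₂ s₀ w₀).exec U).support) : (w.2 : ℝ) ≤ B := by
  induction P generalizing B w with
  | ret a =>
    simp only [EstProg.toQProg, QProg.exec, PMF.support_pure, Set.mem_singleton_iff] at hw
    rw [hw, Nat.cast_zero]
    exact hP
  | call e next ih =>
    obtain ⟨he, B', hB, hnext⟩ := hP
    obtain ⟨w₁, hw₁, w₂, hw₂, -, h2⟩ := QProg.mem_support_exec_bind hw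
    obtain ⟨w₃, hw₃, w₄, hw₄, -, h4⟩ := QProg.mem_support_exec_bind hw₂
    simp only [QProg.exec, PMF.support_pure, Set.mem_singleton_iff] at hw₄
    have h5 := Call.queries_le h₁ h₂ U he hw₁
    have h6 := ih w₁.1 (hnext w₁.1) hw₃
    rw [h2, h4, hw₄]
    push_cast
    linarith

/-- All calls in a transcript met their promises and were answered correctly. -/
def TranscriptCorrect (M : MDP S A) (l : List (Call S A × ℝ)) : Prop :=
  ∀ e ∈ l, e.1.Promise M ∧ |e.2 - e.1.target M| < e.1.error

/-- Union bound for adaptive calls, by induction on the first answer. If it is wrong, its failure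
probability is charged; if it is correct, the remaining program is still safe. -/
theorem EstProg.Safe.prob_incorrect_le (h₁ : IsQEst1 c E₁) (h₂ : IsQEst2 c E₂)
    (hO : IsGenerativeModel M s₀ w₀ O) {P : EstProg S A α} {Q : α → Prop} (hP : P.Safe M Q) {B : ℝ}
    (hB : P.Budget (fun e => 0 < e.failure ∧ e.failure < 1) Call.failure B) :
    ((P.toQProg E₁ E₂ s₀ w₀).law (reorderOracle O)).toOuterMeasure
      {out | TranscriptCorrect M out.2}ᶜ ≤ ENNReal.ofReal B := by
  classical
  induction P generalizing B with
  | ret a =>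
    simp [EstProg.toQProg, QProg.law_ret, PMF.toOuterMeasure_pure_apply, TranscriptCorrect]
  | call e next ih =>
    obtain ⟨he, hsafe⟩ := hP
    obtain ⟨⟨hδ0, hδ1⟩, B', hBB, hnext⟩ := hB
    -- Needed because `ENNReal.ofReal` truncates negative numbers and would not be additive.
    have hB'0 : 0 ≤ B' := by
      have : ∀ (P : EstProg S A α) (B : ℝ),
          P.Budget (fun e => 0 < e.failure ∧ e.failure < 1) Call.failure B → 0 ≤ B := by
        intro P
        induction P with
        | ret a => exact fun B h => h
        | call e next ih =>
          rintro B ⟨⟨h0, -⟩, b, hb, hn⟩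
          linarith [ih 0 b (hn 0)]
      exact this _ _ (hnext 0)
    have hstep : ∀ x, ((((next x).toQProg E₁ E₂ s₀ w₀).bind fun out =>
        .ret (out.1, (e, x) :: out.2)).law (reorderOracle O)).toOuterMeasure
          {out | TranscriptCorrect M out.2}ᶜ ≤
        ENNReal.ofReal B' + ({x | |x - e.target M| < e.error}ᶜ : Set ℝ).indicator 1 x := by
      intro x
      by_cases hx : |x - e.target M| < e.error
      · refine le_trans ?_ le_self_add
        refine le_trans ?_ (ih x (hsafe x hx) (hnext x))
        have : (((next x).toQProg E₁ E₂ s₀ w₀).bind fun out =>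
            .ret (out.1, (e, x) :: out.2)).law (reorderOracle O) =
            (((next x).toQProg E₁ E₂ s₀ w₀).law (reorderOracle O)).map
              fun out => (out.1, (e, x) :: out.2) := by
          rw [QProg.law_bind, ← PMF.bind_pure_comp]
          congr 1
          ext out : 1
          rw [QProg.law_ret]; rfl
        rw [this, prob_map]
        refine prob_mono _ fun out hout => ?_
        simp only [Set.mem_preimage, Set.mem_compl_iff, Set.mem_ofPred_eq] at hout ⊢
        intro hc
        apply hout
        intro e' he'
        rcases List.mem_cons.1 he' with rfl | he'
        · exact ⟨he, hx⟩
        · exact hc e' he'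
      · refine (prob_le_one _ _).trans ?_
        rw [Set.indicator_of_mem (by simpa using hx)]
        exact le_add_self
    rw [EstProg.toQProg, QProg.law_bind, prob_eq_expect, expect_bind]
    simp_rw [← prob_eq_expect]
    refine (expect_mono _ hstep).trans ?_
    rw [expect_add, expect_const, ← prob_eq_expect]
    calc _ ≤ ENNReal.ofReal B' + ENNReal.ofReal e.failure := by
          gcongr
          exact Call.prob_incorrect_le h₁ h₂ hO he hδ0 hδ1
      _ ≤ ENNReal.ofReal B := by
          rw [← ENNReal.ofReal_add hB'0 hδ0.le]
          exact ENNReal.ofReal_le_ofReal (by linarith)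

end Implementation

end QuantumMDP

namespace QuantumMDP

open scoped ENNReal

/-! ## Correctness of the algorithm -/

section Correctness

theorem le_improve_v {S A : Type} [Fintype A] [Nonempty A] (st : Vars S A) (s : S) : st.v s ≤ (improve st).v s := by
  simp only [improve]; split_ifs with h <;> simp [h]

theorem maxValue_le_improve_v {S A : Type} [Fintype A] [Nonempty A] (st : Vars S A) (s : S) : maxValue st.q s ≤ (improve st).v s := by
  simp only [improve]; split_ifs with h
  · exact le_rfl
  · exact (not_le.1 h).le

theorem improve_v_le {S A : Type} [Fintype A] [Nonempty A] {st : Vars S A} {s : S} {c : ℝ} (hv : st.v s ≤ c)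
    (hq : ∀ a, st.q (s, a) ≤ c) : (improve st).v s ≤ c := by
  simp only [improve]; split_ifs
  · exact (maxValue_le_iff _ _ _).2 hq
  · exact hv

/-- Guarantees the requirement η < 4σ of `qEst2`, since η/σ is this product divided by 200. -/
theorem rpow_mul_le_one {S A : Type} [Fintype S] (M : MDP S A) {ε : ℝ}
    (hεΓ : ε ≤ Real.sqrt (horizon M.γ)) : (1 - M.γ) ^ (3 / 2 : ℝ) * ε ≤ 1 := by
  have hd := M.one_sub_gamma_pos
  have hΓ := M.one_le_horizon
  have h1 : Real.sqrt (horizon M.γ) ≤ horizon M.γ ^ (3 / 2 : ℝ) := by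
    rw [Real.sqrt_eq_rpow]
    exact Real.rpow_le_rpow_of_exponent_le hΓ (by norm_num)
  calc (1 - M.γ) ^ (3 / 2 : ℝ) * ε ≤ (1 - M.γ) ^ (3 / 2 : ℝ) * horizon M.γ ^ (3 / 2 : ℝ) := by
        gcongr
        exact hεΓ.trans h1
    _ = 1 := by rw [← Real.mul_rpow hd.le (by linarith), M.horizon_mul, Real.one_rpow]

theorem sqrt_horizon_le {S A : Type} [Fintype S] (M : MDP S A) : Real.sqrt (horizon M.γ) ≤ horizon M.γ := by
  have hΓ := M.one_le_horizon
  rw [Real.sqrt_le_left (by linarith)]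
  nlinarith

variable {S A : Type} [Fintype S] [DecidableEq S] [Fintype A] [DecidableEq A] [Nonempty A]
  {M : MDP S A}

/-- Invariant of the inner loop after `l` iterations. -/
structure InnerInv (M : MDP S A) (v g v₀ : S → ℝ) (e : ℝ) (l : ℕ) (st : Vars S A) : Prop where
  anchor_le : ∀ s, v₀ s ≤ st.v s
  v_le : ∀ s, st.v s ≤ v s
  q_le : ∀ s a, st.q (s, a) ≤ v s
  -- The value lags one backup behind q, hence the exponent l - 1. Truncated subtraction makes it 0
  -- for l = 0 as well.
  v_gap : ∀ s, v s - st.v s ≤ M.γ ^ (l - 1) * (2 * e) + g s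
  -- At the start of an epoch no lower bound on the inherited q is required, and the gap of v itself
  -- is used instead.
  q_gap : l = 0 ∨ ∀ s, v s - maxValue st.q s ≤ M.γ ^ l * (2 * e) + g s

/-- One approximate Bellman backup. Underestimates keep q below the optimal value by monotonicity.
Along the optimal policy the gap is contracted by γ and receives the estimation error, which the
supersolution `g` absorbs. -/
theorem safe_innerStep {v : S → ℝ} {π : S → A} (h : M.IsOptimal v π) {g v₀ : S → ℝ} {e : ℝ}
    (he : 0 < e) (hg0 : ∀ s, 0 ≤ g s) (hv₀e : ∀ s, v s - v₀ s ≤ 2 * e)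
    {ξ x : S × A → ℝ} (hx : ∀ s a, mean (M.p s a) v₀ - 2 * ξ (s, a) ≤ x (s, a) ∧
      x (s, a) ≤ mean (M.p s a) v₀)
    (hg : ∀ s, M.γ * mean (M.p s (π s)) g + M.γ * (2 * ξ (s, π s) +
      2 * (1 / 100 * (1 - M.γ) * e)) ≤ g s) (f : ℝ) {l : ℕ} {st : Vars S A}
    (hst : InnerInv M v g v₀ e l st) :
    (innerStep M.r M.γ f (1 / 100) e v₀ x st).Safe M (InnerInv M v g v₀ e (l + 1)) := by
  have hγ0 := M.γ_nonneg
  have hd := M.one_sub_gamma_pos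
  set st' := improve st with hst'
  have hle : ∀ s, v₀ s ≤ st'.v s := fun s => (hst.anchor_le s).trans (le_improve_v st s)
  have hv : ∀ s, st'.v s ≤ v s := fun s => improve_v_le (hst.v_le s) (hst.q_le s)
  have hgap : ∀ s, v s - st'.v s ≤ M.γ ^ l * (2 * e) + g s := by
    intro s
    rcases hst.q_gap with rfl | hq
    · linarith [hv₀e s, hg0 s, hle s]
    · linarith [hq s, maxValue_le_improve_v st s]
  set t := 1 / 100 * (1 - M.γ) * e with ht
  have ht0 : 0 < t := by positivity
  -- Subtracting the error `t` turns a two-sided estimate into one that is too low by at most 2t.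
  have hsweep : (sweep fun sa : S × A => do
      let m ← estimate (.qEst1 f sa.1 sa.2 (fun s => st'.v s - v₀ s) (2 * e) t)
      pure (m - t)).Safe M fun Δ => ∀ sa : S × A,
        mean (M.p sa.1 sa.2) st'.v - mean (M.p sa.1 sa.2) v₀ - 2 * t ≤ Δ sa ∧
        Δ sa ≤ mean (M.p sa.1 sa.2) st'.v - mean (M.p sa.1 sa.2) v₀ := by
    refine safe_sweep (Q := fun (sa : S × A) (d : ℝ) =>
        mean (M.p sa.1 sa.2) st'.v - mean (M.p sa.1 sa.2) v₀ - 2 * t ≤ d ∧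
        d ≤ mean (M.p sa.1 sa.2) st'.v - mean (M.p sa.1 sa.2) v₀) fun sa => ?_
    refine (safe_estimate ?_).bind fun m hm => ?_
    · exact ⟨by linarith, ht0, fun s => ⟨sub_nonneg.2 (hle s), by linarith [hv s, hv₀e s]⟩⟩
    · simp only [Call.target, Call.error, mean_sub, abs_lt] at hm
      exact ⟨by linarith, by linarith⟩
  refine hsweep.bind fun Δ hΔ => ?_
  have hup : ∀ s a, M.r s a + M.γ * (x (s, a) + Δ (s, a)) ≤ v s := by
    intro s a
    have h1 : x (s, a) + Δ (s, a) ≤ mean (M.p s a) v := by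
      have := mean_mono (M.p_nonneg s a) hv
      linarith [(hx s a).2, (hΔ (s, a)).2]
    have := mul_le_mul_of_nonneg_left h1 hγ0
    linarith [h.le s a]
  refine ⟨hle, hv, fun s a => max_le (hup s a) (h.nonneg s), hgap, Or.inr fun s => ?_⟩
  have h1 := le_maxValue (fun sa : S × A => max (M.r sa.1 sa.2 + M.γ * (x sa + Δ sa)) 0) s (π s)
  have h2 := le_max_left (M.r s (π s) + M.γ * (x (s, π s) + Δ (s, π s))) 0
  have h3 : mean (M.p s (π s)) v - mean (M.p s (π s)) st'.v ≤
      M.γ ^ l * (2 * e) + mean (M.p s (π s)) g := by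
    rw [← mean_sub, ← mean_const (M.p_sum s (π s)) (M.γ ^ l * (2 * e)), ← mean_add]
    exact mean_mono (M.p_nonneg s (π s)) hgap
  have h4 : mean (M.p s (π s)) v - (x (s, π s) + Δ (s, π s)) ≤
      M.γ ^ l * (2 * e) + mean (M.p s (π s)) g + (2 * ξ (s, π s) + 2 * t) := by
    linarith [(hx s (π s)).1, (hΔ (s, π s)).1]
  have h5 := mul_le_mul_of_nonneg_left h4 hγ0
  have h6 : M.γ ^ (l + 1) * (2 * e) = M.γ * (M.γ ^ l * (2 * e)) := by ring
  rw [h6]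
  simp only at h1 ⊢
  linarith [h.eq s, hg s]

/-- Invariant of the outer loop after `k` epochs. -/
structure EpochInv (M : MDP S A) (v : S → ℝ) (k : ℕ) (st : Vars S A) : Prop where
  nonneg : ∀ s, 0 ≤ st.v s
  v_le : ∀ s, st.v s ≤ v s
  q_le : ∀ s a, st.q (s, a) ≤ v s
  gap : ∀ s, v s - st.v s ≤ horizon M.γ / 2 ^ k

/-- The final gap is at most γ^(L-1) · 2e + g ≤ e/2 + e/2 = e, half of the bound 2e for the initial
gap. -/
theorem safe_epoch {v : S → ℝ} {π : S → A} (h : M.IsOptimal v π) {ε : ℝ} (hε : 0 < ε)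
    (hεΓ : ε ≤ Real.sqrt (horizon M.γ)) (f : ℝ) {k : ℕ} (hk : k < epochs M.γ ε) {st : Vars S A}
    (hst : EpochInv M v k st) :
    (epoch M.r M.γ ε f 1 (1 / 100) (iterations M.γ ε) (k + 1) st).Safe M
      (EpochInv M v (k + 1)) := by
  have hΓ := M.one_le_horizon
  have hd := M.one_sub_gamma_pos
  have hmul := M.horizon_mul
  set e := horizon M.γ / 2 ^ (k + 1) with he
  have he0 : 0 < e := by positivity
  have hεe : ε ≤ 2 * e := le_two_mul_horizon_div M hε (hεΓ.trans (sqrt_horizon_le M)) hk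
  have hgap : ∀ s, v s - st.v s ≤ 2 * e := fun s => (hst.gap s).trans_eq (by
    rw [he, pow_succ]; field_simp)
  have hvΓ : ∀ s, st.v s ≤ horizon M.γ := fun s => (hst.v_le s).trans (h.le_horizon s)
  have hy : (sweep fun sa : S × A => do
      let m₂ ← estimate (.qEst1 f sa.1 sa.2 (fun s => st.v s ^ 2) (horizon M.γ ^ 2) 1)
      let m₁ ← estimate (.qEst1 f sa.1 sa.2 st.v (horizon M.γ) ((1 - M.γ) * 1))
      pure (max (m₂ - m₁ ^ 2) 0)).Safe M fun y => ∀ sa : S × A, 0 ≤ y sa ∧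
        variance (M.p sa.1 sa.2) st.v ≤ y sa + 4 ∧
        y sa ≤ variance (M.p sa.1 sa.2) st.v + 4 := by
    refine safe_sweep (Q := fun (sa : S × A) (d : ℝ) => 0 ≤ d ∧
        variance (M.p sa.1 sa.2) st.v ≤ d + 4 ∧ d ≤ variance (M.p sa.1 sa.2) st.v + 4)
      fun sa => ?_
    refine (safe_estimate ?_).bind fun m₂ hm₂ => (safe_estimate ?_).bind fun m₁ hm₁ => ?_
    · exact ⟨by positivity, one_pos, fun s => ⟨sq_nonneg _,
        pow_le_pow_left₀ (hst.nonneg s) (hvΓ s) 2⟩⟩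
    · exact ⟨by linarith, by linarith, fun s => ⟨hst.nonneg s, hvΓ s⟩⟩
    · simp only [Call.target, Call.error, mul_one] at hm₁ hm₂
      have hp := M.p_nonneg sa.1 sa.2
      have hp1 := M.p_sum sa.1 sa.2
      have h1 := mean_sq hp1 st.v
      have h2 := variance_nonneg hp st.v
      have h3 := abs_variance_estimate (y := max (m₂ - m₁ ^ 2) 0) (by linarith [M.γ_nonneg])
        hmul (mean_nonneg hp hst.nonneg)
        ((mean_mono hp hvΓ).trans_eq (mean_const hp1 _)) hm₂ hm₁ (by linarith) rfl
      exact ⟨le_max_right _ _, by linarith, by linarith⟩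
  refine hy.bind fun y hy => ?_
  have hκ := rpow_mul_le_one M hεΓ
  set κ := (1 - M.γ) ^ (3 / 2 : ℝ) with hκdef
  have hκ0 : 0 < κ := Real.rpow_pos_of_pos hd _
  set ξ : S × A → ℝ := fun sa => 1 / 100 * κ * ε * Real.sqrt (y sa + 1) with hξ
  have hx : (sweep fun sa : S × A => do
      let m ← estimate (.qEst2 f sa.1 sa.2 st.v (2 * Real.sqrt (y sa + 1)) (ξ sa))
      pure (m - ξ sa)).Safe M fun x => ∀ sa : S × A,
        mean (M.p sa.1 sa.2) st.v - 2 * ξ sa ≤ x sa ∧ x sa ≤ mean (M.p sa.1 sa.2) st.v := by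
    refine safe_sweep (Q := fun (sa : S × A) (d : ℝ) =>
        mean (M.p sa.1 sa.2) st.v - 2 * ξ sa ≤ d ∧ d ≤ mean (M.p sa.1 sa.2) st.v) fun sa => ?_
    obtain ⟨hy0, hy1, -⟩ := hy sa
    have hs : 0 < Real.sqrt (y sa + 1) := Real.sqrt_pos.2 (by linarith)
    have hξ0 : 0 < ξ sa := by rw [hξ]; positivity
    refine (safe_estimate ?_).bind fun m hm => ?_
    · refine ⟨by positivity, hξ0, ?_, ?_⟩
      · have : ξ sa = 1 / 100 * (κ * ε) * Real.sqrt (y sa + 1) := by rw [hξ]; ring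
        rw [this]
        nlinarith
      -- The variance is at most y + 4 ≤ 4(y + 1) = σ²; this is the reason for the factor 2 in σ.
      · rw [mul_pow, Real.sq_sqrt (by linarith)]
        linarith
    · simp only [Call.target, Call.error, abs_lt] at hm
      exact ⟨by linarith, by linarith⟩
  refine hx.bind fun x hx => ?_
  obtain ⟨g, hg0, hge, hg⟩ := h.exists_epoch_supersolution hε hεΓ hεe hst.v_le hgap
    (y := y) fun s a => (hy (s, a)).2.2
  have hinit : InnerInv M v g st.v e 0 st :=
    ⟨fun s => le_rfl, hst.v_le, hst.q_le, fun s => by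
      have := hgap s
      have := hg0 s
      simp only [Nat.zero_sub, pow_zero]
      linarith, Or.inl rfl⟩
  refine (safe_forLoop (I := InnerInv M v g st.v e) (fun l _ st' hst' =>
    safe_innerStep h he0 hg0 hgap (ξ := ξ) (fun s a => hx (s, a)) hg f hst') hinit).mono
      fun st' hst' => ?_
  refine ⟨fun s => (hst.nonneg s).trans (hst'.anchor_le s), hst'.v_le, hst'.q_le, fun s => ?_⟩
  have h1 := hst'.v_gap s
  have h2 := pow_iterations_le M hε (hεΓ.trans (sqrt_horizon_le M))
  have h3 : M.γ ^ (iterations M.γ ε - 1) * (2 * e) ≤ 1 / 4 * (2 * e) := by gcongr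
  linarith [hge s]

theorem safe_solveMdp1 [Nonempty S] (M : MDP S A) {ε : ℝ} (hε : 0 < ε)
    (hεΓ : ε ≤ Real.sqrt (horizon M.γ)) (δ : ℝ) (π₀ : S → A) :
    (solveMdp1 M.r M.γ ε δ π₀).Safe M fun _ => True := by
  obtain ⟨v, π, h⟩ := M.exists_isOptimal
  refine EstProg.Safe.mono (Q := EpochInv M v (epochs M.γ ε)) ?_ fun _ _ => trivial
  refine safe_forLoop (fun k hk st hst => safe_epoch h hε hεΓ _ hk hst) ?_
  exact ⟨fun s => le_rfl, h.nonneg, fun s a => h.nonneg s, fun s => by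
    simpa using h.le_horizon s⟩

end Correctness

/-! ## Budgets of the algorithm -/

section AlgorithmBudget

variable {S A : Type} [Fintype S] [DecidableEq S] [Fintype A] [DecidableEq A] [Nonempty A]
  {ok : Call S A → Prop} {w : Call S A → ℝ}

/-- Budget of the algorithm, when `w₂`, `w₁`, `wx`, `wΔ` bound the weights of the four kinds of
calls. -/
theorem budget_solveMdp1 (r : S → A → ℝ) {γ ε δ : ℝ} (π₀ : S → A) {f w₂ w₁ wx wΔ : ℝ}
    (hf : f = δ / (4 * epochs γ ε * iterations γ ε * Fintype.card S * Fintype.card A))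
    -- If there are no epochs (Γ = ε = 1), then f = δ/0 = 0 is not a valid failure probability, but
    -- no call is made either. Hence the guard.
    (h₂ : 0 < epochs γ ε → ∀ s a v, ok (.qEst1 f s a v (horizon γ ^ 2) 1) ∧
      w (.qEst1 f s a v (horizon γ ^ 2) 1) ≤ w₂)
    (h₁ : 0 < epochs γ ε → ∀ s a v, ok (.qEst1 f s a v (horizon γ) ((1 - γ) * 1)) ∧
      w (.qEst1 f s a v (horizon γ) ((1 - γ) * 1)) ≤ w₁)
    (hx : 0 < epochs γ ε → ∀ s a v y, 0 ≤ y →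
      ok (.qEst2 f s a v (2 * Real.sqrt (y + 1))
        (1 / 100 * (1 - γ) ^ (3 / 2 : ℝ) * ε * Real.sqrt (y + 1))) ∧
      w (.qEst2 f s a v (2 * Real.sqrt (y + 1))
        (1 / 100 * (1 - γ) ^ (3 / 2 : ℝ) * ε * Real.sqrt (y + 1))) ≤ wx)
    (hΔ : 0 < epochs γ ε → ∀ s a v (k : ℕ),
      ok (.qEst1 f s a v (2 * (horizon γ / 2 ^ k)) (1 / 100 * (1 - γ) * (horizon γ / 2 ^ k))) ∧
      w (.qEst1 f s a v (2 * (horizon γ / 2 ^ k)) (1 / 100 * (1 - γ) * (horizon γ / 2 ^ k))) ≤ wΔ) :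
    (solveMdp1 r γ ε δ π₀).Budget ok w (epochs γ ε * (Fintype.card S * Fintype.card A *
      (w₂ + w₁ + wx + iterations γ ε * wΔ))) := by
  rw [solveMdp1, ← hf]
  refine budget_forLoop (fun k hk st => ?_) _
  have hK : 0 < epochs γ ε := by omega
  have hcard : (Fintype.card (S × A) : ℝ) = Fintype.card S * Fintype.card A := by
    rw [Fintype.card_prod]; push_cast; rfl
  have hpure : ∀ (c : Call S A) (u : ℝ → ℝ) (b : ℝ), ok c ∧ w c ≤ b →
      (do let m ← estimate c; pure (u m) : EstProg S A ℝ).Budget ok w b := fun c u b hc =>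
    ((budget_estimate hc.1).bind fun m => budget_pure (u m)).mono (by linarith [hc.2])
  have hy : (sweep fun sa : S × A => do
      let m₂ ← estimate (.qEst1 f sa.1 sa.2 (fun s => st.v s ^ 2) (horizon γ ^ 2) 1)
      let m₁ ← estimate (.qEst1 f sa.1 sa.2 st.v (horizon γ) ((1 - γ) * 1))
      pure (max (m₂ - m₁ ^ 2) 0) : EstProg S A (S × A → ℝ)).Budget ok w
        (Fintype.card (S × A) * (w₂ + w₁)) :=
    budget_sweep fun sa => ((budget_estimate (h₂ hK sa.1 sa.2 fun s => st.v s ^ 2).1).bind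
      fun m₂ => hpure _ (fun m₁ => max (m₂ - m₁ ^ 2) 0) _ (h₁ hK sa.1 sa.2 st.v)).mono
        (by linarith [(h₂ hK sa.1 sa.2 fun s => st.v s ^ 2).2])
  have hy0 : (sweep fun sa : S × A => do
      let m₂ ← estimate (.qEst1 f sa.1 sa.2 (fun s => st.v s ^ 2) (horizon γ ^ 2) 1)
      let m₁ ← estimate (.qEst1 f sa.1 sa.2 st.v (horizon γ) ((1 - γ) * 1))
      pure (max (m₂ - m₁ ^ 2) 0) : EstProg S A (S × A → ℝ)).Always
        fun y => ∀ sa ∈ Finset.univ.toList, 0 ≤ y sa :=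
    always_sweep (Q := fun _ d => 0 ≤ d) fun sa _ _ => le_max_right _ _
  refine (hy.bind_of_always (B₂ := Fintype.card (S × A) * wx + iterations γ ε *
    (Fintype.card (S × A) * wΔ)) hy0 fun y hy0 => ?_).mono (by rw [hcard]; linarith)
  refine (budget_sweep fun sa => ?_).bind fun x => ?_
  · exact hpure _ _ _ (hx hK sa.1 sa.2 st.v (y sa) (hy0 sa (by simp)))
  · refine budget_forLoop (fun l _ st' => ?_) st
    refine ((budget_sweep fun sa => hpure _ _ _ (hΔ hK sa.1 sa.2 _ (k + 1))).bind
      fun Δ => budget_pure _).mono (by linarith)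

end AlgorithmBudget

end QuantumMDP

namespace QuantumMDP

open scoped ENNReal

/-! ## The query bound -/

section Arithmetic

theorem log_le_logp (x : ℝ) : Real.log x ≤ logp x := le_max_right _ _

theorem logp_nonneg (x : ℝ) : 0 ≤ logp x := zero_le_one.trans (one_le_logp x)

theorem IsQEst1.mono {c c' : ℝ} {E : MeanEstimator} (h : IsQEst1 c E) (hc : c ≤ c') :
    IsQEst1 c' E := by
  intro Ω J _ _ _ _ x₀ j₀ v u η δ U hu hη hδ0 hδ1
  refine ⟨fun w hw => ?_, (h Ω J x₀ j₀ v u η δ U hu hη hδ0 hδ1).2⟩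
  refine ((h Ω J x₀ j₀ v u η δ U hu hη hδ0 hδ1).1 w hw).trans ?_
  have := logp_nonneg (1 / δ)
  gcongr

variable {S A : Type} [Fintype S] {M : MDP S A} {ε : ℝ}

theorem epochs_le (hε : 0 < ε) (hεΓ : ε ≤ horizon M.γ) :
    (epochs M.γ ε : ℝ) ≤ 3 * logp (horizon M.γ / ε) := by
  have h0 : 0 ≤ Real.log (horizon M.γ / ε) := Real.log_nonneg ((one_le_div hε).2 hεΓ)
  have h1 : Real.logb 2 (horizon M.γ / ε) ≤ 2 * Real.log (horizon M.γ / ε) := by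
    rw [Real.logb, div_le_iff₀ (Real.log_pos (by norm_num))]
    nlinarith [Real.log_two_gt_d9]
  have h2 : (epochs M.γ ε : ℝ) < Real.logb 2 (horizon M.γ / ε) + 1 :=
    Nat.ceil_lt_add_one (div_nonneg h0 (Real.log_nonneg (by norm_num)))
  linarith [one_le_logp (horizon M.γ / ε), log_le_logp (horizon M.γ / ε)]

theorem iterations_le (hε : 0 < ε) (hεΓ : ε ≤ horizon M.γ) :
    (iterations M.γ ε : ℝ) ≤ 6 * horizon M.γ * logp (horizon M.γ / ε) := by
  have hΓ := M.one_le_horizon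
  have h0 : 0 ≤ Real.log (horizon M.γ / ε) := Real.log_nonneg ((one_le_div hε).2 hεΓ)
  have hl := one_le_logp (horizon M.γ / ε)
  have h1 : Real.log (4 * horizon M.γ / ε) ≤ 2 + logp (horizon M.γ / ε) := by
    rw [mul_div_assoc, Real.log_mul (by norm_num) (div_pos (by linarith) hε).ne']
    have h4 : Real.log 4 ≤ 2 := by
      rw [show (4 : ℝ) = 2 ^ 2 by norm_num, Real.log_pow]
      push_cast
      linarith [Real.log_two_lt_d9]
    linarith [log_le_logp (horizon M.γ / ε)]
  have h00 : 0 ≤ Real.log (4 * horizon M.γ / ε) :=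
    Real.log_nonneg (by rw [le_div_iff₀ hε]; linarith)
  have h2 := Nat.ceil_lt_add_one h00
  have h3 := Nat.ceil_lt_add_one (a := horizon M.γ * ⌈Real.log (4 * horizon M.γ / ε)⌉₊)
    (by positivity)
  have h4 : horizon M.γ * (⌈Real.log (4 * horizon M.γ / ε)⌉₊ : ℝ) ≤
      horizon M.γ * (4 * logp (horizon M.γ / ε)) := by
    gcongr; linarith
  have h5 : 1 ≤ horizon M.γ * logp (horizon M.γ / ε) := by nlinarith
  rw [iterations]; push_cast
  linarith

theorem horizon_rpow (M : MDP S A) :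
    horizon M.γ ^ (3 / 2 : ℝ) = horizon M.γ * Real.sqrt (horizon M.γ) := by
  have hΓ := M.one_le_horizon
  rw [Real.sqrt_eq_rpow, show (3 / 2 : ℝ) = 1 + 1 / 2 by norm_num,
    Real.rpow_add (by linarith), Real.rpow_one]

/-- The ratio σ/η is 200 Γ^1.5/ε, and ε ≤ √Γ gives Γ^1.5/ε ≤ (Γ/ε)², so its logarithm is comparable
to log(Γ/ε). -/
theorem logp_precision_le (hε : 0 < ε) (hεΓ : ε ≤ Real.sqrt (horizon M.γ)) :
    logp (200 * (horizon M.γ ^ (3 / 2 : ℝ) / ε)) ≤ 8 * logp (horizon M.γ / ε) := by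
  have hΓ := M.one_le_horizon
  have hl := one_le_logp (horizon M.γ / ε)
  have hΓ0 : 0 < horizon M.γ := by linarith
  refine max_le (by linarith) ?_
  have h1 : horizon M.γ ^ (3 / 2 : ℝ) / ε ≤ (horizon M.γ / ε) ^ 2 := by
    have h2 : Real.sqrt (horizon M.γ) * ε ≤ horizon M.γ := by
      calc Real.sqrt (horizon M.γ) * ε ≤ Real.sqrt (horizon M.γ) * Real.sqrt (horizon M.γ) := by
            gcongr
        _ = horizon M.γ := Real.mul_self_sqrt hΓ0.le
    rw [horizon_rpow, div_pow, div_le_div_iff₀ hε (by positivity)]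
    calc horizon M.γ * Real.sqrt (horizon M.γ) * ε ^ 2
        = horizon M.γ * ε * (Real.sqrt (horizon M.γ) * ε) := by ring
      _ ≤ horizon M.γ * ε * horizon M.γ := by gcongr
      _ = horizon M.γ ^ 2 * ε := by ring
  have h3 : Real.log 200 ≤ 6 := by
    have h4 : Real.log 200 ≤ Real.log (2 ^ 8) := Real.log_le_log (by norm_num) (by norm_num)
    rw [Real.log_pow] at h4
    push_cast at h4
    linarith [Real.log_two_lt_d9]
  calc Real.log (200 * (horizon M.γ ^ (3 / 2 : ℝ) / ε))
      ≤ Real.log (200 * (horizon M.γ / ε) ^ 2) := by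
        apply Real.log_le_log (by positivity)
        gcongr
    _ = Real.log 200 + 2 * Real.log (horizon M.γ / ε) := by
        rw [Real.log_mul (by norm_num) (by positivity), Real.log_pow]; norm_num
    _ ≤ _ := by linarith [log_le_logp (horizon M.γ / ε)]

/-- 1/f is at most 72 l² nΓ/δ with l = log₊(Γ/ε), and log l ≤ l - 1. Bounding the resulting sum by a
product costs one power of l in the final estimate. -/
theorem logp_failure_le (hε : 0 < ε) (hεΓ : ε ≤ horizon M.γ) (hK : 0 < epochs M.γ ε) {n δ : ℝ}
    (hn : 1 ≤ n) (hδ0 : 0 < δ) :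
    logp (1 / (δ / (4 * epochs M.γ ε * iterations M.γ ε * n))) ≤
      8 * logp (horizon M.γ / ε) * logp (n * horizon M.γ / δ) := by
  have hΓ := M.one_le_horizon
  have hl := one_le_logp (horizon M.γ / ε)
  have hL := one_le_logp (n * horizon M.γ / δ)
  set l := logp (horizon M.γ / ε) with hldef
  set Λ := logp (n * horizon M.γ / δ) with hΛ
  have hlΛ : 1 ≤ l * Λ := one_le_mul_of_one_le_of_one_le hl hL
  refine max_le (by nlinarith) ?_
  have hKpos : (0 : ℝ) < epochs M.γ ε := by exact_mod_cast hK
  have hLpos : (0 : ℝ) < iterations M.γ ε := by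
    rw [iterations]; positivity
  have h1 : 1 / (δ / (4 * epochs M.γ ε * iterations M.γ ε * n)) ≤
      72 * l ^ 2 * (n * horizon M.γ / δ) := by
    rw [one_div_div, ← mul_div_assoc]
    gcongr ?_ / δ
    calc 4 * (epochs M.γ ε : ℝ) * iterations M.γ ε * n
        ≤ 4 * (3 * l) * (6 * horizon M.γ * l) * n := by
          have := epochs_le hε hεΓ
          have := iterations_le hε hεΓ
          gcongr
      _ = 72 * l ^ 2 * (n * horizon M.γ) := by ring
  have h2 : Real.log 72 ≤ 5 := by
    have h4 : Real.log 72 ≤ Real.log (2 ^ 7) := Real.log_le_log (by norm_num) (by norm_num)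
    rw [Real.log_pow] at h4
    push_cast at h4
    linarith [Real.log_two_lt_d9]
  have h3 : Real.log l ≤ l - 1 := Real.log_le_sub_one_of_pos (by linarith)
  calc _ ≤ Real.log (72 * l ^ 2 * (n * horizon M.γ / δ)) :=
        Real.log_le_log (by positivity) h1
    _ = Real.log 72 + 2 * Real.log l + Real.log (n * horizon M.γ / δ) := by
        rw [Real.log_mul (by positivity) (by positivity), Real.log_mul (by norm_num)
          (by positivity), Real.log_pow]
        norm_num
    _ ≤ 5 + 2 * (l - 1) + Λ := by
        have := log_le_logp (n * horizon M.γ / δ)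
        linarith
    _ ≤ 8 * l * Λ := by nlinarith

end Arithmetic

section Complexity

theorem failure_pos_lt_one {S A : Type} [Fintype S] [Fintype A] [Nonempty S] [Nonempty A]
    {M : MDP S A} {ε δ : ℝ} (hδ0 : 0 < δ) (hδ1 : δ < 1) (hK : 0 < epochs M.γ ε) :
    0 < δ / (4 * epochs M.γ ε * iterations M.γ ε * Fintype.card S * Fintype.card A) ∧
      δ / (4 * epochs M.γ ε * iterations M.γ ε * Fintype.card S * Fintype.card A) < 1 := by
  have h : 1 ≤ 4 * epochs M.γ ε * iterations M.γ ε * Fintype.card S * Fintype.card A := by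
    have hS : 0 < Fintype.card S := Fintype.card_pos
    have hA : 0 < Fintype.card A := Fintype.card_pos
    have hL : 0 < iterations M.γ ε := by rw [iterations]; omega
    exact Nat.succ_le_of_lt (by positivity)
  have h' : (1 : ℝ) ≤ 4 * epochs M.γ ε * iterations M.γ ε * Fintype.card S * Fintype.card A := by
    exact_mod_cast h
  refine ⟨by positivity, ?_⟩
  rw [div_lt_one (by linarith)]
  linarith

variable {S A : Type} [Fintype S] [DecidableEq S] [Fintype A] [DecidableEq A] [Nonempty A]
  {M : MDP S A} {ε δ : ℝ}

/-- The failure probabilities of all calls sum up to at most `δ`. -/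
theorem failure_budget_solveMdp1 [Nonempty S] (M : MDP S A) (hδ0 : 0 < δ) (hδ1 : δ < 1)
    (π₀ : S → A) :
    (solveMdp1 M.r M.γ ε δ π₀).Budget (fun e => 0 < e.failure ∧ e.failure < 1)
      Call.failure δ := by
  set f := δ / (4 * epochs M.γ ε * iterations M.γ ε * Fintype.card S * Fintype.card A) with hf
  have hok : 0 < epochs M.γ ε → 0 < f ∧ f < 1 := fun hK => failure_pos_lt_one hδ0 hδ1 hK
  refine (budget_solveMdp1 M.r π₀ (w₂ := f) (w₁ := f) (wx := f) (wΔ := f) hf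
    (fun hK _ _ _ => ⟨hok hK, le_rfl⟩) (fun hK _ _ _ => ⟨hok hK, le_rfl⟩)
    (fun hK _ _ _ _ _ => ⟨hok hK, le_rfl⟩) (fun hK _ _ _ _ => ⟨hok hK, le_rfl⟩)).mono ?_
  rcases Nat.eq_zero_or_pos (epochs M.γ ε) with hK | hK
  · rw [hK]; simpa using hδ0.le
  · have hS : (0 : ℝ) < Fintype.card S := by exact_mod_cast Fintype.card_pos
    have hA : (0 : ℝ) < Fintype.card A := by exact_mod_cast Fintype.card_pos
    have hL : (1 : ℝ) ≤ iterations M.γ ε := by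
      rw [iterations]; push_cast; linarith [Nat.cast_nonneg (α := ℝ)
        ⌈horizon M.γ * ⌈Real.log (4 * horizon M.γ / ε)⌉₊⌉₊]
    have hKpos : (0 : ℝ) < epochs M.γ ε := by exact_mod_cast hK
    have hf0 := (hok hK).1
    have h1 : 4 * (epochs M.γ ε : ℝ) * iterations M.γ ε * Fintype.card S * Fintype.card A * f =
        δ := by
      rw [hf]; field_simp
    calc (epochs M.γ ε : ℝ) * (Fintype.card S * Fintype.card A *
          (f + f + f + iterations M.γ ε * f))
        = epochs M.γ ε * (Fintype.card S * Fintype.card A * ((3 + iterations M.γ ε) * f)) := by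
          ring
      -- Each epoch makes 3 + L ≤ 4L calls per state-action pair, which explains the 4 in f.
      _ ≤ epochs M.γ ε * (Fintype.card S * Fintype.card A * ((4 * iterations M.γ ε) * f)) := by
          gcongr; linarith
      _ = δ := by rw [← h1]; ring

/-- The four kinds of calls have the precision ratios Γ², Γ/(1-γ) = Γ², 200 Γ^1.5/ε and 200 Γ. None
depends on previous answers, so the bound holds on every path, whether or not the answers are
correct. -/
theorem query_budget_solveMdp1 [Nonempty S] (M : MDP S A) {c : ℝ} (hc : 0 < c) (hε : 0 < ε)
    (hεΓ : ε ≤ Real.sqrt (horizon M.γ)) (hδ0 : 0 < δ) (hδ1 : δ < 1) (π₀ : S → A) :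
    (solveMdp1 M.r M.γ ε δ π₀).Budget Call.Valid (Call.queryBound c)
      (400000 * c * (Fintype.card S * Fintype.card A *
        (horizon M.γ ^ (3 / 2 : ℝ) / ε + horizon M.γ ^ 2)) * logp (horizon M.γ / ε) ^ 4 *
        logp (Fintype.card S * Fintype.card A * horizon M.γ / δ)) := by
  have hΓ := M.one_le_horizon
  have hd := M.one_sub_gamma_pos
  have hmul := M.horizon_mul
  have hεΓ' := hεΓ.trans (sqrt_horizon_le M)
  have hκ := rpow_mul_le_one M hεΓ
  have hκΓ : (1 - M.γ) ^ (3 / 2 : ℝ) * horizon M.γ ^ (3 / 2 : ℝ) = 1 := by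
    rw [← Real.mul_rpow hd.le (by linarith), hmul, Real.one_rpow]
  have hκ0 : 0 < (1 - M.γ) ^ (3 / 2 : ℝ) := Real.rpow_pos_of_pos hd _
  have hX0 : 0 < horizon M.γ ^ (3 / 2 : ℝ) := Real.rpow_pos_of_pos (by linarith) _
  set f := δ / (4 * epochs M.γ ε * iterations M.γ ε * Fintype.card S * Fintype.card A) with hf
  have hf01 : 0 < epochs M.γ ε → 0 < f ∧ f < 1 := fun hK => failure_pos_lt_one hδ0 hδ1 hK
  set l := logp (horizon M.γ / ε) with hl
  have hl1 : 1 ≤ l := one_le_logp _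
  set n : ℝ := Fintype.card S * Fintype.card A with hn
  have hn1 : 1 ≤ n := by
    have hS : (1 : ℝ) ≤ Fintype.card S := by exact_mod_cast Nat.succ_le_of_lt Fintype.card_pos
    have hA : (1 : ℝ) ≤ Fintype.card A := by exact_mod_cast Nat.succ_le_of_lt Fintype.card_pos
    exact one_le_mul_of_one_le_of_one_le hS hA
  set Λ := logp (n * horizon M.γ / δ) with hΛ
  have hΛ0 : 0 ≤ Λ := logp_nonneg _
  have hℓ : 0 < epochs M.γ ε → logp (1 / f) ≤ 8 * l * Λ := fun hK => by
    have := logp_failure_le hε hεΓ' hK hn1 hδ0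
    rwa [hn, ← mul_assoc] at this
  have hsqrt : ∀ x : ℝ, 1 ≤ x → Real.sqrt x ≤ x := fun x hx => by
    rw [Real.sqrt_le_left (by linarith)]; nlinarith
  set Γ := horizon M.γ with hΓdef
  set X := Γ ^ (3 / 2 : ℝ) / ε with hX
  have hXpos : 0 < X := by positivity
  refine (budget_solveMdp1 M.r π₀ (w₂ := c * (2 * Γ ^ 2) * (8 * l * Λ))
    (w₁ := c * (2 * Γ ^ 2) * (8 * l * Λ)) (wx := c * (200 * X * (8 * l) ^ 2) * (8 * l * Λ))
    (wΔ := c * (400 * Γ) * (8 * l * Λ)) hf ?_ ?_ ?_ ?_).mono ?_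
  · intro hK s a v
    refine ⟨⟨by positivity, one_pos, hf01 hK⟩, ?_⟩
    have h1 := hsqrt (Γ ^ 2) (by nlinarith)
    have h2 := hℓ hK
    have hℓ0 := logp_nonneg (1 / f)
    simp only [Call.queryBound, div_one]
    gcongr
    linarith
  · intro hK s a v
    refine ⟨⟨by linarith, by linarith, hf01 hK⟩, ?_⟩
    have h0 : Γ / ((1 - M.γ) * 1) = Γ ^ 2 := by
      rw [mul_one, div_eq_iff hd.ne']
      linear_combination (-Γ) * hmul
    have h1 := hsqrt (Γ ^ 2) (by nlinarith)
    have h2 := hℓ hK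
    have hℓ0 := logp_nonneg (1 / f)
    simp only [Call.queryBound, ← hΓdef, h0]
    gcongr
    linarith
  · intro hK s a v y hy
    have hs : 0 < Real.sqrt (y + 1) := Real.sqrt_pos.2 (by linarith)
    refine ⟨⟨by positivity, by positivity, ?_, hf01 hK⟩, ?_⟩
    · have : 1 / 100 * (1 - M.γ) ^ (3 / 2 : ℝ) * ε * Real.sqrt (y + 1) =
          1 / 100 * ((1 - M.γ) ^ (3 / 2 : ℝ) * ε) * Real.sqrt (y + 1) := by ring
      rw [this]
      nlinarith
    · have h0 : 2 * Real.sqrt (y + 1) / (1 / 100 * (1 - M.γ) ^ (3 / 2 : ℝ) * ε *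
          Real.sqrt (y + 1)) = 200 * X := by
        rw [hX, div_eq_iff (by positivity)]
        field_simp
        linear_combination (-200) * hκΓ
      have h1 : logp (200 * X) ≤ 8 * l := logp_precision_le hε hεΓ
      have h2 := hℓ hK
      have hℓ0 := logp_nonneg (1 / f)
      have h3 := logp_nonneg (200 * X)
      simp only [Call.queryBound, h0]
      gcongr
  · intro hK s a v k
    have he : 0 < Γ / 2 ^ k := by positivity
    refine ⟨⟨by positivity, by positivity, hf01 hK⟩, ?_⟩
    have h0 : 2 * (Γ / 2 ^ k) / (1 / 100 * (1 - M.γ) * (Γ / 2 ^ k)) = 200 * Γ := by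
      rw [div_eq_iff (by positivity)]
      linear_combination (-(2 * (Γ / 2 ^ k))) * hmul
    have h1 := hsqrt (200 * Γ) (by linarith)
    have h2 := hℓ hK
    have hℓ0 := logp_nonneg (1 / f)
    simp only [Call.queryBound, ← hΓdef, h0]
    gcongr
    linarith
  · have hK := epochs_le hε hεΓ'
    have hL := iterations_le hε hεΓ'
    have hl0 : 0 ≤ l := by linarith
    -- Here 12800 = 200 · 8², from `qEst2`. The L difference estimates cost 2400 Γ² l in total and
    -- fit into the Γ² term.
    have hin : c * (2 * Γ ^ 2) * (8 * l * Λ) + c * (2 * Γ ^ 2) * (8 * l * Λ) +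
        c * (200 * X * (8 * l) ^ 2) * (8 * l * Λ) +
        iterations M.γ ε * (c * (400 * Γ) * (8 * l * Λ)) ≤
        c * (8 * l * Λ) * (12800 * l ^ 2 * (X + Γ ^ 2)) := by
      have h1 : iterations M.γ ε * (c * (400 * Γ) * (8 * l * Λ)) ≤
          (6 * Γ * l) * (c * (400 * Γ) * (8 * l * Λ)) := by gcongr
      have h2 : 4 * Γ ^ 2 + 2400 * Γ ^ 2 * l ≤ 12800 * l ^ 2 * Γ ^ 2 := by
        have : 4 + 2400 * l ≤ 12800 * l ^ 2 := by nlinarith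
        nlinarith [sq_nonneg Γ]
      have h3 := mul_le_mul_of_nonneg_left h2 (show 0 ≤ c * (8 * l * Λ) by positivity)
      linarith
    calc _ ≤ (3 * l) * (n * (c * (8 * l * Λ) * (12800 * l ^ 2 * (X + Γ ^ 2)))) := by gcongr
      _ = 307200 * (c * (n * (X + Γ ^ 2)) * l ^ 4 * Λ) := by ring
      _ ≤ 400000 * (c * (n * (X + Γ ^ 2)) * l ^ 4 * Λ) := by
        gcongr; norm_num
      _ = _ := by ring

end Complexity

/-! ## Executions of the algorithm -/

section Runs

variable {S A W : Type} [Fintype S] [DecidableEq S] [Fintype A] [DecidableEq A] [Nonempty A]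
  [Fintype W] [DecidableEq W] {E₁ E₂ : MeanEstimator} {c : ℝ} {M : MDP S A} {s₀ : S} {w₀ : W}
  {O : Matrix.unitaryGroup (S × A × S × W) ℂ} {ε δ : ℝ}

theorem queries_runSolveMdp1_le (h₁ : IsQEst1 c E₁) (h₂ : IsQEst2 c E₂) (hc : 0 < c)
    (π₀ : S → A) (hε : 0 < ε) (hεΓ : ε ≤ Real.sqrt (horizon M.γ)) (hδ0 : 0 < δ) (hδ1 : δ < 1)
    {ω : Outcome S A} (hω : ω ∈ (runSolveMdp1 E₁ E₂ M s₀ w₀ O ε δ π₀).support) :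
    (ω.queries : ℝ) ≤ 400000 * c * (Fintype.card S * Fintype.card A *
        (horizon M.γ ^ (3 / 2 : ℝ) / ε + horizon M.γ ^ 2)) * logp (horizon M.γ / ε) ^ 4 *
        logp (Fintype.card S * Fintype.card A * horizon M.γ / δ) := by
  have : Nonempty S := ⟨s₀⟩
  rw [runSolveMdp1, PMF.support_map] at hω
  obtain ⟨w, hw, rfl⟩ := hω
  exact (query_budget_solveMdp1 M hc hε hεΓ hδ0 hδ1 π₀).queries_le h₁ h₂ _ hw

theorem le_prob_allCorrect (h₁ : IsQEst1 c E₁) (h₂ : IsQEst2 c E₂)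
    (hO : IsGenerativeModel M s₀ w₀ O) (π₀ : S → A) (hε : 0 < ε)
    (hεΓ : ε ≤ Real.sqrt (horizon M.γ)) (hδ0 : 0 < δ) (hδ1 : δ < 1) :
    ENNReal.ofReal (1 - δ) ≤
      (runSolveMdp1 E₁ E₂ M s₀ w₀ O ε δ π₀).toOuterMeasure {ω | ω.AllCorrect M} := by
  have : Nonempty S := ⟨s₀⟩
  have h := (safe_solveMdp1 M hε hεΓ δ π₀).prob_incorrect_le h₁ h₂ hO
    (failure_budget_solveMdp1 M hδ0 hδ1 π₀)
  rw [runSolveMdp1, prob_map]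
  have h2 := QProg.prob_exec_fst (reorderOracle O)
    ((solveMdp1 M.r M.γ ε δ π₀).toQProg E₁ E₂ s₀ w₀) {out | TranscriptCorrect M out.2}
  refine le_trans ?_ h2.ge
  have h4 := prob_add_prob_compl
    (((solveMdp1 M.r M.γ ε δ π₀).toQProg E₁ E₂ s₀ w₀).law (reorderOracle O))
    {out | TranscriptCorrect M out.2}
  rw [ENNReal.ofReal_sub 1 hδ0.le, ENNReal.ofReal_one, tsub_le_iff_right, ← h4]
  gcongr

end Runs

end QuantumMDP

/-! ### Assembly of the estimators, the query bound and the union bound. -/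

theorem mainTheorem2 :
    ∃ (E₁ E₂ : MeanEstimator) (c : ℝ), 0 < c ∧ IsQEst1 c E₁ ∧ IsQEst2 c E₂ ∧
      (∃ C : ℝ, 0 < C ∧
        ∀ (S A W : Type) [Fintype S] [DecidableEq S] [Fintype A] [DecidableEq A] [Nonempty A]
          [Fintype W] [DecidableEq W] (M : MDP S A) (s₀ : S) (w₀ : W)
          (O : Matrix.unitaryGroup (S × A × S × W) ℂ) (π₀ : S → A) (ε δ : ℝ),
          IsGenerativeModel M s₀ w₀ O →
          0 < ε → ε ≤ Real.sqrt (horizon M.γ) → 0 < δ → δ < 1 →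
          (∀ ω ∈ (runSolveMdp1 E₁ E₂ M s₀ w₀ O ε δ π₀).support,
            (ω.queries : ℝ) ≤
              C * (Fintype.card S * Fintype.card A *
                (horizon M.γ ^ (3 / 2 : ℝ) / ε + horizon M.γ ^ 2)) *
                logp (horizon M.γ / ε) ^ 4 *
                logp (Fintype.card S * Fintype.card A * horizon M.γ / δ)) ∧
          ENNReal.ofReal (1 - δ) ≤
            (runSolveMdp1 E₁ E₂ M s₀ w₀ O ε δ π₀).toOuterMeasure {ω | ω.AllCorrect M}) ∧
      (∀ κ : ℝ, 0 < κ → ∃ C : ℝ, 0 < C ∧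
        ∀ (S A W : Type) [Fintype S] [DecidableEq S] [Fintype A] [DecidableEq A] [Nonempty A]
          [Fintype W] [DecidableEq W] (M : MDP S A) (s₀ : S) (w₀ : W)
          (O : Matrix.unitaryGroup (S × A × S × W) ℂ) (π₀ : S → A) (ε δ : ℝ),
          IsGenerativeModel M s₀ w₀ O →
          0 < ε → ε ≤ Real.sqrt (horizon M.γ) → ε ≤ κ / Real.sqrt (horizon M.γ) →
          0 < δ → δ < 1 →
          ∀ ω ∈ (runSolveMdp1 E₁ E₂ M s₀ w₀ O ε δ π₀).support,
            (ω.queries : ℝ) ≤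
              C * (Fintype.card S * Fintype.card A * horizon M.γ ^ (3 / 2 : ℝ) / ε) *
                logp (horizon M.γ / ε) ^ 4 *
                logp (Fintype.card S * Fintype.card A * horizon M.γ / δ)) := by
  have h₁ : IsQEst1 20000000 qEst1 := isQEst1_qEst1.mono (by norm_num)
  have h₂ : IsQEst2 20000000 qEst2 := isQEst2_qEst2
  have hc : (0 : ℝ) < 20000000 := by norm_num
  refine ⟨qEst1, qEst2, 20000000, hc, h₁, h₂,
    ⟨400000 * 20000000, by norm_num, ?_⟩, fun κ hκ => ⟨400000 * 20000000 * (1 + κ), by positivity, ?_⟩⟩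
  · intro S A W _ _ _ _ _ _ _ M s₀ w₀ O π₀ ε δ hO hε hεΓ hδ0 hδ1
    exact ⟨fun ω hω => queries_runSolveMdp1_le h₁ h₂ hc π₀ hε hεΓ hδ0 hδ1 hω,
      le_prob_allCorrect h₁ h₂ hO π₀ hε hεΓ hδ0 hδ1⟩
  · intro S A W _ _ _ _ _ _ _ M s₀ w₀ O π₀ ε δ hO hε hεΓ hεκ hδ0 hδ1 ω hω
    refine (queries_runSolveMdp1_le h₁ h₂ hc π₀ hε hεΓ hδ0 hδ1 hω).trans ?_
    have hΓ := M.one_le_horizon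
    have hs : 0 < Real.sqrt (horizon M.γ) := Real.sqrt_pos.2 (by linarith)
    -- As Γ² = Γ^1.5 √Γ, this is exactly the condition ε√Γ ≤ κ. It produces the factor 1 + κ in the
    -- constant.
    have h3 : horizon M.γ ^ 2 ≤ κ * (horizon M.γ ^ (3 / 2 : ℝ) / ε) := by
      rw [le_div_iff₀ hs] at hεκ
      rw [horizon_rpow, ← mul_div_assoc, le_div_iff₀ hε]
      calc horizon M.γ ^ 2 * ε = horizon M.γ * (Real.sqrt (horizon M.γ) *
            Real.sqrt (horizon M.γ)) * ε := by
            rw [Real.mul_self_sqrt (by linarith)]; ring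
        _ = horizon M.γ * Real.sqrt (horizon M.γ) * (ε * Real.sqrt (horizon M.γ)) := by ring
        _ ≤ horizon M.γ * Real.sqrt (horizon M.γ) * κ := by gcongr
        _ = _ := by ring
    have hl := logp_nonneg (horizon M.γ / ε)
    have hΛ := logp_nonneg (Fintype.card S * Fintype.card A * horizon M.γ / δ)
    refine mul_le_mul_of_nonneg_right (mul_le_mul_of_nonneg_right ?_ (by positivity)) hΛ
    calc (400000 * 20000000 : ℝ) * (Fintype.card S * Fintype.card A *
          (horizon M.γ ^ (3 / 2 : ℝ) / ε + horizon M.γ ^ 2))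
        ≤ 400000 * 20000000 * (Fintype.card S * Fintype.card A *
          (horizon M.γ ^ (3 / 2 : ℝ) / ε + κ * (horizon M.γ ^ (3 / 2 : ℝ) / ε))) := by gcongr
      _ = _ := by ring
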